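/- **Setting.** Let $\rho_1,\rho_2,B$ be nonzero real numbers. Work in the algebra of differential polynomials, i.e. polynomials over $\mathbb C$ in the independent symbols $\partial_\xi^k u(j)$, $\partial_\xi^k\bar u(j)$ ($k\ge 0$, $j\ge1$), with total derivative $\partial_\xi$ and complex conjugation. Put, with $u=u(1)$, $$K_2[u]=-i\rho_1\Big[u_{\xi\xi}+\frac{\rho_2}{\rho_1}|u|^2u\Big],\qquad K_3[u]=B\Big[u_{\xi\xi\xi}+\frac{3\rho_2}{\rho_1}|u|^2u_\xi\Big],$$ and let $K_\sigma'[u]v=\frac{d}{ds}K_\sigma[u+sv]\big|_{s=0}$ ($s$ real) be the Fréchet derivative. For forcing terms $f_\sigma(j)$ ($\sigma=2,3$) set $M_\sigma=\partial_{t_\sigma}-K_\sigma'[u(1)]$, where $\partial_{t_\sigma}$ acts on differential polynomials as the derivation that commutes with $\partial_\xi$ and conjugation and is given by $\partial_{t_\sigma}u(1)=K_\sigma[u(1)]$, $\partial_{t_\sigma}u(j)=K_\sigma'[u(1)]u(j)+f_\sigma(j)$ for $j\ge2$. Give $\partial_\xi^k u(j)$ and $\partial_\xi^k\bar u(j)$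 the order $k+j$ and the charge $+1$, respectively $-1$, and let $\mathcal P_\ell(J)$ be the complex span of the monomials of degree at least $2$, total order $\ell$ and total charge $1$ in the $\partial_\xi^ku(j),\partial_\xi^k\bar u(j)$ with $1\le j\le J$. Let $$f_2(2)=a\,|u(1)|^2u_\xi(1)+b\,u(1)^2\bar u_\xi(1),$$ $$f_2(3)=\tau_{1}\,u(1)^{3}\,\bar u(1)^{2} + \tau_{2}\,u(1)\,u_{\xi}(1)\,\bar u_{\xi}(1) + \tau_{3}\,u(1)\,\bar u(1)\,u_{\xi\xi}(1) + \tau_{4}\,u(1)^{2}\,\bar u_{\xi\xi}(1) + \tau_{5}\,\bar u(1)\,u_{\xi}(1)^{2} + \tau_{6}\,u(1)\,\bar u(1)\,u_{\xi}(2) + \tau_{7}\,u(1)^{2}\,\bar u_{\xi}(2) + \tau_{8}\,\bar u(1)\,u(2)^{2} + \tau_{9}\,u(1)\,u(2)\,\bar u(2) + \tau_{10}\,\bar u(1)\,u_{\xi}(1)\,u(2) + \tau_{11}\,u(1)\,\bar u_{\xi}(1)\,u(2) + \tau_{12}\,u(1)\,u_{\xi}(1)\,\bar u(2),$$ $$f_2(4)=\eta_{1}\,u(1)^{2}\,\bar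 u(1)^{2}\,u_{\xi}(1) + \eta_{2}\,u(1)^{3}\,\bar u(1)\,\bar u_{\xi}(1) + \eta_{3}\,u(1)\,\bar u(1)\,u_{\xi\xi\xi}(1) + \eta_{4}\,u(1)^{2}\,\bar u_{\xi\xi\xi}(1) + \eta_{5}\,u_{\xi}(1)^{2}\,\bar u_{\xi}(1) + \eta_{6}\,u(1)\,u_{\xi}(1)\,\bar u_{\xi\xi}(1) + \eta_{7}\,u(1)\,\bar u_{\xi}(1)\,u_{\xi\xi}(1) + \eta_{8}\,\bar u(1)\,u_{\xi}(1)\,u_{\xi\xi}(1) + \eta_{9}\,u(1)^{2}\,\bar u(1)^{2}\,u(2) + \eta_{10}\,u(1)^{3}\,\bar u(1)\,\bar u(2) + \eta_{11}\,\bar u_{\xi}(1)\,u(2)^{2} + \eta_{12}\,u_{\xi}(1)\,u(2)\,\bar u(2) + \eta_{13}\,u_{\xi}(1)\,\bar u_{\xi}(1)\,u(2) + \eta_{14}\,u(2)^{2}\,\bar u(2) + \eta_{15}\,u_{\xi}(1)^{2}\,\bar u(2) + \eta_{16}\,u(1)\,\bar u(1)\,u_{\xi\xi}(2) + \eta_{17}\,u(1)^{2}\,\bar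 u_{\xi\xi}(2) + \eta_{18}\,u(1)\,\bar u_{\xi\xi}(1)\,u(2) + \eta_{19}\,\bar u(1)\,u_{\xi\xi}(1)\,u(2) + \eta_{20}\,u(1)\,u_{\xi\xi}(1)\,\bar u(2) + \eta_{21}\,\bar u(1)\,u(2)\,u_{\xi}(2) + \eta_{22}\,u(1)\,\bar u(2)\,u_{\xi}(2) + \eta_{23}\,\bar u(1)\,u_{\xi}(1)\,u_{\xi}(2) + \eta_{24}\,u(1)\,\bar u_{\xi}(1)\,u_{\xi}(2) + \eta_{25}\,u(1)\,u_{\xi}(1)\,\bar u_{\xi}(2) + \eta_{26}\,u(1)\,u(2)\,\bar u_{\xi}(2) + \eta_{27}\,u(1)\,\bar u_{\xi}(1)\,u(3) + \eta_{28}\,\bar u(1)\,u_{\xi}(1)\,u(3) + \eta_{29}\,u(1)\,u_{\xi}(1)\,\bar u(3) + \eta_{30}\,u(1)\,\bar u(2)\,u(3) + \eta_{31}\,\bar u(1)\,u(2)\,u(3) + \eta_{32}\,u(1)\,u(2)\,\bar u(3) + \eta_{33}\,u(1)\,\bar u(1)\,u_{\xi}(3) + \eta_{34}\,u(1)^{2}\,\bar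 u_{\xi}(3)$$ with complex coefficients $a,b,\tau_1,\dots,\tau_{12},\eta_1,\dots,\eta_{34}$ (these are the general elements of $\mathcal P_4(1)$, $\mathcal P_5(2)$, $\mathcal P_6(3)$), and let $f_3(2)\in\mathcal P_5(1)$ (5 complex coefficients) and $f_3(3)\in\mathcal P_6(2)$ (26 complex coefficients). Assume that the lower-order compatibility conditions $M_2f_3(2)=M_3f_2(2)$ and $M_2f_3(3)=M_3f_2(3)$ hold (so that, in particular, $a,b$ are real). Write $\tau_j=R_j+iI_j$ and $\eta_j=S_j+iT_j$ with $R_j,I_j,S_j,T_j$ real. **Statement.** There is $f_3(4)\in\mathcal P_7(3)$ (a space with a basis of 77 monomials) satisfying the compatibility condition $$M_2f_3(4)=M_3f_2(4)$$ if and only if the following 48 real relations hold. Moreover $f_3(4)$ (that is, each of its 77 complex coefficients) is then uniquely determined. 1. $T_{2}=\left(\frac{a}{11}+\frac{3 b}{4}\right) \frac{S_{10}}{\rho_2}+\left(\frac{13 a}{11}+\frac{b}{2}\right) \frac{S_{18}-S_{15}}{2 \rho_1}+\left(\frac{37 a}{11}+b\right) \frac{I_{6} S_{27}}{8 \rho_1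 \rho_2}+T_{1}+\left(\frac{a^{2}}{2}+\frac{13 a b}{11}+\frac{b^{2}}{2}\right) \frac{T_{22}}{4 \rho_1 \rho_2}+\left(I_{1}+\left(37 a^{2}-15 a b-11 b^{2}\right) \frac{I_{8}}{44 \rho_1 \rho_2}\right) \frac{T_{27}}{2 \rho_2}+\left(\left(\frac{13 a}{11}+\frac{b}{2}\right) \frac{R_{2}}{8}-\left(32 a^{2}+27 a b-189 b^{2}\right) \frac{I_{6}}{352 \rho_2}+\left(\frac{a}{11}+\frac{b}{4}\right) \frac{a I_{12}}{8 \rho_2}\right) \frac{T_{32}}{\rho_1 \rho_2}-\left(\left(9 a-\frac{7 b}{2}\right) \frac{R_{12}}{22 \rho_1 \rho_2}+\frac{I_{1}}{\rho_2}+\frac{7 I_{2}-29 I_{3}-14 I_{5}}{44 \rho_1}+\left(39 a^{2}-53 a b+\frac{67 b^{2}}{2}\right) \frac{I_{8}}{44 \rho_1 \rho_2^{2}}\right) \frac{T_{33}}{2}$ 2. $T_{3}=\frac{a}{2 \rho_2} \left(-\frac{\rho_1}{\rho_2} S_{10}+S_{15}-S_{18}+S_{20}\right)-\left(a-\frac{b}{2}\right)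 \frac{I_{6} S_{27}}{2 \rho_2^{2}}-\frac{a b T_{22}}{4 \rho_2^{2}}+\left(\frac{a R_{12}}{2 \rho_2}-I_{3}-\left(a-b\right) \frac{a I_{8}}{2 \rho_2^{2}}\right) \frac{T_{27}}{2 \rho_2}-\left(R_{2}+\frac{\left(3 a+b\right) I_{6}+a I_{12}}{2 \rho_2}\right) \frac{a T_{32}}{8 \rho_2^{2}}-\left(\left(3 a+b\right) \frac{R_{12}}{4 \rho_2}+\frac{\rho_1 I_{1}}{\rho_2}-\frac{I_{2}+3 I_{3}+2 I_{5}}{4}-\left(a^{2}-3 a b+2 b^{2}\right) \frac{I_{8}}{4 \rho_2^{2}}\right) \frac{T_{33}}{2 \rho_2}$ 3. $T_{4}=\left(\frac{35 a}{33}+\frac{b}{2}\right) \frac{\rho_1 S_{10}}{2 \rho_2^{2}}-\left(\frac{35 a}{33}-\frac{b}{2}\right) \frac{S_{15}}{2 \rho_2}+\left(\frac{34 a}{33}+\frac{b}{4}\right) \frac{S_{18}}{\rho_2}-\frac{a S_{20}}{2 \rho_2}+\left(\frac{R_{2}}{2}+\frac{67 a I_{6}}{33 \rho_2}+\left(\frac{a}{2}+b\right)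 \frac{I_{12}}{2 \rho_2}\right) \frac{S_{27}}{2 \rho_2}+\frac{\rho_1 T_{1}}{\rho_2}+\left(\frac{a^{2}}{2}+\frac{101 a b}{33}+\frac{b^{2}}{2}\right) \frac{T_{22}}{4 \rho_2^{2}}+\left(-\left(a-b\right) \frac{R_{12}}{8 \rho_2}+\frac{\rho_1 I_{1}}{\rho_2}-\frac{I_{2}-I_{3}-2 I_{5}}{8}+\left(\frac{17 a^{2}}{33}-\frac{103 a b}{264}+\frac{b^{2}}{8}\right) \frac{I_{8}}{\rho_2^{2}}\right) \frac{T_{27}}{\rho_2}+\left(\left(\frac{101 a}{33}+\frac{3 b}{2}\right) \frac{R_{2}}{2}-\left(\frac{19 a^{2}}{3}+\frac{97 a b}{4}-\frac{591 b^{2}}{4}\right) \frac{I_{6}}{22 \rho_2}+\left(\frac{17 a^{2}}{33}+\frac{3 a b}{8}+\frac{b^{2}}{2}\right) \frac{I_{12}}{\rho_2}\right) \frac{T_{32}}{4 \rho_2^{2}}+\left(\left(\frac{37 a}{2}-35 b\right) \frac{R_{12}}{66 \rho_2}+\frac{35 I_{2}-2 I_{3}-70 I_{5}}{66}-\left(\frac{25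 a^{2}}{3}-\frac{317 a b}{6}+\frac{323 b^{2}}{4}\right) \frac{I_{8}}{22 \rho_2^{2}}\right) \frac{T_{33}}{2 \rho_2}$ 4. $S_{5}=-\frac{\rho_1}{\rho_2} \left(S_{1}+\frac{3 S_{2}}{2}\right)+\frac{9}{2} \left(S_{3}+S_{4}\right)-S_{6}+\frac{S_{7}}{2}-\left(a^{2}+\frac{7 a b}{2}+\frac{b^{2}}{4}\right) \frac{S_{22}}{2 \rho_2^{2}}+\left(-\left(5 a-7 b\right) \frac{R_{12}}{16 \rho_2}-\frac{7 \rho_1 I_{1}}{4 \rho_2}-\frac{7 I_{2}-35 I_{3}+18 I_{5}}{16}-\left(\frac{7 a}{16}+b\right) \frac{a I_{8}}{\rho_2^{2}}\right) \frac{S_{27}}{\rho_2}+\left(a+7 b\right) \frac{\rho_1 T_{10}}{4 \rho_2^{2}}+\left(a-\frac{5 b}{2}\right) \frac{T_{15}}{2 \rho_2}+\left(a+\frac{3 b}{2}\right) \frac{T_{18}}{2 \rho_2}+\left(a+b\right) \frac{T_{20}}{4 \rho_2}-\left(3 R_{2}+\left(a-23 b\right) \frac{I_{6}}{2 \rho_2}+\left(\frac{a}{2}+b\right)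 \frac{3 I_{12}}{\rho_2}\right) \frac{T_{27}}{8 \rho_2}+\left(\left(\frac{a^{2}}{2}-a b+3 b^{2}\right) \frac{R_{12}}{8 \rho_2}+\frac{\rho_1 a I_{1}}{\rho_2}+\frac{\left(3 a-5 b\right) I_{2}+\left(a+39 b\right) I_{3}}{16}+\left(\frac{a}{4}-b\right) \frac{I_{5}}{2}+\left(\frac{a \left(5 a+13 b\right)}{2}-11 b^{2}\right) \frac{a I_{8}}{8 \rho_2^{2}}\right) \frac{T_{32}}{\rho_2^{2}}-\left(7 R_{2}+\left(7 a+15 b\right) \frac{I_{6}}{2 \rho_2}+\left(\frac{a}{2}+b\right) \frac{7 I_{12}}{\rho_2}\right) \frac{T_{33}}{8 \rho_2}$ 5. $T_{5}=-\left(\frac{31 a}{11}-3 b\right) \frac{\rho_1 S_{10}}{4 \rho_2^{2}}+\left(\frac{31 a}{11}-5 b\right) \frac{S_{15}}{4 \rho_2}-\left(\frac{53 a}{11}-3 b\right) \frac{S_{18}}{4 \rho_2}+\left(a-\frac{b}{2}\right) \frac{S_{20}}{\rho_2}-\left(\frac{R_{2}}{2}+\left(\frac{97 a}{44}-b\right)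 \frac{I_{6}}{\rho_2}+\left(\frac{a}{2}+b\right) \frac{I_{12}}{2 \rho_2}\right) \frac{S_{27}}{2 \rho_2}-\frac{\rho_1 T_{1}}{\rho_2}+T_{6}-\left(3 a^{2}+\frac{31 a b}{11}-b^{2}\right) \frac{T_{22}}{8 \rho_2^{2}}+\left(\left(a-\frac{b}{2}\right) \frac{R_{12}}{2 \rho_2}-\frac{\rho_1 I_{1}}{2 \rho_2}+\frac{I_{2}-I_{3}-4 I_{5}}{4}-\left(\frac{a \left(8 a-19 b\right)}{11}+\frac{9 b^{2}}{8}\right) \frac{I_{8}}{\rho_2^{2}}\right) \frac{T_{27}}{\rho_2}-\left(\left(\frac{75 a}{11}-b\right) R_{2}+\left(\frac{49 a^{2}}{2}-205 a b+\frac{615 b^{2}}{2}\right) \frac{I_{6}}{11 \rho_2}+\left(\frac{9 a}{11}+7 b\right) \frac{a I_{12}}{2 \rho_2}\right) \frac{T_{32}}{16 \rho_2^{2}}-\left(\left(\frac{9 a}{2}+b\right) \frac{R_{12}}{44 \rho_2}+\frac{\rho_1 I_{1}}{2 \rho_2}-\frac{I_{2}-12 I_{3}+20 I_{5}}{44}-\left(13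 a^{2}-\frac{\left(585 a-533 b\right) b}{8}\right) \frac{I_{8}}{22 \rho_2^{2}}\right) \frac{T_{33}}{\rho_2}$ 6. $T_{7}=-\left(\frac{23 a}{11}+\frac{b}{2}\right) \frac{\rho_1 S_{10}}{\rho_2^{2}}+\left(\frac{23 a}{11}-\frac{b}{2}\right) \frac{S_{15}}{\rho_2}-\left(\frac{34 a}{11}+\frac{b}{2}\right) \frac{S_{18}}{\rho_2}+\frac{3 a S_{20}}{2 \rho_2}-\left(R_{2}+\left(\frac{123 a}{11}-b\right) \frac{I_{6}}{2 \rho_2}+\left(\frac{a}{2}+b\right) \frac{I_{12}}{\rho_2}\right) \frac{S_{27}}{2 \rho_2}-\frac{2 \rho_1 T_{1}}{\rho_2}+T_{6}-\left(\frac{a^{2}}{2}+\frac{45 a b}{11}+\frac{b^{2}}{2}\right) \frac{T_{22}}{2 \rho_2^{2}}+\left(\left(a-\frac{b}{2}\right) \frac{R_{12}}{2 \rho_2}-\frac{2 \rho_1 I_{1}}{\rho_2}+\frac{I_{2}-3 I_{3}-2 I_{5}}{4}-\left(\frac{17 a^{2}}{11}-\frac{57 a b}{44}+\frac{b^{2}}{4}\right)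 \frac{I_{8}}{\rho_2^{2}}\right) \frac{T_{27}}{\rho_2}-\left(3 \left(\frac{15 a}{11}+\frac{b}{2}\right) R_{2}+\left(47 a^{2}-\frac{\left(107 a-815 b\right) b}{2}\right) \frac{I_{6}}{22 \rho_2}+\left(\frac{17 a^{2}}{11}+\frac{3 a b}{4}+b^{2}\right) \frac{I_{12}}{\rho_2}\right) \frac{T_{32}}{4 \rho_2^{2}}-\left(\left(81 a-59 b\right) \frac{R_{12}}{44 \rho_2}+\frac{\rho_1 I_{1}}{\rho_2}+\frac{59 \left(I_{2}-I_{3}\right)-162 I_{5}}{44}-\left(\frac{105 a^{2}}{4}-71 a b+\frac{457 b^{2}}{4}\right) \frac{I_{8}}{11 \rho_2^{2}}\right) \frac{T_{33}}{2 \rho_2}$ 7. $S_{8}=-\frac{2 \rho_1 S_{2}}{\rho_2}+3 S_{3}+6 S_{4}-2 S_{6}+S_{7}-\left(\frac{a^{2}}{2}+a b+\frac{b^{2}}{2}\right) \frac{S_{22}}{\rho_2^{2}}+\left(\left(a+b\right) \frac{R_{12}}{4 \rho_2}-\frac{\rho_1 I_{1}}{\rho_2}-\frac{I_{2}-5 I_{3}+6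 I_{5}}{4}-\left(\frac{a}{4}+b\right) \frac{a I_{8}}{\rho_2^{2}}\right) \frac{S_{27}}{\rho_2}+\left(a+b\right) \frac{\rho_1 T_{10}}{\rho_2^{2}}-\frac{b}{\rho_2} \left(T_{15}-T_{18}\right)-\left(R_{2}+\left(a-5 b\right) \frac{I_{6}}{2 \rho_2}+\left(\frac{a}{2}+b\right) \frac{I_{12}}{\rho_2}\right) \frac{T_{27}}{2 \rho_2}+\left(a \left(a+b\right) \frac{R_{12}}{4 \rho_2}+\frac{\rho_1 a I_{1}}{\rho_2}+\frac{b \left(I_{2}+5 I_{3}-4 I_{5}\right)}{4}+a \left(\frac{a^{2}}{2}+\frac{a b}{4}-b^{2}\right) \frac{I_{8}}{\rho_2^{2}}\right) \frac{T_{32}}{\rho_2^{2}}-\left(R_{2}+\left(a+3 b\right) \frac{I_{6}}{2 \rho_2}+\left(\frac{a}{2}+b\right) \frac{I_{12}}{\rho_2}\right) \frac{T_{33}}{2 \rho_2}$ 8. $T_{8}=-\left(\frac{31 a}{11}-b\right) \frac{\rho_1 S_{10}}{2 \rho_2^{2}}+\left(\frac{31 a}{11}-3 b\right) \frac{S_{15}}{2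 \rho_2}-\left(\frac{53 a}{11}-b\right) \frac{S_{18}}{2 \rho_2}+\left(2 a-b\right) \frac{S_{20}}{\rho_2}-\left(R_{2}+\left(\frac{97 a}{22}-b\right) \frac{I_{6}}{\rho_2}+\left(\frac{a}{2}+b\right) \frac{I_{12}}{\rho_2}\right) \frac{S_{27}}{2 \rho_2}-\frac{2 \rho_1 T_{1}}{\rho_2}+T_{6}-\left(a^{2}+\frac{75 a b}{11}-b^{2}\right) \frac{T_{22}}{4 \rho_2^{2}}+\left(\left(a-b\right) \frac{3 R_{12}}{4 \rho_2}-\frac{2 \rho_1 I_{1}}{\rho_2}+\frac{3 \left(I_{2}-I_{3}-2 I_{5}\right)}{4}-\left(\frac{53 a^{2}}{44}-\frac{16 a b}{11}+\frac{3 b^{2}}{4}\right) \frac{I_{8}}{\rho_2^{2}}\right) \frac{T_{27}}{\rho_2}-\left(\left(\frac{75 a}{11}+b\right) \frac{R_{2}}{8}-\left(\frac{39 a^{2}}{16}+5 a b-\frac{461 b^{2}}{16}\right) \frac{I_{6}}{11 \rho_2}+\left(\frac{53 a^{2}}{44}+\frac{a b}{4}+b^{2}\right) \frac{I_{12}}{4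 \rho_2}\right) \frac{T_{32}}{\rho_2^{2}}-\left(\left(5 a-\frac{31 b}{4}\right) \frac{R_{12}}{11 \rho_2}+\frac{31 I_{2}-9 I_{3}-62 I_{5}}{44}-\left(19 a^{2}-\frac{\left(255 a-313 b\right) b}{2}\right) \frac{I_{8}}{44 \rho_2^{2}}\right) \frac{T_{33}}{\rho_2}$ 9. $S_{9}=\frac{S_{10}}{2}-\frac{\rho_2}{2 \rho_1} \left(S_{15}-S_{18}\right)+\frac{I_{6} S_{27}+b T_{22}}{4 \rho_1}+\left(a-b\right) \frac{I_{8} T_{27}}{4 \rho_1 \rho_2}+\left(R_{2}+\frac{\left(3 a-7 b\right) I_{6}+a I_{12}}{2 \rho_2}\right) \frac{T_{32}}{8 \rho_1}+\frac{3 b I_{8} T_{33}}{4 \rho_1 \rho_2}$ 10. $T_{9}=T_{10}-\frac{I_{1} T_{32}}{2 \rho_2}-\frac{I_{6} T_{33}}{4 \rho_1}$ 11. $S_{11}=\frac{S_{22}}{2}-\left(\frac{R_{12}}{2}+\left(a-b\right) \frac{I_{8}}{\rho_2}\right) \frac{T_{32}}{2 \rho_2}$ 12. $T_{11}=T_{22}+\frac{I_{8}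 T_{27}-\left(I_{6}+I_{12}\right) T_{32}}{2 \rho_2}$ 13. $S_{12}=-\frac{I_{8} S_{27}}{\rho_2}+\left(\frac{a}{2}-b\right) \frac{I_{8} T_{32}}{\rho_2^{2}}$ 14. $T_{12}=-\frac{I_{8} \left(T_{27}-T_{33}\right)}{\rho_2}$ 15. $S_{13}=-\frac{2 \rho_1 S_{10}}{\rho_2}+2 S_{15}-S_{18}+S_{20}-\frac{I_{6} S_{27}}{\rho_2}-\frac{a T_{22}}{\rho_2}-2 \left(a-b\right) \frac{I_{8} T_{27}}{\rho_2^{2}}-\left(R_{2}+\left(5 a-7 b\right) \frac{I_{6}}{2 \rho_2}-\left(\frac{a}{2}-b\right) \frac{I_{12}}{\rho_2}\right) \frac{T_{32}}{2 \rho_2}+\left(3 a-4 b\right) \frac{I_{8} T_{33}}{\rho_2^{2}}$ 16. $T_{13}=T_{18}+T_{20}+\left(\left(a+b\right) \frac{R_{12}}{4 \rho_2}+\frac{\rho_1 I_{1}}{\rho_2}-\frac{I_{2}-I_{3}+2 I_{5}}{4}+\left(\frac{a^{2}}{2}+a b-b^{2}\right) \frac{I_{8}}{2 \rho_2^{2}}\right)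 \frac{T_{32}}{\rho_2}$ 17. $S_{14}=0$ 18. $T_{14}=-\frac{I_{8} T_{32}}{2 \rho_2}$ 19. $S_{16}=-\frac{I_{6} S_{27}+a T_{22}}{2 \rho_2}+\left(a-\frac{3 b}{2}\right) \frac{I_{6} T_{32}}{2 \rho_2^{2}}+\frac{R_{12} T_{33}}{2 \rho_2}$ 20. $T_{16}=\frac{a S_{22}-I_{6} T_{27}}{2 \rho_2}+\left(\frac{a R_{12}}{2 \rho_2}-I_{3}\right) \frac{T_{32}}{2 \rho_2}+\left(I_{6}+I_{12}\right) \frac{T_{33}}{2 \rho_2}$ 21. $S_{17}=S_{15}+\frac{I_{12} S_{27}}{2 \rho_2}-\left(a-b\right) \frac{I_{8} T_{27}}{2 \rho_2^{2}}+\left(\left(-2 a+3 b\right) I_{6}+b I_{12}\right) \frac{T_{32}}{4 \rho_2^{2}}+\left(a-\frac{5 b}{4}\right) \frac{I_{8} T_{33}}{\rho_2^{2}}$ 22. $T_{17}=-\frac{a S_{22}}{2 \rho_2}+\left(R_{12}-\frac{b I_{8}}{\rho_2}\right) \frac{S_{27}}{2 \rho_2}+\frac{\rho_1 T_{10}}{\rho_2}+\left(\left(a+3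 b\right) \frac{R_{12}}{4 \rho_2}+\frac{\rho_1 I_{1}}{\rho_2}-\frac{I_{2}-I_{3}-2 I_{5}}{4}+\left(\frac{3 a^{2}}{2}-a b-b^{2}\right) \frac{I_{8}}{2 \rho_2^{2}}\right) \frac{T_{32}}{2 \rho_2}$ 23. $S_{19}=S_{20}$ 24. $T_{19}=T_{20}$ 25. $S_{21}=S_{22}$ 26. $T_{21}=T_{22}$ 27. $S_{23}=-\frac{2 \rho_1 S_{10}}{\rho_2}+2 S_{15}-S_{18}+S_{20}-\left(I_{6}-\frac{I_{12}}{2}\right) \frac{S_{27}}{\rho_2}-\left(a+b\right) \frac{T_{22}}{2 \rho_2}+\left(R_{12}-\left(a-b\right) \frac{I_{8}}{\rho_2}\right) \frac{T_{27}}{2 \rho_2}-\left(R_{2}-\left(\frac{a}{2}-3 b\right) \frac{I_{6}}{\rho_2}+\left(a-b\right) \frac{I_{12}}{2 \rho_2}\right) \frac{T_{32}}{2 \rho_2}-\left(R_{12}-\frac{3 b I_{8}}{2 \rho_2}\right) \frac{T_{33}}{2 \rho_2}$ 28. $T_{23}=\left(a-\frac{b}{2}\right) \frac{S_{22}}{\rho_2}-\left(R_{12}-\frac{b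 I_{8}}{\rho_2}\right) \frac{S_{27}}{2 \rho_2}-\frac{\rho_1 T_{10}}{\rho_2}+T_{15}+T_{18}+\frac{I_{12} T_{27}}{2 \rho_2}+\left(\left(\frac{a}{2}-b\right) \frac{R_{12}}{\rho_2}+\frac{I_{2}-I_{3}-4 I_{5}}{2}\right) \frac{T_{32}}{2 \rho_2}-\left(\frac{a}{2}-b\right) \frac{a I_{8} T_{32}}{2 \rho_2^{3}}-\frac{I_{12} T_{33}}{2 \rho_2}$ 29. $S_{24}=S_{18}+S_{20}-\frac{\left(I_{6}-I_{12}\right) S_{27}+b T_{22}}{2 \rho_2}+\left(R_{12}+\left(a-b\right) \frac{I_{8}}{\rho_2}\right) \frac{T_{27}}{2 \rho_2}+\left(\left(a-\frac{3 b}{2}\right) I_{6}+\frac{b I_{12}}{4}\right) \frac{T_{32}}{\rho_2^{2}}-\left(a-\frac{5 b}{4}\right) \frac{I_{8} T_{33}}{\rho_2^{2}}$ 30. $T_{24}=\left(a+b\right) \frac{S_{22}}{2 \rho_2}+\left(-R_{12}+\frac{b I_{8}}{\rho_2}\right) \frac{S_{27}}{2 \rho_2}-\frac{\rho_1 T_{10}}{\rho_2}+T_{15}+T_{18}-\left(I_{6}-I_{12}\right)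 \frac{T_{27}}{2 \rho_2}-\left(\frac{I_{2}+I_{3}}{2}+\left(\frac{a}{2}-b\right) \frac{a I_{8}}{\rho_2^{2}}\right) \frac{T_{32}}{2 \rho_2}+\frac{I_{6} T_{33}}{2 \rho_2}$ 31. $S_{25}=2 S_{15}+\frac{I_{12} S_{27}}{2 \rho_2}-\left(a-b\right) \frac{T_{22}}{2 \rho_2}-\left(R_{12}+\left(a-b\right) \frac{3 I_{8}}{\rho_2}\right) \frac{T_{27}}{2 \rho_2}-\left(\left(3 a-\frac{13 b}{2}\right) I_{6}-\frac{b I_{12}}{2}\right) \frac{T_{32}}{2 \rho_2^{2}}+\left(\frac{R_{12}}{2}+\left(3 a-\frac{19 b}{4}\right) \frac{I_{8}}{\rho_2}\right) \frac{T_{33}}{\rho_2}$ 32. $T_{25}=-\left(a-\frac{b}{2}\right) \frac{S_{22}}{\rho_2}+\left(R_{12}-\frac{b I_{8}}{\rho_2}\right) \frac{S_{27}}{2 \rho_2}+\frac{\rho_1 T_{10}}{\rho_2}+T_{15}+T_{20}+\frac{I_{12} T_{27}}{2 \rho_2}+\left(\frac{3 b R_{12}}{4 \rho_2}+\frac{\rho_1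 I_{1}}{\rho_2}-\frac{I_{2}-I_{3}-I_{5}}{2}\right) \frac{T_{32}}{\rho_2}+\left(a^{2}-b^{2}\right) \frac{I_{8} T_{32}}{2 \rho_2^{3}}-\frac{I_{12} T_{33}}{2 \rho_2}$ 33. $S_{26}=-\frac{I_{8} S_{27}}{\rho_2}-\left(R_{12}+\frac{a I_{8}}{\rho_2}\right) \frac{T_{32}}{2 \rho_2}$ 34. $T_{26}=T_{22}-\frac{I_{6} T_{32}-I_{8} T_{33}}{\rho_2}$ 35. $S_{28}=S_{27}-\left(\frac{a}{2}-b\right) \frac{T_{32}}{\rho_2}$ 36. $T_{28}=T_{27}-T_{33}$ 37. $S_{29}=S_{27}-\left(\frac{a}{2}-b\right) \frac{T_{32}}{\rho_2}$ 38. $T_{29}=T_{27}-T_{33}$ 39. $S_{30}=0$ 40. $T_{30}=T_{32}$ 41. $S_{31}=0$ 42. $T_{31}=T_{32}$ 43. $S_{32}=0$ 44. $S_{33}=-\frac{a T_{32}}{2 \rho_2}$ 45. $S_{34}=S_{27}+\frac{b T_{32}}{2 \rho_2}$ 46. $T_{34}=0$ 47. $4 a \left(2 \rho_2 \left(\rho_1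 S_{10}-\rho_2 S_{15}+\rho_2 S_{18}\right)+\rho_2 \left(I_{6} S_{27}+b T_{22}\right)+\left(a-b\right) I_{8} T_{27}\right)+a \left(2 \rho_2 R_{2}+\left(a+3 b\right) I_{6}+a I_{12}\right) T_{32}+2 \left(2 \rho_2 \left(a-b\right) R_{12}+2 \rho_2^{2} \left(I_{2}-I_{3}-2 I_{5}\right)+a \left(b-2 a\right) I_{8}\right) T_{33}=0$ 48. $I_{6} T_{32}-I_{8} T_{33}=0$ -/

import Mathlib

open MvPolynomial

namespace MultiscaleNLS

/-- The jet variables: `Jet.u j k` stands for `∂_ξ^k u(j)` and `Jet.ubar j k` for the complex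
conjugate `∂_ξ^k ū(j)`, where `u(j)` is the amplitude of the first harmonic at order `j`. -/
inductive Jet where
  | u (j k : ℕ)
  | ubar (j k : ℕ)
  deriving DecidableEq

/-- Differential polynomials with complex coefficients in the amplitudes `u(j)`, their complex
conjugates and their `ξ`-derivatives. -/
abbrev DiffPoly : Type := MvPolynomial Jet ℂ

/-- `u j k` is `∂_ξ^k u(j)`. -/
noncomputable def u (j k : ℕ) : DiffPoly := X (Jet.u j k)

/-- `ū j k` is `∂_ξ^k ū(j)`. -/
noncomputable def ū (j k : ℕ) : DiffPoly := X (Jet.ubar j k)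

/-- Complex conjugation of differential polynomials: it conjugates the coefficients and exchanges
`∂_ξ^k u(j)` and `∂_ξ^k ū(j)`. -/
noncomputable def bar : DiffPoly →+* DiffPoly :=
  eval₂Hom ((C : ℂ →+* DiffPoly).comp (starRingEnd ℂ)) fun
    | .u j k => ū j k
    | .ubar j k => u j k

/-- The total derivative `∂_ξ`. -/
noncomputable def dξ : Derivation ℂ DiffPoly DiffPoly :=
  mkDerivation ℂ fun
    | .u j k => u j (k + 1)
    | .ubar j k => ū j (k + 1)

/-- The Fréchet derivative `K'[u(1)]v = d/ds K[u(1) + s v]` at `s = 0` (`s` real), for a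
differential polynomial `K` in `u(1)`: by the chain rule it is
`∑ k, (∂K/∂u_k(1)) ∂_ξ^k v + (∂K/∂ū_k(1)) ∂_ξ^k v̄`. -/
noncomputable def frechet (K v : DiffPoly) : DiffPoly :=
  mkDerivation ℂ (fun
    | .u j k => if j = 1 then dξ^[k] v else 0
    | .ubar j k => if j = 1 then dξ^[k] (bar v) else 0) K

/-- The NLS flow `K_2[u] = -i ρ₁ [u_ξξ + (ρ₂/ρ₁) |u|² u]`, evaluated at `u = u(1)`. -/
noncomputable def K2 (ρ₁ ρ₂ : ℝ) : DiffPoly :=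
  C (-Complex.I * ρ₁) * (u 1 2 + C ((ρ₂ / ρ₁ : ℝ) : ℂ) * (u 1 0 * ū 1 0 * u 1 0))

/-- The next flow of the hierarchy, `K_3[u] = B [u_ξξξ + (3 ρ₂/ρ₁) |u|² u_ξ]`, at `u = u(1)`. -/
noncomputable def K3 (ρ₁ ρ₂ B : ℝ) : DiffPoly :=
  C (B : ℂ) * (u 1 3 + C ((3 * ρ₂ / ρ₁ : ℝ) : ℂ) * (u 1 0 * ū 1 0 * u 1 1))

/-- The right-hand sides of the evolution of the amplitudes in a slow time with flow `K` and
forcing terms `f j`: `∂_t u(1) = K[u(1)]` and `∂_t u(j) = K'[u(1)] u(j) + f(j)` for `j ≥ 2`. -/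
noncomputable def rhs (K : DiffPoly) (f : ℕ → DiffPoly) (j : ℕ) : DiffPoly :=
  if j = 1 then K else frechet K (u j 0) + f j

/-- The time derivative of a differential polynomial, with the time derivatives of the amplitudes
eliminated by means of their evolution equations. -/
noncomputable def dt (K : DiffPoly) (f : ℕ → DiffPoly) : Derivation ℂ DiffPoly DiffPoly :=
  mkDerivation ℂ fun
    | .u j k => dξ^[k] (rhs K f j)
    | .ubar j k => dξ^[k] (bar (rhs K f j))

/-- The operator `M = ∂_t - K'[u(1)]` on differential polynomials. -/
noncomputable def M (K : DiffPoly) (f : ℕ → DiffPoly) (p : DiffPoly) : DiffPoly :=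
  dt K f p - frechet K p

/-- The compatibility condition `M_2 f_3(j) = M_3 f_2(j)`, as an identity of differential
polynomials. -/
def Compatible (ρ₁ ρ₂ B : ℝ) (f₂ f₃ : ℕ → DiffPoly) (j : ℕ) : Prop :=
  M (K2 ρ₁ ρ₂) f₂ (f₃ j) = M (K3 ρ₁ ρ₂ B) f₃ (f₂ j)

/-- The sequence of forcing terms `f(2) = p`, `f(3) = q`, `f(4) = r` (the other ones, which do not
enter the compatibility conditions for `j ≤ 4`, are set to `0`). -/
noncomputable def forcing (p q r : DiffPoly) : ℕ → DiffPoly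
  | 2 => p
  | 3 => q
  | 4 => r
  | _ => 0

/-- `f_2(2) = a u_ξ(1) |u(1)|² + b ū_ξ(1) u(1)²`. -/
noncomputable def f22 (a b : ℂ) : DiffPoly :=
  C a * (u 1 0 * ū 1 0 * u 1 1) + C b * (u 1 0 ^ 2 * ū 1 1)

/-- The general form of `f_3(2)`, with 5 complex coefficients. -/
noncomputable def f32 (α : ℕ → ℂ) : DiffPoly :=
  C (α 1) * u 1 0 ^ 3 * ū 1 0 ^ 2 + C (α 2) * u 1 0 * u 1 1 * ū 1 1 + C (α 3) * ū 1 0 * u 1 1 ^ 2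
  + C (α 4) * u 1 0 ^ 2 * ū 1 2 + C (α 5) * u 1 0 * ū 1 0 * u 1 2

/-- The general form of `f_2(3)`, with 12 complex coefficients. -/
noncomputable def f23 (τ : ℕ → ℂ) : DiffPoly :=
  C (τ 1) * u 1 0 ^ 3 * ū 1 0 ^ 2 + C (τ 2) * u 1 0 * u 1 1 * ū 1 1 +
  C (τ 3) * u 1 0 * ū 1 0 * u 1 2 + C (τ 4) * u 1 0 ^ 2 * ū 1 2 + C (τ 5) * ū 1 0 * u 1 1 ^ 2 +
  C (τ 6) * u 1 0 * ū 1 0 * u 2 1 + C (τ 7) * u 1 0 ^ 2 * ū 2 1 + C (τ 8) * ū 1 0 * u 2 0 ^ 2 +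
  C (τ 9) * u 1 0 * u 2 0 * ū 2 0 + C (τ 10) * ū 1 0 * u 1 1 * u 2 0 +
  C (τ 11) * u 1 0 * ū 1 1 * u 2 0 + C (τ 12) * u 1 0 * u 1 1 * ū 2 0

/-- The general form of `f_3(3)`, with 26 complex coefficients. -/
noncomputable def f33 (γ : ℕ → ℂ) : DiffPoly :=
  C (γ 1) * u 1 0 ^ 2 * ū 1 0 ^ 2 * u 1 1 + C (γ 2) * u 1 0 ^ 3 * ū 1 0 * ū 1 1 +
  C (γ 3) * u 1 0 * ū 1 0 * u 1 3 + C (γ 4) * u 1 0 ^ 2 * ū 1 3 + C (γ 5) * u 1 1 ^ 2 * ū 1 1 +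
  C (γ 6) * u 1 0 * u 1 1 * ū 1 2 + C (γ 7) * u 1 0 * ū 1 1 * u 1 2 +
  C (γ 8) * ū 1 0 * u 1 1 * u 1 2 + C (γ 9) * u 1 0 ^ 2 * ū 1 0 ^ 2 * u 2 0 +
  C (γ 10) * u 1 0 ^ 3 * ū 1 0 * ū 2 0 + C (γ 11) * ū 1 1 * u 2 0 ^ 2 +
  C (γ 12) * u 1 1 * u 2 0 * ū 2 0 + C (γ 13) * u 1 1 * ū 1 1 * u 2 0 +
  C (γ 14) * u 2 0 ^ 2 * ū 2 0 + C (γ 15) * u 1 1 ^ 2 * ū 2 0 + C (γ 16) * u 1 0 * ū 1 0 * u 2 2 +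
  C (γ 17) * u 1 0 ^ 2 * ū 2 2 + C (γ 18) * u 1 0 * ū 1 2 * u 2 0 +
  C (γ 19) * ū 1 0 * u 1 2 * u 2 0 + C (γ 20) * u 1 0 * u 1 2 * ū 2 0 +
  C (γ 21) * ū 1 0 * u 2 0 * u 2 1 + C (γ 22) * u 1 0 * ū 2 0 * u 2 1 +
  C (γ 23) * ū 1 0 * u 1 1 * u 2 1 + C (γ 24) * u 1 0 * ū 1 1 * u 2 1 +
  C (γ 25) * u 1 0 * u 1 1 * ū 2 1 + C (γ 26) * u 1 0 * u 2 0 * ū 2 1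

/-- The general form of `f_2(4)`, with 34 complex coefficients. -/
noncomputable def f24 (η : ℕ → ℂ) : DiffPoly :=
  C (η 1) * u 1 0 ^ 2 * ū 1 0 ^ 2 * u 1 1 + C (η 2) * u 1 0 ^ 3 * ū 1 0 * ū 1 1 +
  C (η 3) * u 1 0 * ū 1 0 * u 1 3 + C (η 4) * u 1 0 ^ 2 * ū 1 3 + C (η 5) * u 1 1 ^ 2 * ū 1 1 +
  C (η 6) * u 1 0 * u 1 1 * ū 1 2 + C (η 7) * u 1 0 * ū 1 1 * u 1 2 +
  C (η 8) * ū 1 0 * u 1 1 * u 1 2 + C (η 9) * u 1 0 ^ 2 * ū 1 0 ^ 2 * u 2 0 +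
  C (η 10) * u 1 0 ^ 3 * ū 1 0 * ū 2 0 + C (η 11) * ū 1 1 * u 2 0 ^ 2 +
  C (η 12) * u 1 1 * u 2 0 * ū 2 0 + C (η 13) * u 1 1 * ū 1 1 * u 2 0 +
  C (η 14) * u 2 0 ^ 2 * ū 2 0 + C (η 15) * u 1 1 ^ 2 * ū 2 0 + C (η 16) * u 1 0 * ū 1 0 * u 2 2 +
  C (η 17) * u 1 0 ^ 2 * ū 2 2 + C (η 18) * u 1 0 * ū 1 2 * u 2 0 +
  C (η 19) * ū 1 0 * u 1 2 * u 2 0 + C (η 20) * u 1 0 * u 1 2 * ū 2 0 +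
  C (η 21) * ū 1 0 * u 2 0 * u 2 1 + C (η 22) * u 1 0 * ū 2 0 * u 2 1 +
  C (η 23) * ū 1 0 * u 1 1 * u 2 1 + C (η 24) * u 1 0 * ū 1 1 * u 2 1 +
  C (η 25) * u 1 0 * u 1 1 * ū 2 1 + C (η 26) * u 1 0 * u 2 0 * ū 2 1 +
  C (η 27) * u 1 0 * ū 1 1 * u 3 0 + C (η 28) * ū 1 0 * u 1 1 * u 3 0 +
  C (η 29) * u 1 0 * u 1 1 * ū 3 0 + C (η 30) * u 1 0 * ū 2 0 * u 3 0 +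
  C (η 31) * ū 1 0 * u 2 0 * u 3 0 + C (η 32) * u 1 0 * u 2 0 * ū 3 0 +
  C (η 33) * u 1 0 * ū 1 0 * u 3 1 + C (η 34) * u 1 0 ^ 2 * ū 3 1

/-- The general form of `f_3(4)`, with 77 complex coefficients. -/
noncomputable def f34 (κ : ℕ → ℂ) : DiffPoly :=
  C (κ 1) * u 1 0 ^ 4 * ū 1 0 ^ 3 + C (κ 2) * u 1 0 * ū 1 0 ^ 2 * u 1 1 ^ 2 +
  C (κ 3) * u 1 0 ^ 2 * ū 1 0 * u 1 1 * ū 1 1 + C (κ 4) * u 1 0 ^ 3 * ū 1 1 ^ 2 +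
  C (κ 5) * u 1 0 ^ 2 * ū 1 0 ^ 2 * u 1 2 + C (κ 6) * u 1 0 ^ 3 * ū 1 0 * ū 1 2 +
  C (κ 7) * u 1 1 * ū 1 1 * u 1 2 + C (κ 8) * u 1 1 ^ 2 * ū 1 2 + C (κ 9) * u 1 0 * u 1 2 * ū 1 2
  + C (κ 10) * ū 1 0 * u 1 2 ^ 2 + C (κ 11) * ū 1 0 * u 1 1 * u 1 3 +
  C (κ 12) * u 1 0 * ū 1 1 * u 1 3 + C (κ 13) * u 1 0 * u 1 1 * ū 1 3 +
  C (κ 14) * u 1 0 * ū 1 0 * u 1 4 + C (κ 15) * u 1 0 ^ 2 * ū 1 4 +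
  C (κ 16) * u 1 0 * ū 1 0 ^ 2 * u 2 0 ^ 2 + C (κ 17) * u 1 0 ^ 2 * ū 1 0 * u 2 0 * ū 2 0 +
  C (κ 18) * u 1 0 ^ 3 * ū 2 0 ^ 2 + C (κ 19) * u 1 0 * ū 1 0 ^ 2 * u 1 1 * u 2 0 +
  C (κ 20) * u 1 0 ^ 2 * ū 1 0 * ū 1 1 * u 2 0 + C (κ 21) * u 1 0 ^ 2 * ū 1 0 * u 1 1 * ū 2 0 +
  C (κ 22) * u 1 0 ^ 3 * ū 1 1 * ū 2 0 + C (κ 23) * ū 1 1 * u 1 2 * u 2 0 +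
  C (κ 24) * u 1 1 * ū 1 2 * u 2 0 + C (κ 25) * u 1 1 * u 1 2 * ū 2 0 +
  C (κ 26) * u 1 0 * ū 1 3 * u 2 0 + C (κ 27) * ū 1 0 * u 1 3 * u 2 0 +
  C (κ 28) * u 1 0 * u 1 3 * ū 2 0 + C (κ 29) * ū 1 2 * u 2 0 ^ 2 +
  C (κ 30) * u 1 2 * u 2 0 * ū 2 0 + C (κ 31) * u 1 0 ^ 2 * ū 1 0 ^ 2 * u 2 1 +
  C (κ 32) * u 1 0 ^ 3 * ū 1 0 * ū 2 1 + C (κ 33) * u 1 1 * ū 1 1 * u 2 1 +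
  C (κ 34) * u 1 1 ^ 2 * ū 2 1 + C (κ 35) * ū 1 0 * u 1 2 * u 2 1 +
  C (κ 36) * u 1 0 * ū 1 2 * u 2 1 + C (κ 37) * u 1 0 * u 1 2 * ū 2 1 +
  C (κ 38) * u 1 0 * ū 1 1 * u 2 2 + C (κ 39) * ū 1 0 * u 1 1 * u 2 2 +
  C (κ 40) * u 1 0 * u 1 1 * ū 2 2 + C (κ 41) * u 1 0 * ū 1 0 * u 2 3 +
  C (κ 42) * u 1 0 ^ 2 * ū 2 3 + C (κ 43) * ū 1 1 * u 2 0 * u 2 1 +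
  C (κ 44) * u 1 1 * ū 2 0 * u 2 1 + C (κ 45) * u 1 1 * u 2 0 * ū 2 1 +
  C (κ 46) * u 1 0 * u 2 1 * ū 2 1 + C (κ 47) * ū 1 0 * u 2 1 ^ 2 +
  C (κ 48) * ū 1 0 * u 2 0 * u 2 2 + C (κ 49) * u 1 0 * ū 2 0 * u 2 2 +
  C (κ 50) * u 1 0 * u 2 0 * ū 2 2 + C (κ 51) * u 2 0 * ū 2 0 * u 2 1 +
  C (κ 52) * u 2 0 ^ 2 * ū 2 1 + C (κ 53) * u 1 0 ^ 2 * ū 1 0 ^ 2 * u 3 0 +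
  C (κ 54) * u 1 0 ^ 3 * ū 1 0 * ū 3 0 + C (κ 55) * ū 1 0 * u 3 0 ^ 2 +
  C (κ 56) * u 1 0 * u 3 0 * ū 3 0 + C (κ 57) * u 2 0 * ū 2 0 * u 3 0 +
  C (κ 58) * u 2 0 ^ 2 * ū 3 0 + C (κ 59) * u 1 1 * ū 1 1 * u 3 0 + C (κ 60) * u 1 1 ^ 2 * ū 3 0 +
  C (κ 61) * u 1 0 * ū 1 2 * u 3 0 + C (κ 62) * ū 1 0 * u 1 2 * u 3 0 +
  C (κ 63) * u 1 0 * u 1 2 * ū 3 0 + C (κ 64) * u 1 0 * ū 1 1 * u 3 1 +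
  C (κ 65) * ū 1 0 * u 1 1 * u 3 1 + C (κ 66) * u 1 0 * u 1 1 * ū 3 1 +
  C (κ 67) * u 1 0 * ū 1 0 * u 3 2 + C (κ 68) * u 1 0 ^ 2 * ū 3 2 +
  C (κ 69) * u 1 1 * ū 2 0 * u 3 0 + C (κ 70) * ū 1 1 * u 2 0 * u 3 0 +
  C (κ 71) * u 1 1 * u 2 0 * ū 3 0 + C (κ 72) * ū 1 0 * u 2 1 * u 3 0 +
  C (κ 73) * u 1 0 * ū 2 1 * u 3 0 + C (κ 74) * u 1 0 * u 2 1 * ū 3 0 +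
  C (κ 75) * u 1 0 * ū 2 0 * u 3 1 + C (κ 76) * ū 1 0 * u 2 0 * u 3 1 +
  C (κ 77) * u 1 0 * u 2 0 * ū 3 1

/-- The 48 real relations for the real parts `S j` and imaginary parts `T j` of the coefficients
`η_j` of `f_2(4)`; `R j` and `I j` are the real and imaginary parts of the coefficients `τ_j` of
`f_2(3)`, and `a`, `b` are the (real) coefficients of `f_2(2)`. -/
structure A4Relations (ρ₁ ρ₂ a b : ℝ) (R I S T : ℕ → ℝ) : Prop where
  rel_T2 :
    T 2 = (a / 11 + 3 * b / 4) * S 10 / ρ₂ + (13 * a / 11 + b / 2) * (S 18 - S 15) / (2 * ρ₁) +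
    (37 * a / 11 + b) * I 6 * S 27 / (8 * ρ₁ * ρ₂) + T 1 + (a ^ 2 / 2 + 13 * a * b / 11 + b ^ 2 /
    2) * T 22 / (4 * ρ₁ * ρ₂) + (I 1 + (37 * a ^ 2 - 15 * a * b - 11 * b ^ 2) * I 8 / (44 * ρ₁ *
    ρ₂)) * T 27 / (2 * ρ₂) + ((13 * a / 11 + b / 2) * R 2 / 8 - (32 * a ^ 2 + 27 * a * b - 189 *
    b ^ 2) * I 6 / (352 * ρ₂) + (a / 11 + b / 4) * a * I 12 / (8 * ρ₂)) * T 32 / (ρ₁ * ρ₂) - ((9 *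
    a - 7 * b / 2) * R 12 / (22 * ρ₁ * ρ₂) + I 1 / ρ₂ + (7 * I 2 - 29 * I 3 - 14 * I 5) / (44 *
    ρ₁) + (39 * a ^ 2 - 53 * a * b + 67 * b ^ 2 / 2) * I 8 / (44 * ρ₁ * ρ₂ ^ 2)) * T 33 / 2
  rel_T3 :
    T 3 = a / (2 * ρ₂) * (-ρ₁ / ρ₂ * S 10 + S 15 - S 18 + S 20) - (a - b / 2) * I 6 * S 27 / (2 *
    ρ₂ ^ 2) - a * b * T 22 / (4 * ρ₂ ^ 2) + (a * R 12 / (2 * ρ₂) - I 3 - (a - b) * a * I 8 / (2 *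
    ρ₂ ^ 2)) * T 27 / (2 * ρ₂) - (R 2 + ((3 * a + b) * I 6 + a * I 12) / (2 * ρ₂)) * a * T 32 / (8
    * ρ₂ ^ 2) - ((3 * a + b) * R 12 / (4 * ρ₂) + ρ₁ * I 1 / ρ₂ - (I 2 + 3 * I 3 + 2 * I 5) / 4 -
    (a ^ 2 - 3 * a * b + 2 * b ^ 2) * I 8 / (4 * ρ₂ ^ 2)) * T 33 / (2 * ρ₂)
  rel_T4 :
    T 4 = (35 * a / 33 + b / 2) * ρ₁ * S 10 / (2 * ρ₂ ^ 2) - (35 * a / 33 - b / 2) * S 15 / (2 *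
    ρ₂) + (34 * a / 33 + b / 4) * S 18 / ρ₂ - a * S 20 / (2 * ρ₂) + (R 2 / 2 + 67 * a * I 6 / (33
    * ρ₂) + (a / 2 + b) * I 12 / (2 * ρ₂)) * S 27 / (2 * ρ₂) + ρ₁ * T 1 / ρ₂ + (a ^ 2 / 2 + 101 *
    a * b / 33 + b ^ 2 / 2) * T 22 / (4 * ρ₂ ^ 2) + (-(a - b) * R 12 / (8 * ρ₂) + ρ₁ * I 1 / ρ₂ -
    (I 2 - I 3 - 2 * I 5) / 8 + (17 * a ^ 2 / 33 - 103 * a * b / 264 + b ^ 2 / 8) * I 8 / ρ₂ ^ 2)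
    * T 27 / ρ₂ + ((101 * a / 33 + 3 * b / 2) * R 2 / 2 - (19 * a ^ 2 / 3 + 97 * a * b / 4 - 591 *
    b ^ 2 / 4) * I 6 / (22 * ρ₂) + (17 * a ^ 2 / 33 + 3 * a * b / 8 + b ^ 2 / 2) * I 12 / ρ₂) *
    T 32 / (4 * ρ₂ ^ 2) + ((37 * a / 2 - 35 * b) * R 12 / (66 * ρ₂) + (35 * I 2 - 2 * I 3 - 70 *
    I 5) / 66 - (25 * a ^ 2 / 3 - 317 * a * b / 6 + 323 * b ^ 2 / 4) * I 8 / (22 * ρ₂ ^ 2)) * T 33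
    / (2 * ρ₂)
  rel_S5 :
    S 5 = -ρ₁ / ρ₂ * (S 1 + 3 * S 2 / 2) + 9 / 2 * (S 3 + S 4) - S 6 + S 7 / 2 - (a ^ 2 + 7 * a *
    b / 2 + b ^ 2 / 4) * S 22 / (2 * ρ₂ ^ 2) + (-(5 * a - 7 * b) * R 12 / (16 * ρ₂) - 7 * ρ₁ * I 1
    / (4 * ρ₂) - (7 * I 2 - 35 * I 3 + 18 * I 5) / 16 - (7 * a / 16 + b) * a * I 8 / ρ₂ ^ 2) *
    S 27 / ρ₂ + (a + 7 * b) * ρ₁ * T 10 / (4 * ρ₂ ^ 2) + (a - 5 * b / 2) * T 15 / (2 * ρ₂) + (a +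
    3 * b / 2) * T 18 / (2 * ρ₂) + (a + b) * T 20 / (4 * ρ₂) - (3 * R 2 + (a - 23 * b) * I 6 / (2
    * ρ₂) + (a / 2 + b) * 3 * I 12 / ρ₂) * T 27 / (8 * ρ₂) + ((a ^ 2 / 2 - a * b + 3 * b ^ 2) *
    R 12 / (8 * ρ₂) + ρ₁ * a * I 1 / ρ₂ + ((3 * a - 5 * b) * I 2 + (a + 39 * b) * I 3) / 16 + (a /
    4 - b) * I 5 / 2 + (a * (5 * a + 13 * b) / 2 - 11 * b ^ 2) * a * I 8 / (8 * ρ₂ ^ 2)) * T 32 /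
    ρ₂ ^ 2 - (7 * R 2 + (7 * a + 15 * b) * I 6 / (2 * ρ₂) + (a / 2 + b) * 7 * I 12 / ρ₂) * T 33 /
    (8 * ρ₂)
  rel_T5 :
    T 5 = -(31 * a / 11 - 3 * b) * ρ₁ * S 10 / (4 * ρ₂ ^ 2) + (31 * a / 11 - 5 * b) * S 15 / (4 *
    ρ₂) - (53 * a / 11 - 3 * b) * S 18 / (4 * ρ₂) + (a - b / 2) * S 20 / ρ₂ - (R 2 / 2 + (97 * a /
    44 - b) * I 6 / ρ₂ + (a / 2 + b) * I 12 / (2 * ρ₂)) * S 27 / (2 * ρ₂) - ρ₁ * T 1 / ρ₂ + T 6 -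
    (3 * a ^ 2 + 31 * a * b / 11 - b ^ 2) * T 22 / (8 * ρ₂ ^ 2) + ((a - b / 2) * R 12 / (2 * ρ₂) -
    ρ₁ * I 1 / (2 * ρ₂) + (I 2 - I 3 - 4 * I 5) / 4 - (a * (8 * a - 19 * b) / 11 + 9 * b ^ 2 / 8)
    * I 8 / ρ₂ ^ 2) * T 27 / ρ₂ - ((75 * a / 11 - b) * R 2 + (49 * a ^ 2 / 2 - 205 * a * b + 615 *
    b ^ 2 / 2) * I 6 / (11 * ρ₂) + (9 * a / 11 + 7 * b) * a * I 12 / (2 * ρ₂)) * T 32 / (16 *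
    ρ₂ ^ 2) - ((9 * a / 2 + b) * R 12 / (44 * ρ₂) + ρ₁ * I 1 / (2 * ρ₂) - (I 2 - 12 * I 3 + 20 *
    I 5) / 44 - (13 * a ^ 2 - (585 * a - 533 * b) * b / 8) * I 8 / (22 * ρ₂ ^ 2)) * T 33 / ρ₂
  rel_T7 :
    T 7 = -(23 * a / 11 + b / 2) * ρ₁ * S 10 / ρ₂ ^ 2 + (23 * a / 11 - b / 2) * S 15 / ρ₂ - (34 *
    a / 11 + b / 2) * S 18 / ρ₂ + 3 * a * S 20 / (2 * ρ₂) - (R 2 + (123 * a / 11 - b) * I 6 / (2 *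
    ρ₂) + (a / 2 + b) * I 12 / ρ₂) * S 27 / (2 * ρ₂) - 2 * ρ₁ * T 1 / ρ₂ + T 6 - (a ^ 2 / 2 + 45 *
    a * b / 11 + b ^ 2 / 2) * T 22 / (2 * ρ₂ ^ 2) + ((a - b / 2) * R 12 / (2 * ρ₂) - 2 * ρ₁ * I 1
    / ρ₂ + (I 2 - 3 * I 3 - 2 * I 5) / 4 - (17 * a ^ 2 / 11 - 57 * a * b / 44 + b ^ 2 / 4) * I 8 /
    ρ₂ ^ 2) * T 27 / ρ₂ - (3 * (15 * a / 11 + b / 2) * R 2 + (47 * a ^ 2 - (107 * a - 815 * b) * b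
    / 2) * I 6 / (22 * ρ₂) + (17 * a ^ 2 / 11 + 3 * a * b / 4 + b ^ 2) * I 12 / ρ₂) * T 32 / (4 *
    ρ₂ ^ 2) - ((81 * a - 59 * b) * R 12 / (44 * ρ₂) + ρ₁ * I 1 / ρ₂ + (59 * (I 2 - I 3) - 162 *
    I 5) / 44 - (105 * a ^ 2 / 4 - 71 * a * b + 457 * b ^ 2 / 4) * I 8 / (11 * ρ₂ ^ 2)) * T 33 /
    (2 * ρ₂)
  rel_S8 :
    S 8 = -2 * ρ₁ * S 2 / ρ₂ + 3 * S 3 + 6 * S 4 - 2 * S 6 + S 7 - (a ^ 2 / 2 + a * b + b ^ 2 / 2)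
    * S 22 / ρ₂ ^ 2 + ((a + b) * R 12 / (4 * ρ₂) - ρ₁ * I 1 / ρ₂ - (I 2 - 5 * I 3 + 6 * I 5) / 4 -
    (a / 4 + b) * a * I 8 / ρ₂ ^ 2) * S 27 / ρ₂ + (a + b) * ρ₁ * T 10 / ρ₂ ^ 2 - b / ρ₂ * (T 15 -
    T 18) - (R 2 + (a - 5 * b) * I 6 / (2 * ρ₂) + (a / 2 + b) * I 12 / ρ₂) * T 27 / (2 * ρ₂) + (a
    * (a + b) * R 12 / (4 * ρ₂) + ρ₁ * a * I 1 / ρ₂ + b * (I 2 + 5 * I 3 - 4 * I 5) / 4 + a *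
    (a ^ 2 / 2 + a * b / 4 - b ^ 2) * I 8 / ρ₂ ^ 2) * T 32 / ρ₂ ^ 2 - (R 2 + (a + 3 * b) * I 6 /
    (2 * ρ₂) + (a / 2 + b) * I 12 / ρ₂) * T 33 / (2 * ρ₂)
  rel_T8 :
    T 8 = -(31 * a / 11 - b) * ρ₁ * S 10 / (2 * ρ₂ ^ 2) + (31 * a / 11 - 3 * b) * S 15 / (2 * ρ₂)
    - (53 * a / 11 - b) * S 18 / (2 * ρ₂) + (2 * a - b) * S 20 / ρ₂ - (R 2 + (97 * a / 22 - b) *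
    I 6 / ρ₂ + (a / 2 + b) * I 12 / ρ₂) * S 27 / (2 * ρ₂) - 2 * ρ₁ * T 1 / ρ₂ + T 6 - (a ^ 2 + 75
    * a * b / 11 - b ^ 2) * T 22 / (4 * ρ₂ ^ 2) + ((a - b) * 3 * R 12 / (4 * ρ₂) - 2 * ρ₁ * I 1 /
    ρ₂ + 3 * (I 2 - I 3 - 2 * I 5) / 4 - (53 * a ^ 2 / 44 - 16 * a * b / 11 + 3 * b ^ 2 / 4) * I 8
    / ρ₂ ^ 2) * T 27 / ρ₂ - ((75 * a / 11 + b) * R 2 / 8 - (39 * a ^ 2 / 16 + 5 * a * b - 461 *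
    b ^ 2 / 16) * I 6 / (11 * ρ₂) + (53 * a ^ 2 / 44 + a * b / 4 + b ^ 2) * I 12 / (4 * ρ₂)) *
    T 32 / ρ₂ ^ 2 - ((5 * a - 31 * b / 4) * R 12 / (11 * ρ₂) + (31 * I 2 - 9 * I 3 - 62 * I 5) /
    44 - (19 * a ^ 2 - (255 * a - 313 * b) * b / 2) * I 8 / (44 * ρ₂ ^ 2)) * T 33 / ρ₂
  rel_S9 :
    S 9 = S 10 / 2 - ρ₂ / (2 * ρ₁) * (S 15 - S 18) + (I 6 * S 27 + b * T 22) / (4 * ρ₁) + (a - b)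
    * I 8 * T 27 / (4 * ρ₁ * ρ₂) + (R 2 + ((3 * a - 7 * b) * I 6 + a * I 12) / (2 * ρ₂)) * T 32 /
    (8 * ρ₁) + 3 * b * I 8 * T 33 / (4 * ρ₁ * ρ₂)
  rel_T9 :
    T 9 = T 10 - I 1 * T 32 / (2 * ρ₂) - I 6 * T 33 / (4 * ρ₁)
  rel_S11 :
    S 11 = S 22 / 2 - (R 12 / 2 + (a - b) * I 8 / ρ₂) * T 32 / (2 * ρ₂)
  rel_T11 :
    T 11 = T 22 + (I 8 * T 27 - (I 6 + I 12) * T 32) / (2 * ρ₂)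
  rel_S12 :
    S 12 = -I 8 * S 27 / ρ₂ + (a / 2 - b) * I 8 * T 32 / ρ₂ ^ 2
  rel_T12 :
    T 12 = -I 8 * (T 27 - T 33) / ρ₂
  rel_S13 :
    S 13 = -2 * ρ₁ * S 10 / ρ₂ + 2 * S 15 - S 18 + S 20 - I 6 * S 27 / ρ₂ - a * T 22 / ρ₂ - 2 * (a
    - b) * I 8 * T 27 / ρ₂ ^ 2 - (R 2 + (5 * a - 7 * b) * I 6 / (2 * ρ₂) - (a / 2 - b) * I 12 /
    ρ₂) * T 32 / (2 * ρ₂) + (3 * a - 4 * b) * I 8 * T 33 / ρ₂ ^ 2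
  rel_T13 :
    T 13 = T 18 + T 20 + ((a + b) * R 12 / (4 * ρ₂) + ρ₁ * I 1 / ρ₂ - (I 2 - I 3 + 2 * I 5) / 4 +
    (a ^ 2 / 2 + a * b - b ^ 2) * I 8 / (2 * ρ₂ ^ 2)) * T 32 / ρ₂
  rel_S14 :
    S 14 = 0
  rel_T14 :
    T 14 = -I 8 * T 32 / (2 * ρ₂)
  rel_S16 :
    S 16 = -(I 6 * S 27 + a * T 22) / (2 * ρ₂) + (a - 3 * b / 2) * I 6 * T 32 / (2 * ρ₂ ^ 2) +
    R 12 * T 33 / (2 * ρ₂)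
  rel_T16 :
    T 16 = (a * S 22 - I 6 * T 27) / (2 * ρ₂) + (a * R 12 / (2 * ρ₂) - I 3) * T 32 / (2 * ρ₂) +
    (I 6 + I 12) * T 33 / (2 * ρ₂)
  rel_S17 :
    S 17 = S 15 + I 12 * S 27 / (2 * ρ₂) - (a - b) * I 8 * T 27 / (2 * ρ₂ ^ 2) + ((-2 * a + 3 * b)
    * I 6 + b * I 12) * T 32 / (4 * ρ₂ ^ 2) + (a - 5 * b / 4) * I 8 * T 33 / ρ₂ ^ 2
  rel_T17 :
    T 17 = -a * S 22 / (2 * ρ₂) + (R 12 - b * I 8 / ρ₂) * S 27 / (2 * ρ₂) + ρ₁ * T 10 / ρ₂ + ((a +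
    3 * b) * R 12 / (4 * ρ₂) + ρ₁ * I 1 / ρ₂ - (I 2 - I 3 - 2 * I 5) / 4 + (3 * a ^ 2 / 2 - a * b
    - b ^ 2) * I 8 / (2 * ρ₂ ^ 2)) * T 32 / (2 * ρ₂)
  rel_S19 :
    S 19 = S 20
  rel_T19 :
    T 19 = T 20
  rel_S21 :
    S 21 = S 22
  rel_T21 :
    T 21 = T 22
  rel_S23 :
    S 23 = -2 * ρ₁ * S 10 / ρ₂ + 2 * S 15 - S 18 + S 20 - (I 6 - I 12 / 2) * S 27 / ρ₂ - (a + b) *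
    T 22 / (2 * ρ₂) + (R 12 - (a - b) * I 8 / ρ₂) * T 27 / (2 * ρ₂) - (R 2 - (a / 2 - 3 * b) * I 6
    / ρ₂ + (a - b) * I 12 / (2 * ρ₂)) * T 32 / (2 * ρ₂) - (R 12 - 3 * b * I 8 / (2 * ρ₂)) * T 33 /
    (2 * ρ₂)
  rel_T23 :
    T 23 = (a - b / 2) * S 22 / ρ₂ - (R 12 - b * I 8 / ρ₂) * S 27 / (2 * ρ₂) - ρ₁ * T 10 / ρ₂ +
    T 15 + T 18 + I 12 * T 27 / (2 * ρ₂) + ((a / 2 - b) * R 12 / ρ₂ + (I 2 - I 3 - 4 * I 5) / 2) *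
    T 32 / (2 * ρ₂) - (a / 2 - b) * a * I 8 * T 32 / (2 * ρ₂ ^ 3) - I 12 * T 33 / (2 * ρ₂)
  rel_S24 :
    S 24 = S 18 + S 20 - ((I 6 - I 12) * S 27 + b * T 22) / (2 * ρ₂) + (R 12 + (a - b) * I 8 / ρ₂)
    * T 27 / (2 * ρ₂) + ((a - 3 * b / 2) * I 6 + b * I 12 / 4) * T 32 / ρ₂ ^ 2 - (a - 5 * b / 4) *
    I 8 * T 33 / ρ₂ ^ 2
  rel_T24 :
    T 24 = (a + b) * S 22 / (2 * ρ₂) + (-R 12 + b * I 8 / ρ₂) * S 27 / (2 * ρ₂) - ρ₁ * T 10 / ρ₂ +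
    T 15 + T 18 - (I 6 - I 12) * T 27 / (2 * ρ₂) - ((I 2 + I 3) / 2 + (a / 2 - b) * a * I 8 /
    ρ₂ ^ 2) * T 32 / (2 * ρ₂) + I 6 * T 33 / (2 * ρ₂)
  rel_S25 :
    S 25 = 2 * S 15 + I 12 * S 27 / (2 * ρ₂) - (a - b) * T 22 / (2 * ρ₂) - (R 12 + (a - b) * 3 *
    I 8 / ρ₂) * T 27 / (2 * ρ₂) - ((3 * a - 13 * b / 2) * I 6 - b * I 12 / 2) * T 32 / (2 *
    ρ₂ ^ 2) + (R 12 / 2 + (3 * a - 19 * b / 4) * I 8 / ρ₂) * T 33 / ρ₂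
  rel_T25 :
    T 25 = -(a - b / 2) * S 22 / ρ₂ + (R 12 - b * I 8 / ρ₂) * S 27 / (2 * ρ₂) + ρ₁ * T 10 / ρ₂ +
    T 15 + T 20 + I 12 * T 27 / (2 * ρ₂) + (3 * b * R 12 / (4 * ρ₂) + ρ₁ * I 1 / ρ₂ - (I 2 - I 3 -
    I 5) / 2) * T 32 / ρ₂ + (a ^ 2 - b ^ 2) * I 8 * T 32 / (2 * ρ₂ ^ 3) - I 12 * T 33 / (2 * ρ₂)
  rel_S26 :
    S 26 = -I 8 * S 27 / ρ₂ - (R 12 + a * I 8 / ρ₂) * T 32 / (2 * ρ₂)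
  rel_T26 :
    T 26 = T 22 - (I 6 * T 32 - I 8 * T 33) / ρ₂
  rel_S28 :
    S 28 = S 27 - (a / 2 - b) * T 32 / ρ₂
  rel_T28 :
    T 28 = T 27 - T 33
  rel_S29 :
    S 29 = S 27 - (a / 2 - b) * T 32 / ρ₂
  rel_T29 :
    T 29 = T 27 - T 33
  rel_S30 :
    S 30 = 0
  rel_T30 :
    T 30 = T 32
  rel_S31 :
    S 31 = 0
  rel_T31 :
    T 31 = T 32
  rel_S32 :
    S 32 = 0
  rel_S33 :
    S 33 = -a * T 32 / (2 * ρ₂)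
  rel_S34 :
    S 34 = S 27 + b * T 32 / (2 * ρ₂)
  rel_T34 :
    T 34 = 0
  constraint₁ :
    4 * a * (2 * ρ₂ * (ρ₁ * S 10 - ρ₂ * S 15 + ρ₂ * S 18) + ρ₂ * (I 6 * S 27 + b * T 22) + (a - b)
    * I 8 * T 27) + a * (2 * ρ₂ * R 2 + (a + 3 * b) * I 6 + a * I 12) * T 32 + 2 * (2 * ρ₂ * (a -
    b) * R 12 + 2 * ρ₂ ^ 2 * (I 2 - I 3 - 2 * I 5) + a * (b - 2 * a) * I 8) * T 33 = 0
  constraint₂ :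
    I 6 * T 32 - I 8 * T 33 = 0

/-- The Fréchet derivative of the NLS flow:
`K_2'[u]v = -i ρ₁ {v_ξξ + (ρ₂/ρ₁) [u² v̄ + 2 |u|² v]}`. -/
theorem frechet_K2 (ρ₁ ρ₂ : ℝ) (v : DiffPoly) :
    frechet (K2 ρ₁ ρ₂) v = C (-Complex.I * ρ₁) * (dξ (dξ v) +
      C ((ρ₂ / ρ₁ : ℝ) : ℂ) * (u 1 0 ^ 2 * bar v + 2 * (u 1 0 * ū 1 0 * v))) := by
  simp only [frechet, K2, u, ū, Derivation.leibniz, map_add, mkDerivation_X, derivation_C,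
    Function.iterate_succ, Function.iterate_zero, Function.comp, id, if_true, smul_eq_mul]
  ring

/-- The Fréchet derivative of the third-order flow:
`K_3'[u]v = B {v_ξξξ + (3 ρ₂/ρ₁) [|u|² v_ξ + ū u_ξ v + u u_ξ v̄]}`. -/
theorem frechet_K3 (ρ₁ ρ₂ B : ℝ) (v : DiffPoly) :
    frechet (K3 ρ₁ ρ₂ B) v = C (B : ℂ) * (dξ (dξ (dξ v)) + C ((3 * ρ₂ / ρ₁ : ℝ) : ℂ) *
      (u 1 0 * ū 1 0 * dξ v + ū 1 0 * u 1 1 * v + u 1 0 * u 1 1 * bar v)) := by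
  simp only [frechet, K3, u, ū, Derivation.leibniz, map_add, mkDerivation_X, derivation_C,
    Function.iterate_succ, Function.iterate_zero, Function.comp, id, if_true, smul_eq_mul]
  ring

end MultiscaleNLS

open MultiscaleNLS

namespace MultiscaleNLS

section Lists
variable {α β V : Type}

/-- Right fold. -/
noncomputable def fold (f : α → β → β) (b : β) (l : List α) : β :=
  @List.rec α (fun _ => β) b (fun a _ r => f a r) l

@[simp] theorem fold_nil (f : α → β → β) (b : β) : fold f b [] = b := rfl
@[simp] theorem fold_cons (f : α → β → β) (b : β) (a : α) (l : List α) :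
    fold f b (a :: l) = f a (fold f b l) := rfl

/-- Case distinction. -/
noncomputable def sel (c : Bool) (x y : α) : α := @Bool.rec (fun _ => α) y x c

@[simp] theorem sel_true (x y : α) : sel true x y = x := rfl
@[simp] theorem sel_false (x y : α) : sel false x y = y := rfl

/-- Evaluates a positive number and passes on its predecessor. -/
noncomputable def force (z : α) (k : ℕ → α) (n : ℕ) : α :=
  @Nat.rec (fun _ => α) z (fun m _ => k m) n

@[simp] theorem force_zero (z : α) (k : ℕ → α) : force z k 0 = z := rfl
@[simp] theorem force_succ (z : α) (k : ℕ → α) (m : ℕ) : force z k (m + 1) = k m := rfl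

/-- Concatenation. -/
noncomputable def cat (l m : List α) : List α := fold List.cons m l

@[simp] theorem cat_eq (l m : List α) : cat l m = l ++ m := by
  induction l with
  | nil => rfl
  | cons a l ih => rw [cat, fold_cons, ← cat, ih, List.cons_append]

/-- Splits a list into the entries at even and at odd places. -/
noncomputable def split (l : List α) : List α × List α :=
  fold (fun a p => (a :: p.2, p.1)) ([], []) l

theorem split_perm (l : List α) : ((split l).1 ++ (split l).2).Perm l := by
  induction l with
  | nil => rfl
  | cons a l ih =>
    rw [split, fold_cons, ← split]
    exact (List.perm_append_comm.trans ih).cons a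

/-- Whether a property holds for all entries; the recursion halves the list `d` times. -/
noncomputable def allB (q : α → Bool) (d : ℕ) : List α → Bool :=
  @Nat.rec (fun _ => List α → Bool) (fun l => fold (fun a r => sel (q a) r false) true l)
    (fun _ ih l => @List.rec α (fun _ => Bool) true
      (fun _ _ _ => sel (ih (split l).1) (ih (split l).2) false) l) d

theorem allB_iff (q : α → Bool) (d : ℕ) (l : List α) : allB q d l = true ↔ ∀ a ∈ l, q a = true := by
  induction d generalizing l with
  | zero =>
    change fold (fun a r => sel (q a) r false) true l = true ↔ _
    induction l with
    | nil => simp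
    | cons a l ih => cases h : q a <;> simp [h, ih]
  | succ d ih =>
    cases l with
    | nil => simp [allB]
    | cons a l =>
      change sel (allB q d (split (a :: l)).1) (allB q d (split (a :: l)).2) false = true ↔ _
      have : sel (allB q d (split (a :: l)).1) (allB q d (split (a :: l)).2) false = true ↔
          allB q d (split (a :: l)).1 = true ∧ allB q d (split (a :: l)).2 = true := by
        cases allB q d (split (a :: l)).1 <;> simp
      rw [this, ih, ih]
      constructor
      · intro h b hb
        rcases List.mem_append.1 ((split_perm (a :: l)).mem_iff.2 hb) with hb | hb
        · exact h.1 b hb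
        · exact h.2 b hb
      · intro h
        exact ⟨fun b hb => h b ((split_perm (a :: l)).mem_iff.1 (List.mem_append_left _ hb)),
          fun b hb => h b ((split_perm (a :: l)).mem_iff.1 (List.mem_append_right _ hb))⟩

/-- Merges lists with increasing keys; values with equal keys are added where `same` allows it. -/
noncomputable def merge (same : V → V → Bool) (add : V → V → V) (l : List (ℕ × V)) :
    List (ℕ × V) → List (ℕ × V) :=
  @List.rec (ℕ × V) (fun _ => List (ℕ × V) → List (ℕ × V)) (fun m => m)
    (fun a l ih m => @List.rec (ℕ × V) (fun _ => List (ℕ × V)) (a :: l)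
      (fun b m' ihm => sel (Nat.beq a.1 b.1)
        (sel (same a.2 b.2) ((a.1, add a.2 b.2) :: ih m') (a :: ih (b :: m')))
        (sel (Nat.ble a.1 b.1) (a :: ih (b :: m')) (b :: ihm))) m) l

/-- Merges the first list with the second, the third with the fourth, and so on. -/
noncomputable def mergePairs (same : V → V → Bool) (add : V → V → V)
    (L : List (List (ℕ × V))) : List (List (ℕ × V)) :=
  fold (fun x k y => @List.rec (ℕ × V) (fun _ => List (List (ℕ × V))) (k x)
    (fun _ _ _ => merge same add y x :: k []) y) (fun y => [y]) L []

/-- Merge sort with `d` rounds. -/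
noncomputable def msort (same : V → V → Bool) (add : V → V → V) (d : ℕ) (l : List (ℕ × V)) :
    List (ℕ × V) :=
  fold (merge same add) [] (@Nat.rec (fun _ => List (List (ℕ × V)))
    (fold (fun a r => [a] :: r) [] l) (fun _ L => mergePairs same add L) d)

variable {A : Type} [AddCommMonoid A] (f : ℕ × V → A) (same : V → V → Bool) (add : V → V → V)
  (h : ∀ k v v', same v v' = true → f (k, add v v') = f (k, v) + f (k, v'))

include h in
theorem sum_merge (l m : List (ℕ × V)) :
    ((merge same add l m).map f).sum = (l.map f).sum + (m.map f).sum := by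
  induction l generalizing m with
  | nil => simp [merge]
  | cons a l ihl =>
    induction m with
    | nil => simp [merge]
    | cons b m ihm =>
      change ((sel (Nat.beq a.1 b.1) (sel (same a.2 b.2)
        ((a.1, add a.2 b.2) :: merge same add l m) (a :: merge same add l (b :: m)))
        (sel (Nat.ble a.1 b.1) (a :: merge same add l (b :: m))
          (b :: merge same add (a :: l) m))).map f).sum = _
      have e : ((a :: merge same add l (b :: m)).map f).sum =
          ((a :: l).map f).sum + ((b :: m).map f).sum := by
        simp only [List.map_cons, List.sum_cons, ihl, add_assoc]
      rcases hk : Nat.beq a.1 b.1 with _ | _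
      · rw [sel_false]
        rcases Nat.ble a.1 b.1 with _ | _
        · rw [sel_false, List.map_cons, List.sum_cons, ihm, List.map_cons (l := m), List.sum_cons,
            add_left_comm]
        · exact e
      · rw [sel_true]
        rcases hs : same a.2 b.2 with _ | _
        · exact e
        · have hab : f (a.1, b.2) = f b := by rw [Nat.eq_of_beq_eq_true hk]
          rw [sel_true, List.map_cons, List.sum_cons, ihl, h _ _ _ hs, hab, List.map_cons,
            List.map_cons, List.sum_cons, List.sum_cons]
          exact add_add_add_comm (f a) (f b) _ _

include h in
theorem sum_mergePairs (L : List (List (ℕ × V))) :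
    ((mergePairs same add L).map fun l => (l.map f).sum).sum =
      (L.map fun l => (l.map f).sum).sum := by
  have aux (L : List (List (ℕ × V))) (y : List (ℕ × V)) :
      ((fold (fun x k y => @List.rec (ℕ × V) (fun _ => List (List (ℕ × V))) (k x)
        (fun _ _ _ => merge same add y x :: k []) y) (fun y => [y]) L y).map
          fun l => (l.map f).sum).sum = (y.map f).sum + (L.map fun l => (l.map f).sum).sum := by
    induction L generalizing y with
    | nil => simp
    | cons x L ih =>
      rw [fold_cons]
      cases y with
      | nil => rw [ih]; simp
      | cons a y =>
        rw [List.map_cons, List.sum_cons, ih, sum_merge f same add h, List.map_cons (l := L),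
          List.sum_cons]
        simp only [List.map_nil, List.sum_nil, zero_add, add_assoc]
  rw [mergePairs, aux]
  simp

include h in
theorem sum_msort (d : ℕ) (l : List (ℕ × V)) :
    ((msort same add d l).map f).sum = (l.map f).sum := by
  have h1 (L : List (List (ℕ × V))) : ((fold (merge same add) [] L).map f).sum =
      (L.map fun l => (l.map f).sum).sum := by
    induction L with
    | nil => rfl
    | cons x L ih => rw [fold_cons, sum_merge f same add h, ih, List.map_cons, List.sum_cons]
  rw [msort, h1]
  induction d with
  | zero =>
    change ((fold (fun a r => [a] :: r) [] l).map fun l => (l.map f).sum).sum = _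
    induction l with
    | nil => rfl
    | cons a l ih => rw [fold_cons, List.map_cons, List.sum_cons, ih]; simp
  | succ d ih =>
    rw [← ih]
    exact sum_mergePairs f same add h _

end Lists

/-- A coefficient: a list of terms `(n, e, c)` that stand for `c i ^ e χ(n)`. -/
abbrev Coef : Type := List (ℕ × ℕ × ℕ)

/-- A differential polynomial: a list of terms, each a coefficient and a list of jet codes. -/
abbrev Rep : Type := List (Coef × List ℕ)

/-- The jet variable with code `8 k + 2 j + c`, where `c = 0` for `u` and `c = 1` for `ū`. -/
def jet (i : ℕ) : Jet := if i % 2 = 0 then .u (i / 2 % 4) (i / 8) else .ubar (i / 2 % 4) (i / 8)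

/-- The code of a jet variable. -/
def jetCode : Jet → ℕ
  | .u j k => 8 * k + 2 * j
  | .ubar j k => 8 * k + 2 * j + 1

/-- The code of the complex conjugate of a jet variable. -/
noncomputable def flip (i : ℕ) : ℕ := sel (Nat.beq (Nat.mod i 2) 0) (Nat.add i 1) (Nat.sub i 1)

/-- The product of the jet variables with the given codes. -/
noncomputable def mono (l : List ℕ) : DiffPoly := (l.map fun i => X (jet i)).prod

/-- Product of coefficients. -/
noncomputable def cmul (a b : Coef) : Coef :=
  fold (fun s r => fold (fun t r' =>
    (Nat.mul s.1 t.1, Nat.add s.2.1 t.2.1, Nat.mul s.2.2 t.2.2) :: r') r b) [] a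

/-- Complex conjugation of coefficients. -/
noncomputable def cconj (a : Coef) : Coef :=
  fold (fun t r => (t.1, Nat.mul 3 t.2.1, t.2.2) :: r) [] a

/-- Multiplication by a coefficient. -/
noncomputable def rsmul (c : Coef) (p : Rep) : Rep := fold (fun t r => (cmul c t.1, t.2) :: r) [] p

/-- Complex conjugation of differential polynomials. -/
noncomputable def rbar (p : Rep) : Rep :=
  fold (fun t r => (cconj t.1, fold (fun i r' => flip i :: r') [] t.2) :: r) [] p

/-- The derivative of a monomial for the derivation with values `T` on the jet variables. -/
noncomputable def monoDeriv (T : ℕ → Rep) (l : List ℕ) : Rep :=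
  @List.rec ℕ (fun _ => Rep) []
    (fun i l ih => fold (fun t r => (t.1, cat t.2 l) :: r)
      (fold (fun t r => (t.1, i :: t.2) :: r) [] ih) (T i)) l

/-- The derivation with values `T` on the jet variables. -/
noncomputable def rderiv (T : ℕ → Rep) (p : Rep) : Rep :=
  fold (fun s r => fold (fun t r' => (cmul s.1 t.1, t.2) :: r') r (monoDeriv T s.2)) [] p

section Semantics
variable (χ : ℕ →*₀ ℝ)

/-- The value of a term. -/
noncomputable def tval (t : ℕ × ℕ × ℕ) : ℂ := (t.2.2 : ℂ) * Complex.I ^ t.2.1 * (χ t.1 : ℂ)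

/-- The value of a coefficient. -/
noncomputable def val (c : Coef) : ℂ := (c.map (tval χ)).sum

/-- The differential polynomial that a list of terms stands for. -/
noncomputable def den (p : Rep) : DiffPoly := (p.map fun t => C (val χ t.1) * mono t.2).sum

@[simp] theorem val_nil : val χ [] = 0 := by simp [val]
@[simp] theorem val_cons (t : ℕ × ℕ × ℕ) (c : Coef) : val χ (t :: c) = tval χ t + val χ c := by
  simp [val]
@[simp] theorem val_append (c d : Coef) : val χ (c ++ d) = val χ c + val χ d := by simp [val]

@[simp] theorem mono_nil : mono [] = 1 := by simp [mono]
@[simp] theorem mono_cons (i : ℕ) (l : List ℕ) : mono (i :: l) = X (jet i) * mono l := by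
  simp [mono]
@[simp] theorem mono_append (l m : List ℕ) : mono (l ++ m) = mono l * mono m := by simp [mono]

@[simp] theorem den_nil : den χ [] = 0 := by simp [den]
@[simp] theorem den_cons (t : Coef × List ℕ) (p : Rep) :
    den χ (t :: p) = C (val χ t.1) * mono t.2 + den χ p := by simp [den]
@[simp] theorem den_append (p q : Rep) : den χ (p ++ q) = den χ p + den χ q := by simp [den]

theorem val_cmul (a b : Coef) : val χ (cmul a b) = val χ a * val χ b := by
  have aux (s : ℕ × ℕ × ℕ) (r : Coef) : val χ (fold (fun t r' =>
      (Nat.mul s.1 t.1, Nat.add s.2.1 t.2.1, Nat.mul s.2.2 t.2.2) :: r') r b) =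
      tval χ s * val χ b + val χ r := by
    induction b with
    | nil => simp
    | cons t b ih =>
      rw [fold_cons, val_cons, ih, val_cons]
      simp only [tval, Nat.mul_eq, Nat.add_eq, map_mul, pow_add]
      push_cast
      ring
  induction a with
  | nil => simp [cmul]
  | cons s a ih =>
    rw [cmul, fold_cons, aux, ← cmul, ih, val_cons]
    ring

theorem val_cconj (a : Coef) : val χ (cconj a) = starRingEnd ℂ (val χ a) := by
  induction a with
  | nil => simp [cconj]
  | cons s a ih =>
    rw [cconj, fold_cons, val_cons, ← cconj, ih, val_cons]
    simp [tval, pow_mul]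

theorem den_rsmul (c : Coef) (p : Rep) : den χ (rsmul c p) = C (val χ c) * den χ p := by
  induction p with
  | nil => simp [rsmul]
  | cons s p ih =>
    rw [rsmul, fold_cons, den_cons, ← rsmul, ih, den_cons, val_cmul, C_mul]
    ring

theorem jet_flip (i : ℕ) : bar (X (jet i)) = X (jet (flip i)) := by
  rcases Nat.mod_two_eq_zero_or_one i with h0 | h1
  · have e1 : (i + 1) / 2 = i / 2 := by omega
    have e2 : (i + 1) / 8 = i / 8 := by omega
    have e3 : (i + 1) % 2 = 1 := by omega
    have e : flip i = i + 1 := by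
      have : Nat.mod i 2 = 0 := h0
      simp [flip, this]
    simp [jet, e, h0, e1, e2, e3, bar, ū]
  · have e1 : (i - 1) / 2 = i / 2 := by omega
    have e2 : (i - 1) / 8 = i / 8 := by omega
    have e3 : (i - 1) % 2 = 0 := by omega
    have e : flip i = i - 1 := by
      have : Nat.mod i 2 = 1 := h1
      simp [flip, this, Nat.beq]
    simp [jet, e, h1, e1, e2, e3, bar, u]

theorem bar_C (c : ℂ) : bar (C c) = C (starRingEnd ℂ c) := by simp [bar]

theorem bar_mono (l : List ℕ) : bar (mono l) = mono (fold (fun i r => flip i :: r) [] l) := by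
  induction l with
  | nil => simp
  | cons i l ih => simp [ih, jet_flip]

theorem den_rbar (p : Rep) : den χ (rbar p) = bar (den χ p) := by
  induction p with
  | nil => simp [rbar]
  | cons s p ih =>
    rw [rbar, fold_cons, den_cons, ← rbar, ih, den_cons, map_add, map_mul, bar_C, bar_mono,
      val_cconj]

theorem den_rderiv (d : Derivation ℂ DiffPoly DiffPoly) (T : ℕ → Rep)
    (h : ∀ i, den χ (T i) = d (X (jet i))) (p : Rep) : den χ (rderiv T p) = d (den χ p) := by
  have h1 (q r : Rep) (l : List ℕ) : den χ (fold (fun t r => (t.1, cat t.2 l) :: r) r q) =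
      den χ q * mono l + den χ r := by
    induction q with
    | nil => simp
    | cons t q ih => rw [fold_cons, den_cons, ih, den_cons, cat_eq, mono_append]; ring
  have h2 (q : Rep) (i : ℕ) : den χ (fold (fun t r => (t.1, i :: t.2) :: r) [] q) =
      X (jet i) * den χ q := by
    induction q with
    | nil => simp
    | cons t q ih => rw [fold_cons, den_cons, ih, den_cons, mono_cons]; ring
  have h3 (l : List ℕ) : den χ (monoDeriv T l) = d (mono l) := by
    induction l with
    | nil => simp [monoDeriv]
    | cons i l ih =>
      change den χ (fold (fun t r => (t.1, cat t.2 l) :: r)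
        (fold (fun t r => (t.1, i :: t.2) :: r) [] (monoDeriv T l)) (T i)) = _
      rw [h1, h2, ih, h, mono_cons, Derivation.leibniz, smul_eq_mul, smul_eq_mul]
      ring
  have h4 (c : Coef) (q r : Rep) : den χ (fold (fun t r' => (cmul c t.1, t.2) :: r') r q) =
      C (val χ c) * den χ q + den χ r := by
    induction q with
    | nil => simp
    | cons t q ih => rw [fold_cons, den_cons, ih, den_cons, val_cmul, C_mul]; ring
  induction p with
  | nil => simp [rderiv]
  | cons s p ih =>
    rw [rderiv, fold_cons, h4, ← rderiv, ih, h3, den_cons, map_add, Derivation.leibniz,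
      derivation_C]
    simp

end Semantics

/-- Collects the terms of a coefficient with equal parameter monomials. -/
noncomputable def ccollect (c : Coef) : Coef :=
  fold (fun s r => sel (Nat.beq s.2.1 s.2.2) r
    ((Nat.div (Nat.succ s.1) 2, sel (Nat.ble s.2.1 s.2.2)
      (Nat.add 2 (Nat.mod (Nat.succ s.1) 2), Nat.sub s.2.2 s.2.1)
      (Nat.mod (Nat.succ s.1) 2, Nat.sub s.2.1 s.2.2)) :: r))
    [] (msort (V := ℕ × ℕ) (fun _ _ => true) (fun v w => (Nat.add v.1 w.1, Nat.add v.2 w.2)) 10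
      (fold (fun t r => force r (fun m => (m, sel (Nat.ble 2 (Nat.mod t.2.1 4)) (0, t.2.2)
        (t.2.2, 0)) :: r) (Nat.add (Nat.mul 2 t.1) (Nat.mod t.2.1 2))) [] c))

/-- A numerical key of a list of codes, which does not depend on their order. -/
noncomputable def key (l : List ℕ) : ℕ :=
  fold (fun i n => Nat.add (Nat.pow 2 (Nat.mul 4 i)) n) 0 l

/-- Insertion into a sorted list of codes. -/
noncomputable def orderedInsert (i : ℕ) (l : List ℕ) : List ℕ :=
  @List.rec ℕ (fun _ => List ℕ) [i]
    (fun j l ih => sel (Nat.ble i j) (i :: j :: l) (j :: ih)) l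

/-- Equality test for lists of codes. -/
noncomputable def sameCodes (l : List ℕ) : List ℕ → Bool :=
  @List.rec ℕ (fun _ => List ℕ → Bool)
    (fun m => @List.rec ℕ (fun _ => Bool) true (fun _ _ _ => false) m)
    (fun i _ ih m => @List.rec ℕ (fun _ => Bool) false
      (fun j m _ => sel (Nat.beq i j) (ih m) false) m) l

/-- Collects the terms with equal jet monomials. -/
noncomputable def gather (p : Rep) : Rep :=
  fold (fun s r => s.2 :: r) [] (msort (V := Coef × List ℕ) (fun v w => sameCodes v.2 w.2)
    (fun v w => (cat v.1 w.1, w.2)) 13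
      (fold (fun t r => force ((0, t) :: r)
        (fun m => (m, t.1, fold orderedInsert [] t.2) :: r) (key t.2)) [] p))

/-- Drops the terms without coefficient. -/
noncomputable def dropZero (p : Rep) : Rep :=
  fold (fun s r => @List.rec (ℕ × ℕ × ℕ) (fun _ => Rep) r (fun _ _ _ => s :: r) s.1) [] p

/-- Normal form of a differential polynomial. -/
noncomputable def collect (p : Rep) : Rep :=
  dropZero (fold (fun s r => (ccollect s.1, s.2) :: r) [] (gather p))

section
variable (χ : ℕ →*₀ ℝ)

theorem val_ccollect (c : Coef) : val χ (ccollect c) = val χ c := by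
  set f : ℕ × ℕ × ℕ → ℂ := fun t =>
    ((t.2.1 : ℂ) - t.2.2) * Complex.I ^ ((t.1 + 1) % 2) * (χ ((t.1 + 1) / 2) : ℂ) with hf
  have h1 (l : List (ℕ × ℕ × ℕ)) : val χ (fold (fun s r => sel (Nat.beq s.2.1 s.2.2) r
      ((Nat.div (Nat.succ s.1) 2, sel (Nat.ble s.2.1 s.2.2)
        (Nat.add 2 (Nat.mod (Nat.succ s.1) 2), Nat.sub s.2.2 s.2.1)
        (Nat.mod (Nat.succ s.1) 2, Nat.sub s.2.1 s.2.2)) :: r)) [] l) = (l.map f).sum := by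
    induction l with
    | nil => simp
    | cons s l ih =>
      rw [fold_cons, List.map_cons, List.sum_cons, ← ih]
      rcases he : Nat.beq s.2.1 s.2.2 with _ | _
      · rw [sel_false, val_cons]
        congr 1
        rcases hl : Nat.ble s.2.1 s.2.2 with _ | _
        · have hle : s.2.2 ≤ s.2.1 := by
            by_contra hc
            rw [Nat.ble_eq_true_of_le (by omega)] at hl
            simp at hl
          simp only [sel_false, tval, hf, Nat.sub_eq]
          rw [Nat.cast_sub hle]
          rfl
        · have hle : s.2.1 ≤ s.2.2 := Nat.le_of_ble_eq_true hl
          simp only [sel_true, tval, hf, Nat.sub_eq, Nat.add_eq, pow_add, Complex.I_sq]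
          rw [Nat.cast_sub hle]
          change _ * (-1 * Complex.I ^ ((s.1 + 1) % 2)) * (χ ((s.1 + 1) / 2) : ℂ) = _
          ring
      · rw [sel_true, hf]
        simp [Nat.eq_of_beq_eq_true he]
  have h2 (c : Coef) : ((fold (fun t r => force r (fun m => ((m,
      sel (Nat.ble 2 (Nat.mod t.2.1 4)) (0, t.2.2) (t.2.2, 0)) : ℕ × ℕ × ℕ) :: r)
      (Nat.add (Nat.mul 2 t.1) (Nat.mod t.2.1 2))) [] c).map f).sum = val χ c := by
    induction c with
    | nil => simp
    | cons t c ih =>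
      have e1 : (2 * t.1 + t.2.1 % 2) / 2 = t.1 := by omega
      have e2 : (2 * t.1 + t.2.1 % 2) % 2 = t.2.1 % 2 := by omega
      have e3 : Nat.add (Nat.mul 2 t.1) (Nat.mod t.2.1 2) = 2 * t.1 + t.2.1 % 2 := rfl
      have e4 : Nat.mod t.2.1 4 = t.2.1 % 4 := rfl
      rw [fold_cons, e3, e4, val_cons]
      rcases hn : 2 * t.1 + t.2.1 % 2 with _ | m
      · have ht : t.1 = 0 := by omega
        rw [force_zero, ih]
        simp [tval, ht]
      · rw [hn] at e1 e2
        have e5 : Complex.I ^ t.2.1 = Complex.I ^ (t.2.1 % 4) := Complex.I_pow_eq_pow_mod _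
        have e6 : t.2.1 % 2 = t.2.1 % 4 % 2 := by omega
        have e7 : t.2.1 % 4 < 4 := Nat.mod_lt _ (by norm_num)
        rw [force_succ, List.map_cons, List.sum_cons, ih]
        congr 1
        simp only [hf, e1, e2, tval, e5]
        rw [e6]
        generalize t.2.1 % 4 = e at e7
        interval_cases e <;> simp [Nat.ble, pow_succ]
  rw [ccollect, h1, sum_msort f, h2]
  intro k v v' _
  simp only [hf, Nat.add_eq]
  push_cast
  ring

theorem mono_orderedInsert (i : ℕ) (l : List ℕ) :
    mono (orderedInsert i l) = X (jet i) * mono l := by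
  induction l with
  | nil => simp [orderedInsert]
  | cons j l ih =>
    change mono (sel (Nat.ble i j) (i :: j :: l) (j :: orderedInsert i l)) = _
    cases Nat.ble i j
    · rw [sel_false, mono_cons, ih, mono_cons]; ring
    · rw [sel_true, mono_cons]

theorem mono_sort (l : List ℕ) : mono (fold orderedInsert [] l) = mono l := by
  induction l with
  | nil => rfl
  | cons i l ih => rw [fold_cons, mono_orderedInsert, ih, mono_cons]

theorem eq_of_sameCodes {l m : List ℕ} (h : sameCodes l m = true) : l = m := by
  induction l generalizing m with
  | nil => cases m with
    | nil => rfl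
    | cons => simp [sameCodes] at h
  | cons i l ih => cases m with
    | nil => simp [sameCodes] at h
    | cons j m =>
      change sel (Nat.beq i j) (sameCodes l m) false = true at h
      rcases hb : Nat.beq i j with _ | _
      · simp [hb] at h
      · rw [hb] at h
        rw [Nat.eq_of_beq_eq_true hb, ih h]

theorem den_gather (p : Rep) : den χ (gather p) = den χ p := by
  set f : ℕ × Coef × List ℕ → DiffPoly := fun s => C (val χ s.2.1) * mono s.2.2 with hf
  have h1 (l : List (ℕ × Coef × List ℕ)) : den χ (fold (fun s r => s.2 :: r) [] l) =
      (l.map f).sum := by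
    induction l with
    | nil => simp
    | cons s l ih => simp [ih, hf]
  have h2 (p : Rep) : ((fold (fun t r => force (((0, t) : ℕ × Coef × List ℕ) :: r)
      (fun m => (m, t.1, fold orderedInsert [] t.2) :: r) (key t.2)) [] p).map f).sum =
      den χ p := by
    induction p with
    | nil => simp
    | cons s p ih =>
      rw [fold_cons, den_cons, ← ih]
      cases key s.2 with
      | zero => simp [hf]
      | succ m => simp [hf, mono_sort]
  rw [gather, h1, sum_msort f, h2]
  intro k v v' hv
  simp only [hf, eq_of_sameCodes hv, cat_eq, val_append, C_add]
  ring

theorem den_dropZero (p : Rep) : den χ (dropZero p) = den χ p := by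
  induction p with
  | nil => rfl
  | cons s p ih =>
    obtain ⟨c, l⟩ := s
    rw [dropZero, fold_cons, ← dropZero, den_cons, ← ih]
    cases c with
    | nil => simp
    | cons t c => rw [← den_cons]

theorem den_map_coef (g : Coef → Coef) (hg : ∀ c, val χ (g c) = val χ c) (p : Rep) :
    den χ (fold (fun s r => (g s.1, s.2) :: r) [] p) = den χ p := by
  induction p with
  | nil => rfl
  | cons s p ih => rw [fold_cons, den_cons, ih, hg, den_cons]

theorem den_collect (p : Rep) : den χ (collect p) = den χ p := by
  rw [collect, den_dropZero, den_map_coef χ _ (val_ccollect χ), den_gather]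

end

/-- The total derivative. -/
noncomputable def rD (p : Rep) : Rep :=
  collect (rderiv (fun i => [([(1, 0, 1)], [Nat.add i 8])]) p)

/-- Iterated total derivative. -/
noncomputable def rDn (p : Rep) (k : ℕ) : Rep := @Nat.rec (fun _ => Rep) p (fun _ q => rD q) k

/-- The Fréchet derivative. -/
noncomputable def rfrechet (K v : Rep) : Rep :=
  rderiv (fun i => sel (Nat.beq (Nat.mod (Nat.div i 2) 4) 1)
    (rDn (sel (Nat.beq (Nat.mod i 2) 0) v (rbar v)) (Nat.div i 8)) []) K

/-- The right-hand side of the evolution equation of `u(j)`. -/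
noncomputable def rrhs (K : Rep) (f : ℕ → Rep) (j : ℕ) : Rep :=
  sel (Nat.beq j 1) K (collect (cat (rfrechet K [([(1, 0, 1)], [Nat.mul 2 j])]) (f j)))

/-- Case distinction by the value of a number, which is passed on as a numeral. -/
noncomputable def pass (f : ℕ → Rep) (j : ℕ) : Rep :=
  sel (Nat.beq j 1) (f 1) (sel (Nat.beq j 2) (f 2) (sel (Nat.beq j 3) (f 3) (f j)))

/-- The time derivative. -/
noncomputable def rdt (K : Rep) (f : ℕ → Rep) (p : Rep) : Rep :=
  rderiv (fun i => pass (fun j => sel (Nat.beq (Nat.mod i 2) 0)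
    (rDn (rrhs K f j) (Nat.div i 8)) (rDn (rbar (rrhs K f j)) (Nat.div i 8)))
      (Nat.mod (Nat.div i 2) 4)) p

/-- The operator `M`. -/
noncomputable def rM (K : Rep) (f : ℕ → Rep) (p : Rep) : Rep :=
  cat (rdt K f p) (rsmul [(1, 2, 1)] (rfrechet K p))

section
variable (χ : ℕ →*₀ ℝ)

theorem dξ_jet (i : ℕ) : dξ (X (jet i)) = X (jet (i + 8)) := by
  have e1 : (i + 8) / 2 % 4 = i / 2 % 4 := by omega
  have e2 : (i + 8) / 8 = i / 8 + 1 := by omega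
  have e3 : (i + 8) % 2 = i % 2 := by omega
  rcases Nat.mod_two_eq_zero_or_one i with h | h
  · simp [jet, e1, e2, e3, h, dξ, u]
  · simp [jet, e1, e2, e3, h, dξ, ū]

theorem den_rD (p : Rep) : den χ (rD p) = dξ (den χ p) := by
  rw [rD, den_collect]
  exact den_rderiv χ _ _ (fun i => by simp [dξ_jet, tval]) p

theorem den_rDn (p : Rep) (k : ℕ) : den χ (rDn p k) = dξ^[k] (den χ p) := by
  induction k with
  | zero => rfl
  | succ k ih =>
    change den χ (rD (rDn p k)) = _
    rw [den_rD, ih, Function.iterate_succ_apply']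

theorem den_rfrechet (K v : Rep) : den χ (rfrechet K v) = frechet (den χ K) (den χ v) := by
  refine den_rderiv χ _ _ (fun i => ?_) K
  have hm : Nat.mod (Nat.div i 2) 4 = i / 2 % 4 := rfl
  have hm2 : Nat.mod i 2 = i % 2 := rfl
  have hd : Nat.div i 8 = i / 8 := rfl
  simp only [hm, hm2, hd]
  rcases hj : Nat.beq (i / 2 % 4) 1 with _ | _
  · have hj' : i / 2 % 4 ≠ 1 := fun h => by simp [h] at hj
    rcases Nat.mod_two_eq_zero_or_one i with h | h <;> simp [jet, h, hj']
  · have hj' : i / 2 % 4 = 1 := Nat.eq_of_beq_eq_true hj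
    rcases Nat.mod_two_eq_zero_or_one i with h | h <;>
      simp [jet, h, hj', den_rDn, den_rbar, Nat.beq]

theorem den_rrhs (K : Rep) (f : ℕ → Rep) (F : ℕ → DiffPoly) (hF : ∀ j < 4, den χ (f j) = F j)
    (j : ℕ) (hj : j < 4) : den χ (rrhs K f j) = rhs (den χ K) F j := by
  rcases h : Nat.beq j 1 with _ | _
  · have h' : j ≠ 1 := fun h' => by simp [h'] at h
    have e : den χ [([(1, 0, 1)], [Nat.mul 2 j])] = u j 0 := by
      have e1 : 2 * j / 8 = 0 := by omega
      have e2 : j % 4 = j := by omega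
      simp [jet, u, e1, e2, tval]
    rw [rrhs, h, sel_false, rhs, if_neg h', den_collect, cat_eq, den_append, den_rfrechet, e,
      hF j hj]
  · obtain rfl := Nat.eq_of_beq_eq_true h
    simp [rrhs, rhs, Nat.beq]

theorem pass_eq (f : ℕ → Rep) (j : ℕ) : pass f j = f j := by
  rw [pass]
  rcases h1 : Nat.beq j 1 with _ | _
  · rcases h2 : Nat.beq j 2 with _ | _
    · rcases h3 : Nat.beq j 3 with _ | _
      · rfl
      · rw [Nat.eq_of_beq_eq_true h3]; rfl
    · rw [Nat.eq_of_beq_eq_true h2]; rfl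
  · rw [Nat.eq_of_beq_eq_true h1]; rfl

theorem den_rM (K : Rep) (f : ℕ → Rep) (F : ℕ → DiffPoly) (hF : ∀ j < 4, den χ (f j) = F j)
    (p : Rep) : den χ (rM K f p) = M (den χ K) F (den χ p) := by
  have h : den χ (rdt K f p) = dt (den χ K) F (den χ p) := by
    refine den_rderiv χ _ _ (fun i => ?_) p
    have hr := den_rrhs χ K f F hF (i / 2 % 4) (Nat.mod_lt _ (by norm_num))
    have hm : Nat.mod (Nat.div i 2) 4 = i / 2 % 4 := rfl
    have hm2 : Nat.mod i 2 = i % 2 := rfl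
    have hd : Nat.div i 8 = i / 8 := rfl
    rw [pass_eq, hm, hm2, hd]
    rcases Nat.mod_two_eq_zero_or_one i with h | h <;>
      simp [jet, h, dt, den_rDn, den_rbar, hr, Nat.beq]
  rw [rM, cat_eq, den_append, den_rsmul, den_rfrechet, h, M]
  simp [sub_eq_add_neg, tval]

end

/-- The exponents of a monomial in the jet variables. -/
noncomputable def exponents (l : List ℕ) : Jet →₀ ℕ := (l.map fun i => Finsupp.single (jet i) 1).sum

theorem mono_eq_monomial (l : List ℕ) : mono l = monomial (exponents l) 1 := by
  induction l with
  | nil => simp [exponents]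
  | cons i l ih =>
    rw [mono_cons, ih, X, monomial_mul, one_mul, exponents, exponents, List.map_cons,
      List.sum_cons]

theorem jetCode_jet (i : ℕ) : jetCode (jet i) = i := by
  rcases Nat.mod_two_eq_zero_or_one i with h | h <;> simp [jet, h, jetCode] <;> omega

theorem key_eq (l : List ℕ) : key l = (exponents l).sum fun J n => n * 2 ^ (4 * jetCode J) := by
  induction l with
  | nil => simp [key, exponents]
  | cons i l ih =>
    rw [exponents, List.map_cons, List.sum_cons, ← exponents, Finsupp.sum_add_index',
      Finsupp.sum_single_index, ← ih, jetCode_jet, one_mul, key, fold_cons, ← key]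
    · exact congrArg (· + key l) rfl
    · simp
    · simp
    · intros; ring

/-- The pairs of consecutive keys. -/
noncomputable def keyPairs (p : Rep) : List (ℕ × ℕ) :=
  @List.rec (Coef × List ℕ) (fun _ => List (ℕ × ℕ)) []
    (fun s p ih => @List.rec (Coef × List ℕ) (fun _ => List (ℕ × ℕ)) []
      (fun t _ _ => (key s.2, key t.2) :: ih) p) p

/-- Strictly increasing keys. -/
noncomputable def increasing (p : Rep) : Bool :=
  allB (fun s => Nat.ble (Nat.succ s.1) s.2) 9 (keyPairs p)

theorem increasing_cons {s : Coef × List ℕ} {p : Rep} (h : increasing (s :: p) = true) :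
    increasing p = true := by
  cases p with
  | nil => rfl
  | cons t p =>
    rw [increasing, allB_iff] at h ⊢
    exact fun a ha => h a (List.mem_cons_of_mem (key s.2, key t.2) ha)

theorem increasing_head {s : Coef × List ℕ} {p : Rep} (h : increasing (s :: p) = true) :
    ∀ t ∈ p, key s.2 < key t.2 := by
  induction p generalizing s with
  | nil => simp
  | cons t p ih =>
    have h1 : key s.2 < key t.2 := by
      rw [increasing, allB_iff] at h
      exact Nat.le_of_ble_eq_true (h (key s.2, key t.2) List.mem_cons_self)
    intro r hr
    rcases List.mem_cons.1 hr with rfl | hr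
    · exact h1
    · exact h1.trans (ih (increasing_cons h) r hr)

theorem coeff_den_of_forall_key_ne (χ : ℕ →*₀ ℝ) (p : Rep) (l : List ℕ)
    (h : ∀ t ∈ p, key l < key t.2) : coeff (exponents l) (den χ p) = 0 := by
  induction p with
  | nil => simp
  | cons t p ih =>
    rw [den_cons, coeff_add, ih fun r hr => h r (List.mem_cons_of_mem _ hr), coeff_C_mul,
      mono_eq_monomial, coeff_monomial, if_neg]
    · simp
    · intro e
      have := h t List.mem_cons_self
      rw [key_eq, key_eq, e] at this
      exact lt_irrefl _ this

theorem den_eq_zero_iff (χ : ℕ →*₀ ℝ) (p : Rep) (h : increasing p = true) :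
    den χ p = 0 ↔ ∀ t ∈ p, val χ t.1 = 0 := by
  constructor
  · intro h0
    induction p with
    | nil => simp
    | cons s p ih =>
      have hs : val χ s.1 = 0 := by
        have := congrArg (coeff (exponents s.2)) h0
        rw [den_cons, coeff_add, coeff_den_of_forall_key_ne χ p s.2 (increasing_head h),
          coeff_C_mul, mono_eq_monomial, coeff_monomial, if_pos rfl] at this
        simpa using this
      have := ih (increasing_cons h) (by simpa [hs] using h0)
      simpa [hs] using this
  · intro h0
    clear h
    induction p with
    | nil => simp
    | cons s p ih =>
      rw [den_cons, h0 s List.mem_cons_self, ih fun t ht => h0 t (List.mem_cons_of_mem _ ht)]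
      simp

/-- Replaces the factor `q` by a coefficient. -/
noncomputable def crewrite (q : ℕ) (r c : Coef) : Coef :=
  fold (fun t c' => sel (Nat.beq (Nat.mod t.1 q) 0)
    (cat (cmul [(Nat.div t.1 q, t.2)] r) c') (t :: c')) [] c

theorem val_crewrite (χ : ℕ →*₀ ℝ) (q : ℕ) (r : Coef) (h : (χ q : ℂ) = val χ r) (c : Coef) :
    val χ (crewrite q r c) = val χ c := by
  induction c with
  | nil => simp [crewrite]
  | cons t c ih =>
    rw [crewrite, fold_cons, ← crewrite, val_cons]
    rcases hq : Nat.beq (Nat.mod t.1 q) 0 with _ | _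
    · rw [sel_false, val_cons, ih]
    · obtain ⟨m, hm⟩ := Nat.dvd_of_mod_eq_zero (Nat.eq_of_beq_eq_true hq)
      rw [sel_true, cat_eq, val_append, ih, val_cmul, ← h, val_cons, val_nil]
      congr 1
      have hd : Nat.div t.1 q = t.1 / q := rfl
      simp only [tval, hd]
      rcases Nat.eq_zero_or_pos q with rfl | hq
      · simp [hm]
      · rw [hm, Nat.mul_div_cancel_left _ hq]
        simp only [map_mul]
        push_cast
        ring

/-- Replaces a factor by the coefficient that the rules give for it, otherwise leaves the term;
the rules are looked up by the binary digits of the factor. -/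
noncomputable def look (t : ℕ × ℕ × ℕ) (x d : ℕ) : List (ℕ × Coef) → Coef → Coef :=
  @Nat.rec (fun _ => List (ℕ × Coef) → Coef → Coef)
    (fun rules c => fold (fun r r' => sel (Nat.beq r.1 x)
      (cat (cmul [(Nat.div t.1 x, t.2)] r.2) c) r') (t :: c) rules)
    (fun k ih rules c => sel (Nat.beq (Nat.mod (Nat.div x (Nat.pow 2 k)) 2) 0)
      (ih (fold (fun r l => sel (Nat.beq (Nat.mod (Nat.div r.1 (Nat.pow 2 k)) 2) 0) (r :: l) l)
        [] rules) c)
      (ih (fold (fun r l => sel (Nat.beq (Nat.mod (Nat.div r.1 (Nat.pow 2 k)) 2) 0) l (r :: l))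
        [] rules) c)) d

/-- Replaces the factors of `z` according to the rules. -/
noncomputable def substitute (z : ℕ) (rules : List (ℕ × Coef)) (c : Coef) : Coef :=
  fold (fun t c' => sel (Nat.beq (Nat.gcd t.1 z) 1) (t :: c')
    (look t (Nat.gcd t.1 z) 7 rules c')) [] c

section
variable (χ : ℕ →*₀ ℝ)

theorem val_look (t : ℕ × ℕ × ℕ) (x : ℕ) (hx : x ∣ t.1) (d : ℕ) (rules : List (ℕ × Coef))
    (h : ∀ r ∈ rules, (χ r.1 : ℂ) = val χ r.2) (c : Coef) :
    val χ (look t x d rules c) = tval χ t + val χ c := by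
  induction d generalizing rules with
  | zero =>
    change val χ (fold (fun r r' => sel (Nat.beq r.1 x)
      (cat (cmul [(Nat.div t.1 x, t.2)] r.2) c) r') (t :: c) rules) = _
    induction rules with
    | nil => simp
    | cons r rules ih =>
      rw [fold_cons]
      rcases hq : Nat.beq r.1 x with _ | _
      · exact ih fun s hs => h s (List.mem_cons_of_mem _ hs)
      · obtain rfl := Nat.eq_of_beq_eq_true hq
        obtain ⟨m, hm⟩ := hx
        rw [sel_true, cat_eq, val_append, val_cmul, ← h r List.mem_cons_self, val_cons, val_nil]
        congr 1
        have hd : Nat.div t.1 r.1 = t.1 / r.1 := rfl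
        simp only [tval, hd]
        rcases Nat.eq_zero_or_pos r.1 with h0 | h0
        · simp [hm, h0]
        · rw [hm, Nat.mul_div_cancel_left _ h0]
          simp only [map_mul]
          push_cast
          ring
  | succ k ih =>
    have hsub (p : ℕ × Coef → Bool) (rules : List (ℕ × Coef)) :
        (∀ r ∈ fold (fun r l => sel (p r) (r :: l) l) [] rules, r ∈ rules) ∧
        (∀ r ∈ fold (fun r l => sel (p r) l (r :: l)) [] rules, r ∈ rules) := by
      induction rules with
      | nil => simp
      | cons s rules ih =>
        rw [fold_cons, fold_cons]
        rcases p s with _ | _ <;>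
          simp only [sel_true, sel_false, List.mem_cons, forall_eq_or_imp, true_or, true_and] <;>
          exact ⟨fun r hr => .inr (ih.1 r hr), fun r hr => .inr (ih.2 r hr)⟩
    change val χ (sel (Nat.beq (Nat.mod (Nat.div x (Nat.pow 2 k)) 2) 0)
      (look t x k (fold (fun r l =>
        sel (Nat.beq (Nat.mod (Nat.div r.1 (Nat.pow 2 k)) 2) 0) (r :: l) l) [] rules) c)
      (look t x k (fold (fun r l =>
        sel (Nat.beq (Nat.mod (Nat.div r.1 (Nat.pow 2 k)) 2) 0) l (r :: l)) [] rules) c)) = _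
    rcases Nat.beq (Nat.mod (Nat.div x (Nat.pow 2 k)) 2) 0 with _ | _
    · exact ih _ fun r hr => h r ((hsub _ rules).2 r hr)
    · exact ih _ fun r hr => h r ((hsub _ rules).1 r hr)

theorem val_substitute (z : ℕ) (rules : List (ℕ × Coef))
    (h : ∀ r ∈ rules, (χ r.1 : ℂ) = val χ r.2) (c : Coef) :
    val χ (substitute z rules c) = val χ c := by
  induction c with
  | nil => rfl
  | cons t c ih =>
    rw [substitute, fold_cons, ← substitute, val_cons, ← ih]
    rcases Nat.beq (Nat.gcd t.1 z) 1 with _ | _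
    · rw [sel_false]
      exact val_look χ t _ (Nat.gcd_dvd_left _ _) _ _ h _
    · simp

end

/-- The terms of a coefficient with an even or with an odd power of `i`. -/
noncomputable def part (o : ℕ) (c : Coef) : Coef :=
  fold (fun t r => sel (Nat.beq (Nat.mod t.2.1 2) o) (t :: r) r) [] c

/-- The real and imaginary parts of the coefficients of a differential polynomial. -/
noncomputable def rows (p : Rep) : List Coef :=
  fold (fun t r => part 0 t.1 :: part 1 t.1 :: r) [] p

/-- An entry of a list of coefficients. -/
noncomputable def row (l : List Coef) : ℕ → Coef :=
  @List.rec Coef (fun _ => ℕ → Coef) (fun _ => [])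
    (fun c _ ih k => @Nat.rec (fun _ => Coef) c (fun n _ => ih n) k) l

/-- The linear combination of rows with weights `c i ^ e`, given as triples of row, `e`, `c`. -/
noncomputable def combine (l : List Coef) (w : List (ℕ × ℕ × ℕ)) : Coef :=
  ccollect (fold (fun s r => cat (cmul [(1, s.2)] (row l s.1)) r) [] w)

/-- Drops the terms that have a factor in common with `z`. -/
noncomputable def reduceMod (z : ℕ) (c : Coef) : Coef :=
  fold (fun t r => sel (Nat.beq (Nat.gcd t.1 z) 1) (t :: r) r) [] c

/-- Trial division. -/
noncomputable def noFactor (n : ℕ) (k : ℕ) : Bool :=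
  @Nat.rec (fun _ => Bool) true
    (fun k ih => sel (Nat.beq (Nat.mod n (Nat.add k 2)) 0) false ih) k

/-- Primality test for numbers below `2500`. -/
noncomputable def smallPrime (n : ℕ) : Bool :=
  sel (Nat.ble n 1) false (sel (Nat.ble n 49) (noFactor n (Nat.sub n 2))
    (sel (Nat.ble n 2499) (noFactor n 48) false))

/-- Whether a coefficient is a non-zero multiple of a given parameter. -/
noncomputable def isMultiple (x : ℕ) (c : Coef) : Bool :=
  @List.rec (ℕ × ℕ × ℕ) (fun _ => Bool) false (fun t c _ =>
    @List.rec (ℕ × ℕ × ℕ) (fun _ => Bool)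
      (sel (Nat.beq t.1 x) (sel (Nat.beq t.2.2 0) false true) false) (fun _ _ _ => false) c) c

/-- Whether a coefficient has no terms. -/
noncomputable def isNil (c : Coef) : Bool :=
  @List.rec (ℕ × ℕ × ℕ) (fun _ => Bool) true (fun _ _ _ => false) c

/-- An elimination step: an unknown and weights for a linear combination of rows. -/
abbrev Step : Type := ℕ × List (ℕ × ℕ × ℕ)

/-- Pairs each step with the product of the unknowns of the earlier steps. -/
noncomputable def withPrevious (steps : List Step) : ℕ → List (ℕ × Step) :=
  fold (fun s k z => (z, s) :: k (Nat.mul z s.1)) (fun _ => []) steps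

/-- The product of the unknowns. -/
noncomputable def unknowns (steps : List Step) : ℕ :=
  fold (fun s n => Nat.mul s.1 n) 1 steps

/-- Checks an elimination step. -/
noncomputable def checkStep (l : List Coef) (s : ℕ × Step) : Bool :=
  sel (smallPrime s.2.1) (isMultiple s.2.1 (reduceMod s.1 (combine l s.2.2))) false

/-- Checks that a differential polynomial vanishes exactly if all the unknowns do. -/
noncomputable def checkSystem (p : Rep) (steps : List Step) : Bool :=
  sel (increasing p) (sel (allB (checkStep (rows p)) 9 (withPrevious steps 1))
    (allB (fun c => isNil (reduceMod (unknowns steps) c)) 9 (rows p)) false) false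

theorem prime_of_smallPrime {n : ℕ} (h : smallPrime n = true) : n.Prime := by
  have aux (k : ℕ) (hk : noFactor n k = true) (m : ℕ) (h2 : 2 ≤ m) (hm : m ≤ k + 1) :
      ¬ m ∣ n := by
    induction k with
    | zero => omega
    | succ k ih =>
      change sel (Nat.beq (Nat.mod n (Nat.add k 2)) 0) false (noFactor n k) = true at hk
      rcases hb : Nat.beq (Nat.mod n (Nat.add k 2)) 0 with _ | _
      · rw [hb, sel_false] at hk
        rcases Nat.lt_or_ge m (k + 2) with h | h
        · exact ih hk (by omega)
        · obtain rfl : m = k + 2 := by omega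
          intro hd
          have : Nat.mod n (Nat.add k 2) = 0 := Nat.mod_eq_zero_of_dvd hd
          rw [this] at hb
          simp at hb
      · rw [hb] at hk
        simp at hk
  rw [smallPrime] at h
  have h1 : 2 ≤ n := by
    by_contra hn
    rw [Nat.ble_eq_true_of_le (by omega)] at h
    simp at h
  have hb1 : Nat.ble n 1 = false := by
    by_contra hb
    have := Nat.le_of_ble_eq_true (by simpa using hb : Nat.ble n 1 = true)
    omega
  rw [hb1, sel_false] at h
  rw [Nat.prime_def_le_sqrt]
  refine ⟨h1, fun m h2 hm hd => ?_⟩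
  have hs : m * m ≤ n := Nat.le_sqrt.1 hm
  rcases hb : Nat.ble n 49 with _ | _
  · rw [hb, sel_false] at h
    rcases hc : Nat.ble n 2499 with _ | _
    · rw [hc] at h
      simp at h
    · rw [hc, sel_true] at h
      have h3 : n ≤ 2499 := Nat.le_of_ble_eq_true hc
      exact aux _ h m h2 (by nlinarith) hd
  · rw [hb, sel_true] at h
    have : 2 * m ≤ n := by nlinarith
    have e : Nat.sub n 2 = n - 2 := rfl
    rw [e] at h
    exact aux _ h m h2 (by omega) hd

section
variable (χ : ℕ →*₀ ℝ)

theorem val_part_eq (c : Coef) : val χ c = val χ (part 0 c) + val χ (part 1 c) ∧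
    (val χ (part 0 c)).im = 0 ∧ (val χ (part 1 c)).re = 0 := by
  induction c with
  | nil => simp [part]
  | cons t c ih =>
    obtain ⟨h1, h2, h3⟩ := ih
    have e (o : ℕ) : part o (t :: c) = sel (Nat.beq (t.2.1 % 2) o) (t :: part o c) (part o c) := rfl
    rw [e, e, val_cons, h1]
    rcases Nat.mod_two_eq_zero_or_one t.2.1 with h | h
    · have ht : (tval χ t).im = 0 := by
        obtain ⟨m, hm⟩ := Nat.dvd_of_mod_eq_zero h
        have e : tval χ t = ((t.2.2 * (-1) ^ m * χ t.1 : ℝ) : ℂ) := by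
          rw [tval, hm, pow_mul, Complex.I_sq]
          push_cast
          rfl
        rw [e, Complex.ofReal_im]
      rw [h]
      simp [Nat.beq, h2, h3, ht]
      ring
    · have ht : (tval χ t).re = 0 := by
        obtain ⟨m, hm⟩ : ∃ m, t.2.1 = 2 * m + 1 := ⟨t.2.1 / 2, by omega⟩
        have e : tval χ t = ((t.2.2 * (-1) ^ m * χ t.1 : ℝ) : ℂ) * Complex.I := by
          rw [tval, hm, pow_succ, pow_mul, Complex.I_sq]
          push_cast
          ring
        rw [e, Complex.re_ofReal_mul, Complex.I_re, mul_zero]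
      rw [h]
      simp [Nat.beq, h2, h3, ht]
      ring

theorem forall_mem_rows_iff (p : Rep) :
    (∀ c ∈ rows p, val χ c = 0) ↔ ∀ t ∈ p, val χ t.1 = 0 := by
  induction p with
  | nil => simp [rows]
  | cons t p ih =>
    rw [rows, fold_cons, ← rows]
    simp only [List.mem_cons, forall_eq_or_imp]
    rw [ih, ← and_assoc]
    refine and_congr_left fun _ => ?_
    obtain ⟨h1, h2, h3⟩ := val_part_eq χ t.1
    constructor
    · rintro ⟨ha, hb⟩
      rw [h1, ha, hb, add_zero]
    · intro h
      rw [h1] at h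
      have hr := congrArg Complex.re h
      have hi := congrArg Complex.im h
      simp only [Complex.add_re, Complex.add_im, h2, h3, Complex.zero_re, Complex.zero_im,
        add_zero, zero_add] at hr hi
      exact ⟨Complex.ext hr h2, Complex.ext h3 hi⟩

theorem val_row (l : List Coef) (h : ∀ c ∈ l, val χ c = 0) (k : ℕ) : val χ (row l k) = 0 := by
  induction l generalizing k with
  | nil => simp [row]
  | cons c l ih =>
    cases k with
    | zero => exact h c List.mem_cons_self
    | succ k => exact ih (fun d hd => h d (List.mem_cons_of_mem _ hd)) k

theorem val_combine (l : List Coef) (h : ∀ c ∈ l, val χ c = 0) (w : List (ℕ × ℕ × ℕ)) :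
    val χ (combine l w) = 0 := by
  rw [combine, val_ccollect]
  induction w with
  | nil => simp
  | cons s w ih => rw [fold_cons, cat_eq, val_append, ih, val_cmul, val_row χ l h]; simp

theorem val_reduceMod (z : ℕ) (hz : ∀ d, d ∣ z → d ≠ 1 → χ d = 0) (c : Coef) :
    val χ (reduceMod z c) = val χ c := by
  induction c with
  | nil => rfl
  | cons t c ih =>
    rw [reduceMod, fold_cons, ← reduceMod, val_cons]
    rcases hb : Nat.beq (Nat.gcd t.1 z) 1 with _ | _
    · have hg : Nat.gcd t.1 z ≠ 1 := fun h => by simp [h] at hb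
      obtain ⟨m, hm⟩ := Nat.gcd_dvd_left t.1 z
      have : χ t.1 = 0 := by rw [hm, map_mul, hz _ (Nat.gcd_dvd_right _ _) hg, zero_mul]
      simp [ih, tval, this]
    · rw [sel_true, val_cons, ih]

theorem eq_zero_of_isMultiple {x : ℕ} {c : Coef} (h : isMultiple x c = true)
    (hc : val χ c = 0) : χ x = 0 := by
  match c with
  | [] => simp [isMultiple] at h
  | [t] =>
    change sel (Nat.beq t.1 x) (sel (Nat.beq t.2.2 0) false true) false = true at h
    rcases hb : Nat.beq t.1 x with _ | _
    · simp [hb] at h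
    · rcases hd : Nat.beq t.2.2 0 with _ | _
      · have hx := Nat.eq_of_beq_eq_true hb
        have h0 : t.2.2 ≠ 0 := fun h0 => by simp [h0] at hd
        simpa [tval, hx, h0] using hc
      · simp [hb, hd] at h
  | _ :: _ :: _ => simp [isMultiple] at h

theorem forall_dvd_mul_prime {z x : ℕ} (hx : x.Prime) (h0 : χ x = 0)
    (hz : ∀ d, d ∣ z → d ≠ 1 → χ d = 0) : ∀ d, d ∣ z * x → d ≠ 1 → χ d = 0 := by
  intro d hd h1
  obtain ⟨d₁, d₂, h₁, h₂, rfl⟩ := (Nat.dvd_mul).1 hd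
  rcases (Nat.dvd_prime hx).1 h₂ with rfl | rfl
  · rw [mul_one] at h1 ⊢
    exact hz _ h₁ h1
  · rw [map_mul, h0, mul_zero]

theorem forall_dvd_unknowns (steps : List Step) (hp : ∀ s ∈ steps, s.1.Prime)
    (h : ∀ s ∈ steps, χ s.1 = 0) : ∀ d, d ∣ unknowns steps → d ≠ 1 → χ d = 0 := by
  induction steps with
  | nil => exact fun d hd h1 => absurd (Nat.dvd_one.1 hd) h1
  | cons s steps ih =>
    rw [unknowns, fold_cons, ← unknowns, Nat.mul_eq, mul_comm]
    exact forall_dvd_mul_prime χ (hp s List.mem_cons_self) (h s List.mem_cons_self)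
      (ih (fun r hr => hp r (List.mem_cons_of_mem _ hr))
        fun r hr => h r (List.mem_cons_of_mem _ hr))

theorem prime_and_eq_zero_of_checkStep {l : List Coef} (steps : List Step) (z : ℕ)
    (h : ∀ s ∈ withPrevious steps z, checkStep l s = true) :
    (∀ s ∈ steps, s.1.Prime) ∧ ((∀ c ∈ l, val χ c = 0) →
      (∀ d, d ∣ z → d ≠ 1 → χ d = 0) → ∀ s ∈ steps, χ s.1 = 0) := by
  induction steps generalizing z with
  | nil => simp
  | cons s steps ih =>
    have e : withPrevious (s :: steps) z = (z, s) :: withPrevious steps (z * s.1) := rfl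
    rw [e, List.forall_mem_cons] at h
    obtain ⟨h1, h2⟩ := h
    rw [checkStep] at h1
    rcases hsp : smallPrime s.1 with _ | _
    · simp [hsp] at h1
    · have hp := prime_of_smallPrime hsp
      rw [hsp, sel_true] at h1
      obtain ⟨i1, i2⟩ := ih _ h2
      refine ⟨List.forall_mem_cons.2 ⟨hp, i1⟩, fun hl hz => ?_⟩
      have hx : χ s.1 = 0 := eq_zero_of_isMultiple χ h1
        (by rw [val_reduceMod χ z hz, val_combine χ l hl])
      exact List.forall_mem_cons.2 ⟨hx, i2 hl (forall_dvd_mul_prime χ hp hx hz)⟩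

theorem den_eq_zero_iff_of_checkSystem {p : Rep} {steps : List Step}
    (h : checkSystem p steps = true) : den χ p = 0 ↔ ∀ s ∈ steps, χ s.1 = 0 := by
  rw [checkSystem] at h
  rcases hi : increasing p with _ | _
  · simp [hi] at h
  rcases hs : allB (checkStep (rows p)) 9 (withPrevious steps 1) with _ | _
  · simp [hi, hs] at h
  rw [hi, hs, sel_true, sel_true, allB_iff] at h
  rw [allB_iff] at hs
  obtain ⟨h1, h2⟩ := prime_and_eq_zero_of_checkStep χ steps 1 hs
  rw [den_eq_zero_iff χ p hi, ← forall_mem_rows_iff]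
  refine ⟨fun hr => h2 hr fun d hd h1 => absurd (Nat.dvd_one.1 hd) h1, fun h0 c hc => ?_⟩
  have hc := h c hc
  rw [← val_reduceMod χ _ (forall_dvd_unknowns χ steps h1 h0)]
  cases hr : reduceMod (unknowns steps) c with
  | nil => simp
  | cons t c => simp [hr, isNil] at hc

end

/-- The first 318 primes. -/
def primes : List ℕ :=
  [2, 3, 5, 7, 11, 13, 17, 19, 23, 29, 31, 37, 41, 43, 47, 53, 59, 61, 67, 71, 73, 79, 83, 89, 97,
   101, 103, 107, 109, 113, 127, 131, 137, 139, 149, 151, 157, 163, 167, 173, 179, 181, 191, 193,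
   197, 199, 211, 223, 227, 229, 233, 239, 241, 251, 257, 263, 269, 271, 277, 281, 283, 293, 307,
   311, 313, 317, 331, 337, 347, 349, 353, 359, 367, 373, 379, 383, 389, 397, 401, 409, 419, 421,
   431, 433, 439, 443, 449, 457, 461, 463, 467, 479, 487, 491, 499, 503, 509, 521, 523, 541, 547,
   557, 563, 569, 571, 577, 587, 593, 599, 601, 607, 613, 617, 619, 631, 641, 643, 647, 653, 659,
   661, 673, 677, 683, 691, 701, 709, 719, 727, 733, 739, 743, 751, 757, 761, 769, 773, 787, 797,
   809, 811, 821, 823, 827, 829, 839, 853, 857, 859, 863, 877, 881, 883, 887, 907, 911, 919, 929,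
   937, 941, 947, 953, 967, 971, 977, 983, 991, 997, 1009, 1013, 1019, 1021, 1031, 1033, 1039,
   1049, 1051, 1061, 1063, 1069, 1087, 1091, 1093, 1097, 1103, 1109, 1117, 1123, 1129, 1151, 1153,
   1163, 1171, 1181, 1187, 1193, 1201, 1213, 1217, 1223, 1229, 1231, 1237, 1249, 1259, 1277, 1279,
   1283, 1289, 1291, 1297, 1301, 1303, 1307, 1319, 1321, 1327, 1361, 1367, 1373, 1381, 1399, 1409,
   1423, 1427, 1429, 1433, 1439, 1447, 1451, 1453, 1459, 1471, 1481, 1483, 1487, 1489, 1493, 1499,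
   1511, 1523, 1531, 1543, 1549, 1553, 1559, 1567, 1571, 1579, 1583, 1597, 1601, 1607, 1609, 1613,
   1619, 1621, 1627, 1637, 1657, 1663, 1667, 1669, 1693, 1697, 1699, 1709, 1721, 1723, 1733, 1741,
   1747, 1753, 1759, 1777, 1783, 1787, 1789, 1801, 1811, 1823, 1831, 1847, 1861, 1867, 1871, 1873,
   1877, 1879, 1889, 1901, 1907, 1913, 1931, 1933, 1949, 1951, 1973, 1979, 1987, 1993, 1997, 1999,
   2003, 2011, 2017, 2027, 2029, 2039, 2053, 2063, 2069, 2081, 2083, 2087, 2089, 2099, 2111]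

/-- The primes that stand for the parameters: `a`, `b`, the two constraints, the real and imaginary
parts of the `τ_j` and `η_j`, the deviations of the coefficients of `f_3(j)` from their solved
values, and the deviations of the dependent coefficients of `f_2(j)`. -/
def pr (k : ℕ) : ℕ := primes.getD k 1

namespace Atom

def a : ℕ := pr 0
def b : ℕ := pr 1
def c₁ : ℕ := pr 2
def c₂ : ℕ := pr 3
def R (j : ℕ) : ℕ := pr (3 + j)
def I (j : ℕ) : ℕ := pr (15 + j)
def S (j : ℕ) : ℕ := pr (27 + j)
def T (j : ℕ) : ℕ := pr (61 + j)
def dRe (j : ℕ) : ℕ := pr (95 + j)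
def dIm (j : ℕ) : ℕ := pr (172 + j)
def eRe (j : ℕ) : ℕ := pr (249 + j)
def eIm (j : ℕ) : ℕ := pr (283 + j)

end Atom

open Atom

/-- The monomials of `f_2(2)`. -/
def monos22 : List (List ℕ) :=
  [[2, 10, 3], [2, 2, 11]]

/-- The monomials of `f_3(2)`. -/
def monos32 : List (List ℕ) :=
  [[2, 2, 2, 3, 3], [2, 10, 11], [10, 10, 3], [2, 2, 19], [2, 18, 3]]

/-- The monomials of `f_2(3)`. -/
def monos23 : List (List ℕ) :=
  [[2, 2, 2, 3, 3], [2, 10, 11], [2, 18, 3], [2, 2, 19], [10, 10, 3], [2, 12, 3], [2, 2, 13],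
   [4, 4, 3], [2, 4, 5], [10, 4, 3], [2, 4, 11], [2, 10, 5]]

/-- The monomials of `f_3(3)`. -/
def monos33 : List (List ℕ) :=
  [[2, 2, 10, 3, 3], [2, 2, 2, 3, 11], [2, 26, 3], [2, 2, 27], [10, 10, 11], [2, 10, 19],
   [2, 18, 11], [10, 18, 3], [2, 2, 4, 3, 3], [2, 2, 2, 3, 5], [4, 4, 11], [10, 4, 5],
   [10, 4, 11], [4, 4, 5], [10, 10, 5], [2, 20, 3], [2, 2, 21], [2, 4, 19], [18, 4, 3],
   [2, 18, 5], [4, 12, 3], [2, 12, 5], [10, 12, 3], [2, 12, 11], [2, 10, 13], [2, 4, 13]]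

/-- The monomials of `f_2(4)`. -/
def monos24 : List (List ℕ) :=
  [[2, 2, 10, 3, 3], [2, 2, 2, 3, 11], [2, 26, 3], [2, 2, 27], [10, 10, 11], [2, 10, 19],
   [2, 18, 11], [10, 18, 3], [2, 2, 4, 3, 3], [2, 2, 2, 3, 5], [4, 4, 11], [10, 4, 5],
   [10, 4, 11], [4, 4, 5], [10, 10, 5], [2, 20, 3], [2, 2, 21], [2, 4, 19], [18, 4, 3],
   [2, 18, 5], [4, 12, 3], [2, 12, 5], [10, 12, 3], [2, 12, 11], [2, 10, 13], [2, 4, 13],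
   [2, 6, 11], [10, 6, 3], [2, 10, 7], [2, 6, 5], [4, 6, 3], [2, 4, 7], [2, 14, 3], [2, 2, 15]]

/-- The monomials of `f_3(4)`. -/
def monos34 : List (List ℕ) :=
  [[2, 2, 2, 2, 3, 3, 3], [2, 10, 10, 3, 3], [2, 2, 10, 3, 11], [2, 2, 2, 11, 11],
   [2, 2, 18, 3, 3], [2, 2, 2, 3, 19], [10, 18, 11], [10, 10, 19], [2, 18, 19], [18, 18, 3],
   [10, 26, 3], [2, 26, 11], [2, 10, 27], [2, 34, 3], [2, 2, 35], [2, 4, 4, 3, 3],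
   [2, 2, 4, 3, 5], [2, 2, 2, 5, 5], [2, 10, 4, 3, 3], [2, 2, 4, 3, 11], [2, 2, 10, 3, 5],
   [2, 2, 2, 11, 5], [18, 4, 11], [10, 4, 19], [10, 18, 5], [2, 4, 27], [26, 4, 3], [2, 26, 5],
   [4, 4, 19], [18, 4, 5], [2, 2, 12, 3, 3], [2, 2, 2, 3, 13], [10, 12, 11], [10, 10, 13],
   [18, 12, 3], [2, 12, 19], [2, 18, 13], [2, 20, 11], [10, 20, 3], [2, 10, 21], [2, 28, 3],
   [2, 2, 29], [4, 12, 11], [10, 12, 5], [10, 4, 13], [2, 12, 13], [12, 12, 3], [4, 20, 3],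
   [2, 20, 5], [2, 4, 21], [4, 12, 5], [4, 4, 13], [2, 2, 6, 3, 3], [2, 2, 2, 3, 7], [6, 6, 3],
   [2, 6, 7], [4, 6, 5], [4, 4, 7], [10, 6, 11], [10, 10, 7], [2, 6, 19], [18, 6, 3], [2, 18, 7],
   [2, 14, 11], [10, 14, 3], [2, 10, 15], [2, 22, 3], [2, 2, 23], [10, 6, 5], [4, 6, 11],
   [10, 4, 7], [12, 6, 3], [2, 6, 13], [2, 12, 7], [2, 14, 5], [4, 14, 3], [2, 4, 15]]

/-- The coefficients of `f_3(2)`. -/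
def sol32 : List Coef :=
  [
    [(a, 1, 3)],
    [(b, 1, 12)],
    [(a, 1, 6)],
    [],
    [(a, 1, 6)]]

/-- The coefficients of `f_2(3)` in terms of nine free ones. -/
def sol23 : List Coef :=
  [
    [(a * I 6, 2, 8), (I 1, 1, 8)],
    [(R 2, 0, 8), (I 2, 1, 8)],
    [(a * I 6, 2, 16), (a * I 12, 2, 16), (b * I 6, 0, 16), (I 3, 1, 8)],
    [(a * I 6, 0, 8), (a * I 12, 0, 8), (b * I 6, 2, 8), (R 2, 0, 4), (a * a * I 8, 1, 32),
      (a * b * I 8, 1, 64), (a * R 12, 1, 8), (b * b * I 8, 3, 64), (b * R 12, 1, 8), (I 1, 1, 8),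
      (I 2, 1, 2), (I 3, 3, 2), (I 5, 3, 4)],
    [(a * I 6, 0, 8), (a * I 12, 2, 8), (b * I 6, 2, 8), (b * I 12, 0, 16), (R 2, 0, 4),
      (I 5, 1, 8)],
    [(a * I 8, 2, 32), (I 6, 1, 8)],
    [(a * I 8, 0, 32), (b * I 8, 2, 32), (R 12, 0, 8)],
    [(I 8, 1, 8)],
    [(I 8, 1, 16)],
    [(R 12, 0, 8), (I 12, 1, 8)],
    [(a * I 8, 0, 32), (b * I 8, 2, 64), (R 12, 0, 8), (I 6, 1, 8), (I 12, 1, 8)],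
    [(R 12, 0, 8), (I 12, 1, 8)]]

/-- The deviations of the dependent coefficients of `f_2(3)`. -/
def dev23 : List Coef :=
  [[(eRe 1, 0, 1)], [], [(eRe 3, 0, 1)], [(eRe 4, 0, 1), (eIm 4, 1, 1)], [(eRe 5, 0, 1)],
   [(eRe 6, 0, 1)], [(eRe 7, 0, 1), (eIm 7, 1, 1)], [(eRe 8, 0, 1)],
   [(eRe 9, 0, 1), (eIm 9, 1, 1)], [(eRe 10, 0, 1), (eIm 10, 1, 1)],
   [(eRe 11, 0, 1), (eIm 11, 1, 1)], []]

/-- The coefficients of `f_3(3)`. -/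
def sol33 : List Coef :=
  [
    [(a * a * I 8, 0, 96), (b * R 12, 2, 24), (I 1, 2, 24), (I 2, 0, 6), (I 3, 2, 12),
      (I 5, 2, 12), (a * I 6, 3, 60), (a * I 12, 3, 36), (b * I 6, 1, 12)],
    [(a * a * I 8, 2, 96), (a * b * I 8, 0, 192), (a * R 12, 2, 24), (a * I 6, 3, 24),
      (a * I 12, 3, 24)],
    [(I 3, 2, 12), (a * I 6, 3, 24), (a * I 12, 3, 24), (b * I 6, 1, 24)],
    [],
    [(I 2, 2, 12), (R 2, 1, 12)],
    [(a * a * I 8, 2, 96), (a * b * I 8, 2, 192), (a * R 12, 2, 24), (b * b * I 8, 0, 192),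
      (b * R 12, 2, 24), (I 1, 2, 24), (I 2, 2, 6), (I 3, 0, 6), (I 5, 0, 12), (a * I 6, 1, 24),
      (a * I 12, 1, 24), (b * I 6, 3, 24), (R 2, 1, 12)],
    [(I 2, 2, 12), (R 2, 1, 12)],
    [(I 3, 2, 12), (I 5, 2, 24), (a * I 12, 3, 48), (b * I 12, 1, 48), (R 2, 1, 12)],
    [(I 6, 2, 6), (a * I 8, 3, 72)],
    [(a * I 8, 3, 48)],
    [],
    [(I 8, 2, 24)],
    [(I 6, 2, 12), (I 12, 2, 12), (a * I 8, 1, 48), (b * I 8, 3, 96), (R 12, 1, 12)],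
    [],
    [(I 12, 2, 12), (R 12, 1, 12)],
    [(I 6, 2, 12), (a * I 8, 3, 48)],
    [],
    [],
    [(I 12, 2, 12), (R 12, 1, 12)],
    [(I 12, 2, 12), (R 12, 1, 12)],
    [(I 8, 2, 24)],
    [(I 8, 2, 24)],
    [(I 6, 2, 12), (I 12, 2, 12), (a * I 8, 3, 48), (R 12, 1, 12)],
    [(I 6, 2, 12), (I 12, 2, 12), (a * I 8, 1, 48), (b * I 8, 3, 96), (R 12, 1, 12)],
    [(a * I 8, 1, 96), (b * I 8, 3, 96), (R 12, 1, 24)],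
    []]

/-- The coefficients of `f_2(4)`. -/
def coef24 : List Coef :=
  [[(S 1, 0, 16), (T 1, 1, 16)], [(S 2, 0, 16), (T 2, 1, 8)], [(S 3, 0, 16), (T 3, 1, 8)],
   [(S 4, 0, 16), (T 4, 1, 8)], [(S 5, 0, 8), (T 5, 1, 8)], [(S 6, 0, 16), (T 6, 1, 16)],
   [(S 7, 0, 16), (T 7, 1, 8)], [(S 8, 0, 8), (T 8, 1, 8)], [(S 9, 0, 8), (T 9, 1, 8)],
   [(S 10, 0, 16), (T 10, 1, 16)], [(S 11, 0, 8), (T 11, 1, 8)], [(S 12, 0, 8), (T 12, 1, 8)],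
   [(S 13, 0, 8), (T 13, 1, 8)], [(S 14, 0, 8), (T 14, 1, 8)], [(S 15, 0, 16), (T 15, 1, 16)],
   [(S 16, 0, 8), (T 16, 1, 8)], [(S 17, 0, 8), (T 17, 1, 8)], [(S 18, 0, 16), (T 18, 1, 16)],
   [(S 19, 0, 8), (T 19, 1, 8)], [(S 20, 0, 16), (T 20, 1, 16)], [(S 21, 0, 8), (T 21, 1, 8)],
   [(S 22, 0, 16), (T 22, 1, 16)], [(S 23, 0, 8), (T 23, 1, 8)], [(S 24, 0, 8), (T 24, 1, 8)],
   [(S 25, 0, 8), (T 25, 1, 8)], [(S 26, 0, 8), (T 26, 1, 8)], [(S 27, 0, 16), (T 27, 1, 16)],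
   [(S 28, 0, 8), (T 28, 1, 8)], [(S 29, 0, 8), (T 29, 1, 8)], [(S 30, 0, 8), (T 30, 1, 8)],
   [(S 31, 0, 8), (T 31, 1, 8)], [(S 32, 0, 8), (T 32, 1, 16)], [(S 33, 0, 8), (T 33, 1, 16)],
   [(S 34, 0, 8), (T 34, 1, 8)]]

/-- The coefficients of `f_3(4)` in terms of those of `f_2(4)`, part 1. -/
def sol34_1 : List Coef :=
  [
    [(a * a * I 6 * T 32, 2, 96), (a * I 6 * S 33, 0, 96), (a * S 9, 0, 12), (a * S 10, 2, 24),
      (I 1 * T 33, 0, 48), (I 1 * T 34, 2, 72), (a * a * a * I 8 * T 32, 1, 128),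
      (a * a * b * I 8 * T 32, 1, 256), (a * a * R 12 * T 32, 1, 32),
      (a * a * I 8 * S 27, 3, 128), (a * a * I 8 * S 33, 3, 64), (a * a * I 8 * S 34, 1, 64),
      (a * b * b * I 8 * T 32, 3, 256), (a * b * R 12 * T 32, 1, 32),
      (a * b * I 8 * S 27, 3, 256), (a * b * I 8 * S 33, 3, 192), (a * b * S 22, 3, 16),
      (a * R 12 * S 27, 3, 32), (a * R 12 * S 33, 3, 16), (a * R 12 * S 34, 1, 16),
      (a * I 1 * T 32, 1, 32), (a * I 2 * T 32, 1, 8), (a * I 3 * T 32, 3, 8),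
      (a * I 5 * T 32, 3, 16), (a * I 6 * T 27, 3, 32), (a * I 6 * T 33, 1, 16),
      (a * I 6 * T 34, 1, 88), (a * I 12 * T 27, 3, 32), (a * I 12 * T 33, 3, 48),
      (a * I 12 * T 34, 1, 24), (a * T 10, 3, 16), (a * T 16, 1, 4), (a * T 17, 1, 4),
      (a * T 18, 1, 8), (a * T 20, 3, 8), (b * b * I 8 * S 27, 1, 256),
      (b * b * I 8 * S 33, 1, 128), (b * b * S 21, 3, 8), (b * R 12 * S 27, 3, 32),
      (b * R 12 * S 33, 3, 16), (b * R 12 * S 34, 1, 16), (b * I 6 * T 27, 1, 32),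
      (b * I 6 * T 33, 1, 16), (b * I 6 * T 34, 3, 56), (b * I 12 * T 34, 1, 64), (b * T 9, 3, 8),
      (b * T 16, 3, 6), (b * T 18, 1, 32), (b * T 19, 3, 4), (b * T 23, 3, 2), (b * T 24, 3, 6),
      (R 2 * T 27, 3, 16), (R 2 * T 33, 3, 8), (R 2 * T 34, 1, 20), (I 1 * S 27, 3, 32),
      (I 1 * S 33, 3, 48), (I 1 * S 34, 1, 48), (I 2 * S 27, 3, 8), (I 2 * S 33, 3, 4),
      (I 2 * S 34, 3, 4), (I 3 * S 27, 1, 8), (I 3 * S 33, 1, 12), (I 3 * S 34, 1, 12),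
      (I 5 * S 27, 1, 16), (I 5 * S 33, 1, 8), (I 5 * S 34, 3, 24), (S 1, 1, 8), (S 2, 3, 8),
      (S 3, 1, 10), (S 4, 1, 24), (S 6, 3, 8), (S 7, 1, 2), (S 8, 3, 1)],
    [(a * a * I 8 * T 29, 2, 192), (a * b * I 8 * T 29, 2, 384), (a * R 12 * T 29, 2, 48),
      (a * I 6 * S 28, 0, 96), (a * I 6 * S 29, 2, 48), (a * I 12 * S 28, 0, 96),
      (a * I 12 * S 29, 2, 48), (a * S 23, 2, 24), (b * b * I 8 * T 29, 0, 384),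
      (b * R 12 * T 29, 2, 48), (b * I 6 * S 28, 2, 96), (b * I 6 * S 29, 0, 48),
      (b * S 25, 2, 24), (R 2 * S 29, 2, 24), (I 1 * T 29, 2, 48), (I 2 * T 29, 2, 12),
      (I 3 * T 28, 0, 48), (I 3 * T 29, 0, 12), (I 5 * T 29, 0, 24), (T 1, 2, 48), (T 6, 0, 12),
      (T 8, 2, 6), (a * a * I 8 * S 29, 1, 192), (a * b * I 8 * S 29, 1, 384),
      (a * R 12 * S 29, 1, 48), (a * I 6 * T 28, 1, 96), (a * I 6 * T 29, 3, 48),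
      (a * I 12 * T 28, 1, 96), (a * I 12 * T 29, 3, 48), (a * T 23, 3, 24),
      (b * b * I 8 * S 29, 3, 384), (b * R 12 * S 29, 1, 48), (b * I 6 * T 28, 3, 96),
      (b * I 6 * T 29, 1, 48), (b * T 25, 3, 24), (R 2 * T 29, 3, 24), (I 1 * S 29, 1, 48),
      (I 2 * S 29, 1, 12), (I 3 * S 28, 3, 48), (I 3 * S 29, 3, 12), (I 5 * S 29, 3, 24),
      (S 1, 1, 48), (S 6, 3, 12), (S 8, 1, 6)],
    [(a * a * I 8 * T 28, 0, 192), (a * b * I 8 * T 28, 0, 384), (a * R 12 * T 28, 0, 48),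
      (a * I 6 * S 28, 2, 48), (a * I 6 * S 29, 0, 96), (a * I 12 * S 28, 2, 48),
      (a * I 12 * S 29, 0, 96), (a * S 16, 2, 24), (a * S 17, 2, 24), (a * S 25, 2, 24),
      (b * b * I 8 * T 28, 2, 384), (b * R 12 * T 28, 0, 48), (b * I 6 * S 28, 0, 48),
      (b * I 6 * S 29, 2, 96), (b * S 16, 2, 48), (b * S 17, 2, 48), (b * S 23, 2, 24),
      (R 2 * S 28, 2, 24), (R 2 * S 33, 2, 48), (R 2 * S 34, 2, 48), (I 1 * T 28, 0, 48),
      (I 2 * T 28, 0, 12), (I 2 * T 33, 0, 96), (I 2 * T 34, 2, 48), (I 3 * T 28, 2, 12),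
      (I 3 * T 29, 2, 48), (I 5 * T 28, 2, 24), (T 2, 2, 36), (T 3, 2, 18), (T 4, 0, 12),
      (T 6, 0, 24), (T 7, 2, 6), (T 8, 2, 6), (a * a * I 8 * S 28, 3, 192),
      (a * b * I 8 * S 28, 3, 384), (a * R 12 * S 28, 3, 48), (a * I 6 * T 28, 3, 48),
      (a * I 6 * T 29, 1, 96), (a * I 12 * T 28, 3, 48), (a * I 12 * T 29, 1, 96),
      (a * T 16, 3, 24), (a * T 17, 3, 24), (a * T 25, 3, 24), (b * b * I 8 * S 28, 1, 384),
      (b * R 12 * S 28, 3, 48), (b * I 6 * T 28, 1, 48), (b * I 6 * T 29, 3, 96),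
      (b * T 16, 3, 48), (b * T 17, 3, 48), (b * T 23, 3, 24), (R 2 * T 28, 3, 24),
      (R 2 * T 33, 3, 96), (R 2 * T 34, 3, 48), (I 1 * S 28, 3, 48), (I 2 * S 28, 3, 12),
      (I 2 * S 33, 3, 48), (I 2 * S 34, 1, 48), (I 3 * S 28, 1, 12), (I 3 * S 29, 1, 48),
      (I 5 * S 28, 1, 24), (S 2, 1, 72), (S 3, 1, 36), (S 4, 3, 72), (S 7, 1, 12), (S 8, 1, 6)],
    [(a * a * I 8 * T 27, 0, 384), (a * b * I 8 * T 27, 0, 768), (a * R 12 * T 27, 0, 96),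
      (a * I 6 * S 27, 2, 96), (a * I 6 * S 34, 0, 96), (a * I 12 * S 27, 2, 96),
      (a * I 12 * S 34, 0, 96), (a * S 17, 2, 24), (b * b * I 8 * T 27, 2, 768),
      (b * R 12 * T 27, 0, 96), (b * I 6 * S 27, 0, 96), (b * I 6 * S 34, 2, 96),
      (b * S 18, 0, 48), (b * S 24, 2, 24), (R 2 * S 27, 2, 48), (I 1 * T 27, 0, 96),
      (I 2 * T 27, 0, 24), (I 3 * T 27, 2, 24), (I 3 * T 34, 2, 48), (I 5 * T 27, 2, 48),
      (T 3, 0, 6), (T 6, 0, 12), (T 7, 2, 6), (a * a * I 8 * S 27, 3, 384),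
      (a * b * I 8 * S 27, 3, 768), (a * R 12 * S 27, 3, 96), (a * I 6 * T 27, 3, 96),
      (a * I 6 * T 34, 1, 96), (a * I 12 * T 27, 3, 96), (a * I 12 * T 34, 1, 96),
      (a * T 17, 3, 24), (b * b * I 8 * S 27, 1, 768), (b * R 12 * S 27, 3, 96),
      (b * I 6 * T 27, 1, 96), (b * I 6 * T 34, 3, 96), (b * T 18, 1, 48), (b * T 24, 3, 24),
      (R 2 * T 27, 3, 48), (I 1 * S 27, 3, 96), (I 2 * S 27, 3, 24), (I 3 * S 27, 1, 24),
      (I 3 * S 34, 1, 48), (I 5 * S 27, 1, 48), (S 3, 1, 12), (S 6, 3, 12), (S 7, 1, 12)],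
    [(a * a * I 8 * T 34, 2, 192), (a * b * I 8 * T 34, 2, 384), (a * R 12 * T 34, 2, 48),
      (a * I 6 * S 33, 0, 48), (a * I 6 * S 34, 2, 48), (a * I 12 * S 33, 0, 48),
      (a * I 12 * S 34, 2, 48), (a * S 16, 2, 12), (a * S 20, 2, 24),
      (b * b * I 8 * T 34, 0, 384), (b * R 12 * T 34, 2, 48), (b * I 6 * S 33, 2, 48),
      (b * I 6 * S 34, 0, 48), (b * S 17, 2, 24), (b * S 19, 2, 12), (R 2 * S 34, 2, 24),
      (I 1 * T 34, 2, 48), (I 2 * T 34, 2, 12), (I 3 * T 33, 0, 48), (I 3 * T 34, 0, 12),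
      (I 5 * T 34, 0, 24), (T 1, 2, 24), (T 3, 2, 9), (T 4, 0, 12), (T 7, 0, 3), (T 8, 2, 3),
      (a * a * I 8 * S 34, 1, 192), (a * b * I 8 * S 34, 1, 384), (a * R 12 * S 34, 1, 48),
      (a * I 6 * T 33, 1, 96), (a * I 6 * T 34, 3, 48), (a * I 12 * T 33, 1, 96),
      (a * I 12 * T 34, 3, 48), (a * T 16, 3, 12), (a * T 20, 3, 24),
      (b * b * I 8 * S 34, 3, 384), (b * R 12 * S 34, 1, 48), (b * I 6 * T 33, 3, 96),
      (b * I 6 * T 34, 1, 48), (b * T 17, 3, 24), (b * T 19, 3, 12), (R 2 * T 34, 3, 24),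
      (I 1 * S 34, 1, 48), (I 2 * S 34, 1, 12), (I 3 * S 33, 3, 24), (I 3 * S 34, 3, 12),
      (I 5 * S 34, 3, 24), (S 1, 1, 24), (S 3, 1, 18), (S 7, 3, 6), (S 8, 1, 3)],
    [(a * a * I 8 * T 27, 2, 384), (a * b * I 8 * T 27, 2, 768), (a * R 12 * T 27, 2, 96),
      (a * I 6 * S 27, 0, 96), (a * I 6 * S 34, 2, 96), (a * I 12 * S 27, 0, 96),
      (a * I 12 * S 34, 0, 96), (a * S 17, 2, 48), (b * b * I 8 * T 27, 0, 768),
      (b * R 12 * T 27, 2, 96), (b * I 6 * S 27, 2, 96), (b * I 6 * S 34, 0, 96),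
      (b * I 12 * S 34, 2, 192), (b * S 18, 2, 96), (b * S 24, 0, 24), (R 2 * S 27, 0, 48),
      (R 2 * S 34, 2, 48), (I 1 * T 27, 2, 96), (I 2 * T 27, 2, 24), (I 3 * T 27, 0, 24),
      (I 5 * T 27, 0, 48), (I 5 * T 34, 2, 96), (T 2, 2, 12), (T 3, 2, 6), (T 4, 0, 36),
      (T 6, 2, 24), (T 7, 0, 6), (T 8, 0, 6), (a * a * I 8 * S 27, 1, 384),
      (a * b * I 8 * S 27, 1, 768), (a * R 12 * S 27, 1, 96), (a * I 6 * T 27, 1, 96),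
      (a * I 6 * T 34, 3, 96), (a * I 12 * T 27, 1, 96), (a * I 12 * T 34, 1, 96),
      (a * T 17, 3, 48), (b * b * I 8 * S 27, 3, 768), (b * R 12 * S 27, 1, 96),
      (b * I 6 * T 27, 3, 96), (b * I 6 * T 34, 1, 96), (b * I 12 * T 34, 3, 192),
      (b * T 18, 3, 96), (b * T 24, 1, 24), (R 2 * T 27, 1, 48), (R 2 * T 34, 3, 48),
      (I 1 * S 27, 1, 96), (I 2 * S 27, 1, 24), (I 3 * S 27, 3, 24), (I 5 * S 27, 3, 48),
      (I 5 * S 34, 1, 96), (S 2, 1, 24), (S 3, 3, 12), (S 4, 3, 72), (S 6, 1, 24), (S 7, 3, 12),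
      (S 8, 1, 6)],
    [(T 5, 2, 24), (T 7, 2, 12), (S 5, 1, 24), (S 7, 1, 24)],
    [(T 6, 2, 24), (S 6, 1, 24)],
    [(T 6, 2, 24), (S 6, 1, 24)],
    [(T 8, 2, 12), (S 8, 1, 12)],
    [(T 3, 2, 12), (T 8, 2, 12), (S 3, 1, 24), (S 8, 1, 12)]]

/-- The coefficients of `f_3(4)` in terms of those of `f_2(4)`, part 2. -/
def sol34_2 : List Coef :=
  [
    [(T 7, 2, 12), (S 7, 1, 24)],
    [(T 4, 2, 24), (S 4, 1, 48)],
    [(T 3, 2, 12), (S 3, 1, 24)],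
    [],
    [(I 6 * T 31, 0, 48), (T 21, 2, 6), (T 26, 0, 6), (b * I 8 * T 31, 1, 192),
      (R 12 * T 31, 3, 48), (S 21, 1, 6), (S 26, 3, 6)],
    [(a * I 8 * S 30, 0, 384), (I 6 * T 31, 0, 48), (I 8 * T 34, 2, 144), (T 21, 0, 3),
      (T 22, 2, 18), (T 26, 0, 6), (b * I 8 * T 31, 1, 192), (R 12 * T 31, 3, 48),
      (I 8 * S 33, 3, 96), (I 8 * S 34, 1, 96), (S 21, 1, 12)],
    [(I 8 * T 34, 2, 48), (T 21, 0, 3), (T 22, 2, 6), (I 8 * S 34, 1, 96), (S 21, 1, 6),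
      (S 26, 1, 6)],
    [(a * a * I 8 * T 31, 2, 192), (a * b * I 8 * T 31, 2, 384), (a * R 12 * T 31, 2, 48),
      (a * I 8 * S 28, 0, 192), (a * I 8 * S 29, 2, 192), (a * S 21, 2, 24),
      (b * b * I 8 * T 31, 0, 384), (b * R 12 * T 31, 2, 48), (b * I 8 * S 29, 0, 192),
      (b * S 26, 2, 24), (R 12 * S 29, 2, 48), (I 1 * T 31, 2, 48), (I 2 * T 31, 2, 12),
      (I 3 * T 31, 0, 60), (I 5 * T 31, 0, 24), (I 6 * T 28, 0, 48), (T 9, 2, 24), (T 18, 0, 12),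
      (T 19, 2, 6), (T 23, 2, 6), (T 25, 0, 6), (a * I 6 * T 31, 1, 48), (a * I 8 * T 28, 1, 192),
      (a * I 8 * T 29, 3, 192), (a * I 12 * T 31, 1, 48), (a * T 21, 3, 24),
      (b * I 6 * T 31, 3, 48), (b * I 8 * T 29, 1, 192), (b * T 26, 3, 24), (R 2 * T 31, 3, 24),
      (R 12 * T 29, 3, 48), (I 6 * S 28, 3, 48), (S 9, 1, 24), (S 18, 3, 12), (S 19, 1, 6),
      (S 23, 1, 6), (S 25, 3, 6)],
    [(a * I 8 * S 27, 2, 192), (a * I 12 * S 32, 0, 96), (a * S 26, 2, 36),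
      (b * I 8 * S 27, 0, 384), (b * I 12 * S 32, 2, 96), (b * S 11, 2, 24), (R 2 * S 32, 2, 24),
      (R 12 * S 27, 2, 48), (R 12 * S 34, 2, 72), (I 3 * T 32, 2, 48), (I 5 * T 32, 2, 96),
      (I 6 * T 27, 0, 48), (I 12 * T 27, 0, 48), (I 12 * T 34, 2, 72), (T 9, 2, 12), (T 13, 2, 3),
      (T 15, 0, 12), (T 17, 0, 18), (T 18, 0, 18), (T 20, 0, 6), (T 24, 2, 6),
      (a * I 6 * T 31, 1, 48), (a * I 8 * T 33, 3, 384), (a * I 8 * T 34, 1, 384),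
      (a * I 12 * T 31, 1, 48), (a * T 22, 3, 48), (b * I 6 * T 31, 3, 48),
      (b * I 8 * T 33, 1, 384), (b * I 8 * T 34, 3, 192), (b * T 21, 3, 48), (R 2 * T 31, 3, 24),
      (I 6 * S 34, 3, 48), (I 12 * S 33, 3, 48), (I 12 * S 34, 1, 48), (S 9, 1, 24),
      (S 17, 3, 24), (S 18, 3, 12), (S 19, 1, 6), (S 23, 1, 6), (S 25, 1, 6)],
    [(a * I 8 * S 28, 2, 192), (a * I 8 * S 29, 0, 192), (a * I 8 * S 34, 2, 192),
      (b * I 8 * S 28, 0, 192), (b * I 8 * S 34, 0, 384), (R 12 * S 28, 2, 48),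
      (R 12 * S 33, 2, 48), (R 12 * S 34, 2, 48), (I 6 * T 29, 2, 48), (I 6 * T 34, 2, 48),
      (I 12 * T 33, 0, 96), (I 12 * T 34, 2, 48), (T 10, 2, 72), (T 16, 2, 18), (T 17, 0, 24),
      (T 23, 2, 6), (T 24, 0, 6), (a * I 8 * T 27, 3, 384), (a * I 8 * T 29, 1, 192),
      (a * I 8 * T 33, 1, 384), (a * I 8 * T 34, 1, 192), (b * I 8 * T 27, 1, 384),
      (b * I 8 * T 33, 3, 384), (R 12 * T 27, 3, 96), (R 12 * T 34, 1, 48), (I 6 * S 29, 1, 48),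
      (I 6 * S 34, 1, 48), (I 12 * S 33, 3, 48), (I 12 * S 34, 1, 48), (S 10, 1, 72),
      (S 16, 1, 6), (S 17, 3, 24), (S 23, 1, 6), (S 24, 1, 6)],
    [(a * I 8 * S 33, 0, 192), (b * I 8 * S 33, 2, 192), (b * S 26, 2, 24), (R 12 * S 33, 0, 48),
      (R 12 * S 34, 2, 96), (I 12 * T 34, 2, 96), (T 10, 2, 24), (T 17, 0, 36), (T 18, 2, 12),
      (T 19, 0, 6), (T 23, 0, 6), (T 25, 2, 6), (a * I 6 * T 32, 3, 96), (a * I 12 * T 32, 3, 96),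
      (b * I 6 * T 32, 1, 96), (b * T 22, 3, 48), (R 2 * T 32, 3, 48), (R 12 * T 34, 3, 48),
      (I 12 * S 34, 1, 48), (S 17, 3, 12), (S 19, 1, 6), (S 20, 1, 12)]]

/-- The coefficients of `f_3(4)` in terms of those of `f_2(4)`, part 3. -/
def sol34_3 : List Coef :=
  [
    [(T 13, 2, 12), (S 13, 1, 12)],
    [(T 18, 2, 24), (S 18, 1, 24)],
    [(T 15, 2, 48), (T 20, 2, 24), (S 15, 1, 48), (S 20, 1, 24)],
    [],
    [(T 19, 2, 12), (S 19, 1, 12)],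
    [(T 20, 2, 24), (S 20, 1, 24)],
    [],
    [(T 12, 2, 12), (S 12, 1, 12)],
    [(a * I 8 * S 33, 0, 96), (a * I 8 * S 34, 2, 192), (a * S 22, 2, 24),
      (b * I 8 * S 34, 0, 192), (b * S 21, 2, 12), (R 12 * S 34, 2, 48), (I 6 * T 33, 0, 48),
      (T 9, 2, 12), (T 16, 2, 9), (T 17, 0, 12), (T 23, 2, 3), (T 24, 0, 3),
      (a * I 8 * T 33, 1, 192), (a * I 8 * T 34, 3, 384), (a * T 26, 3, 12),
      (b * I 8 * T 33, 1, 192), (b * I 8 * T 34, 1, 288), (R 12 * T 33, 3, 48),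
      (R 12 * T 34, 3, 72), (I 6 * S 33, 3, 48), (I 6 * S 34, 1, 24), (S 16, 1, 12)],
    [(a * I 8 * S 33, 2, 192), (a * I 8 * S 34, 0, 192), (b * I 8 * S 33, 0, 192),
      (R 12 * S 33, 2, 48), (I 6 * T 34, 2, 48), (a * I 8 * T 33, 3, 384),
      (a * I 8 * T 34, 1, 192), (b * I 8 * T 33, 1, 384), (R 12 * T 33, 3, 96),
      (I 6 * S 34, 1, 48), (S 16, 1, 12)],
    [(T 13, 2, 12), (T 24, 2, 12), (S 13, 1, 12), (S 24, 1, 12)]]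

/-- The coefficients of `f_3(4)` in terms of those of `f_2(4)`, part 4. -/
def sol34_4 : List Coef :=
  [
    [(T 25, 2, 12), (S 25, 1, 12)],
    [(T 19, 2, 12), (T 23, 2, 12), (S 19, 1, 12), (S 23, 1, 12)],
    [(T 18, 2, 24), (S 18, 1, 24)],
    [(T 25, 2, 12), (S 25, 1, 12)],
    [(T 24, 2, 12), (S 24, 1, 12)],
    [(T 16, 2, 12), (T 23, 2, 12), (S 16, 1, 12), (S 23, 1, 12)],
    [(T 17, 2, 24), (S 17, 1, 24)],
    [(T 16, 2, 12), (S 16, 1, 12)],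
    [],
    [(T 11, 2, 24), (S 11, 1, 24)],
    [(T 12, 2, 12), (T 22, 2, 24), (S 12, 1, 12), (S 22, 1, 24)]]

/-- The coefficients of `f_3(4)` in terms of those of `f_2(4)`, part 5. -/
def sol34_5 : List Coef :=
  [
    [(T 26, 2, 12), (S 26, 1, 12)],
    [(T 26, 2, 12), (S 26, 1, 12)],
    [(T 21, 2, 12), (S 21, 1, 12)],
    [(T 21, 2, 12), (S 21, 1, 12)],
    [(T 22, 2, 24), (S 22, 1, 24)],
    [],
    [(T 14, 2, 24), (S 14, 1, 24)],
    [],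
    [(T 33, 2, 12), (T 34, 0, 18), (a * T 32, 3, 24), (S 33, 1, 12)],
    [(S 33, 1, 12)],
    []]

/-- The coefficients of `f_3(4)` in terms of those of `f_2(4)`, part 6. -/
def sol34_6 : List Coef :=
  [
    [],
    [],
    [],
    [(T 27, 2, 24), (S 27, 1, 24)],
    [(T 29, 2, 12), (S 29, 1, 12)],
    [],
    [(T 28, 2, 12), (S 28, 1, 12)],
    [(T 29, 2, 12), (S 29, 1, 12)],
    [(T 27, 2, 24), (S 27, 1, 24)],
    [(T 27, 2, 24), (T 34, 0, 24), (S 28, 1, 12), (S 33, 1, 12)],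
    [(T 34, 2, 24), (S 34, 1, 24)]]

/-- The coefficients of `f_3(4)` in terms of those of `f_2(4)`, part 7. -/
def sol34_7 : List Coef :=
  [
    [(T 33, 2, 24), (S 33, 1, 12)],
    [],
    [(T 30, 2, 12), (S 30, 1, 12)],
    [],
    [(T 32, 2, 24), (S 32, 1, 12)],
    [(T 31, 2, 12)],
    [],
    [(T 31, 2, 12)],
    [(T 32, 2, 24)],
    [(T 30, 2, 12)],
    []]

/-- The coefficients of `f_3(4)` in terms of those of `f_2(4)`. -/
noncomputable def sol34 : List Coef :=
  cat sol34_1 (cat sol34_2 (cat sol34_3 (cat sol34_4 (cat sol34_5 (cat sol34_6 (sol34_7))))))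

/-- The dependent real parts of the coefficients of `f_2(4)`, part 1. -/
def depS_1 : List (ℕ × Coef) :=
  [
    (5, [(a * a * a * I 8 * T 32, 0, 320), (a * a * b * I 8 * T 32, 0, 832),
      (a * a * R 12 * T 32, 0, 16), (a * a * I 8 * S 27, 2, 112), (a * a * S 22, 2, 16),
      (a * b * b * I 8 * T 32, 2, 1408), (a * b * R 12 * T 32, 2, 32),
      (a * b * I 8 * S 27, 2, 256), (a * b * S 22, 2, 56), (a * R 12 * S 27, 2, 20),
      (a * I 1 * T 32, 0, 64), (a * I 2 * T 32, 0, 12), (a * I 3 * T 32, 0, 4),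
      (a * I 5 * T 32, 0, 8), (a * I 6 * T 27, 2, 4), (a * I 6 * T 33, 2, 28),
      (a * I 12 * T 27, 2, 12), (a * I 12 * T 33, 2, 28), (a * T 10, 0, 2), (a * T 15, 0, 4),
      (a * T 18, 0, 4), (a * T 20, 0, 2), (b * b * R 12 * T 32, 0, 96), (b * b * S 22, 2, 4),
      (b * R 12 * S 27, 0, 28), (b * I 2 * T 32, 2, 20), (b * I 3 * T 32, 0, 156),
      (b * I 5 * T 32, 2, 32), (b * I 6 * T 27, 0, 92), (b * I 6 * T 33, 2, 60),
      (b * I 12 * T 27, 2, 24), (b * I 12 * T 33, 2, 56), (b * T 10, 0, 14), (b * T 15, 2, 10),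
      (b * T 18, 0, 6), (b * T 20, 0, 2), (R 2 * T 27, 2, 6), (R 2 * T 33, 2, 14),
      (I 1 * S 27, 2, 28), (I 2 * S 27, 2, 7), (I 3 * S 27, 0, 35), (I 5 * S 27, 2, 18),
      (S 1, 2, 2), (S 2, 2, 3), (S 3, 0, 9), (S 4, 0, 9), (S 6, 2, 2), (S 7, 0, 1)]),
    (8, [(a * a * a * I 8 * T 32, 0, 512), (a * a * b * I 8 * T 32, 0, 256),
      (a * a * R 12 * T 32, 0, 64), (a * a * I 8 * S 27, 2, 64), (a * a * S 22, 2, 16),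
      (a * b * b * I 8 * T 32, 2, 1024), (a * b * R 12 * T 32, 0, 64),
      (a * b * I 8 * S 27, 2, 256), (a * b * S 22, 2, 32), (a * R 12 * S 27, 0, 16),
      (a * I 1 * T 32, 0, 64), (a * I 6 * T 27, 2, 16), (a * I 6 * T 33, 2, 16),
      (a * I 12 * T 27, 2, 16), (a * I 12 * T 33, 2, 16), (a * T 10, 0, 8), (b * b * S 22, 2, 16),
      (b * R 12 * S 27, 0, 16), (b * I 2 * T 32, 0, 16), (b * I 3 * T 32, 0, 80),
      (b * I 5 * T 32, 2, 64), (b * I 6 * T 27, 0, 80), (b * I 6 * T 33, 2, 48),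
      (b * I 12 * T 27, 2, 32), (b * I 12 * T 33, 2, 32), (b * T 10, 0, 8), (b * T 15, 2, 8),
      (b * T 18, 0, 8), (R 2 * T 27, 2, 8), (R 2 * T 33, 2, 8), (I 1 * S 27, 2, 16),
      (I 2 * S 27, 2, 4), (I 3 * S 27, 0, 20), (I 5 * S 27, 2, 24), (S 2, 2, 4), (S 3, 0, 6),
      (S 4, 0, 12), (S 6, 2, 4), (S 7, 0, 2)]),
    (9, [(a * I 6 * T 32, 0, 12), (a * I 8 * T 27, 0, 16), (a * I 12 * T 32, 0, 4),
      (b * I 6 * T 32, 2, 12), (b * I 8 * T 27, 2, 16), (b * I 8 * T 33, 0, 32), (b * T 22, 0, 2),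
      (R 2 * T 32, 0, 2), (I 6 * S 27, 0, 4), (S 10, 0, 1), (S 15, 2, 1), (S 18, 0, 1)]),
    (11, [(a * I 8 * T 32, 2, 32), (b * I 8 * T 32, 0, 32), (R 12 * T 32, 2, 4), (S 22, 0, 1)]),
    (12, [(a * I 8 * T 32, 0, 32), (b * I 8 * T 32, 2, 64), (I 8 * S 27, 2, 16)]),
    (13, [(a * I 6 * T 32, 0, 48), (a * I 8 * T 27, 2, 128), (a * I 8 * T 33, 0, 64),
      (a * I 12 * T 32, 0, 16), (a * T 22, 2, 8), (b * I 6 * T 32, 0, 48),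
      (b * I 8 * T 27, 0, 128), (b * I 8 * T 33, 2, 192), (b * I 12 * T 32, 2, 32),
      (R 2 * T 32, 2, 8), (I 6 * S 27, 2, 16), (S 10, 2, 4), (S 15, 0, 4), (S 18, 2, 2),
      (S 20, 0, 2)])]

/-- The dependent real parts of the coefficients of `f_2(4)`, part 2. -/
def depS_2 : List (ℕ × Coef) :=
  [
    (14, []),
    (16, [(a * I 6 * T 32, 0, 32), (a * T 22, 2, 4), (b * I 6 * T 32, 2, 48), (R 12 * T 33, 0, 8),
      (I 6 * S 27, 2, 8)]),
    (17, [(a * I 8 * T 27, 2, 32), (a * I 8 * T 33, 0, 32), (b * I 6 * T 32, 0, 32),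
      (b * I 8 * T 27, 0, 32), (b * I 8 * T 33, 2, 64), (b * I 12 * T 32, 0, 16),
      (I 12 * S 27, 0, 8), (S 15, 0, 2)]),
    (19, [(S 20, 0, 2)]),
    (21, [(S 22, 0, 2)]),
    (23, [(a * I 6 * T 32, 0, 48), (a * I 8 * T 27, 2, 32), (a * I 8 * T 33, 2, 32),
      (a * I 12 * T 32, 2, 16), (a * T 22, 2, 4), (b * I 6 * T 32, 2, 48),
      (b * I 8 * T 27, 0, 32), (b * I 12 * T 32, 0, 16), (b * T 22, 2, 4), (R 2 * T 32, 2, 8),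
      (R 12 * T 27, 0, 8), (R 12 * T 33, 2, 8), (I 6 * S 27, 2, 16), (I 12 * S 27, 0, 8),
      (S 10, 2, 4), (S 15, 0, 4), (S 18, 2, 2), (S 20, 0, 2)])]

/-- The dependent real parts of the coefficients of `f_2(4)`, part 3. -/
def depS_3 : List (ℕ × Coef) :=
  [
    (24, [(a * I 6 * T 32, 0, 32), (a * I 8 * T 27, 0, 32), (a * I 8 * T 33, 2, 32),
      (b * I 6 * T 32, 2, 80), (b * I 8 * T 27, 2, 32), (b * I 8 * T 33, 0, 64),
      (b * I 12 * T 32, 0, 16), (b * T 22, 2, 4), (R 12 * T 27, 0, 8), (I 6 * S 27, 2, 8),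
      (I 12 * S 27, 0, 8), (S 18, 0, 2), (S 20, 0, 2)]),
    (25, [(a * I 8 * T 27, 2, 96), (a * I 8 * T 33, 0, 96), (a * T 22, 2, 4),
      (b * I 6 * T 32, 0, 96), (b * I 8 * T 27, 0, 96), (b * I 8 * T 33, 2, 192),
      (b * I 12 * T 32, 0, 16), (b * T 22, 0, 4), (R 12 * T 27, 2, 8), (R 12 * T 33, 0, 8),
      (I 12 * S 27, 0, 8), (S 15, 0, 4)]),
    (26, [(a * I 8 * T 32, 2, 32), (R 12 * T 32, 2, 8), (I 8 * S 27, 2, 16)]),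
    (28, [(a * T 32, 2, 4), (b * T 32, 0, 8), (S 27, 0, 2)]),
    (29, [(a * T 32, 2, 4), (b * T 32, 0, 8), (S 27, 0, 2)]),
    (30, [])]

/-- The dependent real parts of the coefficients of `f_2(4)`, part 4. -/
def depS_4 : List (ℕ × Coef) :=
  [
    (31, []),
    (32, []),
    (33, [(a * T 32, 2, 4)]),
    (34, [(b * T 32, 0, 4), (S 27, 0, 2)])]

/-- The dependent real parts of the coefficients of `f_2(4)`. -/
noncomputable def depS : List (ℕ × Coef) :=
  cat depS_1 (cat depS_2 (cat depS_3 (depS_4)))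

/-- The dependent imaginary parts of the coefficients of `f_2(4)`, part 1. -/
def depT_1 : List (ℕ × Coef) :=
  [
    (2, [(a * a * I 6 * T 32, 2, 104), (a * a * I 8 * T 27, 0, 192), (a * a * I 8 * T 33, 2, 96),
      (a * a * I 12 * T 32, 0, 24), (a * a * T 22, 0, 4), (a * b * I 6 * T 32, 2, 48),
      (a * b * I 8 * T 27, 2, 128), (a * b * I 8 * T 33, 0, 288), (a * b * I 12 * T 32, 0, 8),
      (a * b * T 22, 0, 20), (a * R 2 * T 32, 0, 20), (a * R 12 * T 33, 0, 8),
      (a * I 6 * S 27, 0, 48), (a * S 10, 0, 6), (a * S 15, 2, 10), (a * S 18, 0, 10),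
      (b * b * I 6 * T 32, 0, 136), (b * b * I 8 * T 27, 2, 32), (b * b * I 8 * T 33, 2, 96),
      (b * b * T 22, 0, 4), (b * R 2 * T 32, 0, 4), (b * R 12 * T 33, 2, 16),
      (b * I 6 * S 27, 0, 8), (b * S 10, 0, 6), (b * S 15, 2, 2), (b * S 18, 0, 2),
      (I 1 * T 27, 0, 8), (I 1 * T 33, 2, 8), (I 2 * T 33, 0, 4), (I 5 * T 33, 2, 8),
      (T 1, 0, 2)]),
    (3, [(a * a * I 6 * T 32, 0, 64), (a * a * I 8 * T 27, 2, 128), (a * a * I 8 * T 33, 2, 32),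
      (a * a * I 12 * T 32, 2, 32), (a * b * I 8 * T 27, 0, 128), (a * b * I 8 * T 33, 2, 192),
      (a * b * T 22, 2, 16), (a * R 2 * T 32, 2, 16), (a * R 12 * T 27, 0, 16),
      (a * R 12 * T 33, 2, 40), (a * I 6 * S 27, 2, 48), (a * S 10, 2, 8), (a * S 15, 0, 8),
      (a * S 18, 2, 8), (a * S 20, 0, 4), (b * b * I 8 * T 33, 0, 64), (b * R 12 * T 33, 0, 8),
      (b * I 6 * S 27, 0, 16), (I 1 * T 33, 2, 8), (I 2 * T 33, 2, 2), (I 3 * T 27, 2, 8),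
      (I 3 * T 33, 0, 10), (I 5 * T 33, 0, 12)]),
    (4, [(a * a * I 6 * T 32, 2, 136), (a * a * I 8 * T 27, 0, 224), (a * a * I 12 * T 32, 0, 56),
      (a * a * T 22, 0, 4), (a * b * I 8 * T 27, 2, 192), (a * b * I 8 * T 33, 0, 352),
      (a * b * I 12 * T 32, 0, 24), (a * b * T 22, 0, 36), (a * R 2 * T 32, 0, 36),
      (a * R 12 * T 27, 2, 8), (a * R 12 * T 33, 0, 32), (a * I 6 * S 27, 0, 88),
      (a * I 12 * S 27, 0, 8), (a * S 10, 0, 10), (a * S 15, 2, 10), (a * S 18, 0, 14),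
      (a * S 20, 2, 4), (b * b * I 6 * T 32, 0, 312), (b * b * I 8 * T 27, 0, 32),
      (b * b * I 8 * T 33, 2, 352), (b * b * I 12 * T 32, 0, 32), (b * b * T 22, 0, 4),
      (b * R 2 * T 32, 0, 12), (b * R 12 * T 27, 0, 8), (b * R 12 * T 33, 2, 40),
      (b * I 12 * S 27, 0, 16), (b * S 10, 0, 2), (b * S 15, 0, 2), (b * S 18, 0, 2),
      (R 2 * S 27, 0, 4), (I 1 * T 27, 0, 16), (I 2 * T 27, 2, 2), (I 2 * T 33, 0, 10),
      (I 3 * T 27, 0, 2), (I 3 * T 33, 2, 6), (I 5 * T 27, 0, 4), (I 5 * T 33, 2, 20),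
      (T 1, 0, 2)]),
    (5, [(a * a * I 6 * T 32, 0, 280), (a * a * I 8 * T 27, 2, 448), (a * a * I 8 * T 33, 0, 32),
      (a * a * I 12 * T 32, 2, 72), (a * a * T 22, 2, 12), (a * b * I 6 * T 32, 2, 80),
      (a * b * I 8 * T 27, 0, 704), (a * b * I 8 * T 33, 2, 800), (a * b * I 12 * T 32, 2, 56),
      (a * b * T 22, 2, 44), (a * R 2 * T 32, 2, 60), (a * R 12 * T 27, 0, 32),
      (a * R 12 * T 33, 2, 72), (a * I 6 * S 27, 2, 136), (a * I 12 * S 27, 2, 8),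
      (a * S 10, 2, 22), (a * S 15, 0, 22), (a * S 18, 2, 26), (a * S 20, 0, 8),
      (b * b * I 6 * T 32, 2, 344), (b * b * I 8 * T 27, 2, 288), (b * b * I 8 * T 33, 0, 672),
      (b * b * T 22, 0, 4), (b * R 2 * T 32, 0, 4), (b * R 12 * T 27, 2, 16),
      (b * R 12 * T 33, 0, 64), (b * I 6 * S 27, 0, 32), (b * I 12 * S 27, 2, 16),
      (b * S 10, 0, 6), (b * S 15, 2, 10), (b * S 18, 0, 6), (b * S 20, 2, 4), (R 2 * S 27, 2, 4),
      (I 1 * T 27, 2, 8), (I 1 * T 33, 2, 8), (I 2 * T 27, 0, 4), (I 2 * T 33, 2, 16),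
      (I 3 * T 27, 2, 4), (I 3 * T 33, 0, 12), (I 5 * T 27, 2, 16), (I 5 * T 33, 0, 40),
      (T 1, 2, 2), (T 6, 0, 2)]),
    (7, [(a * a * I 6 * T 32, 0, 336), (a * a * I 8 * T 27, 2, 576), (a * a * I 8 * T 33, 2, 32),
      (a * a * I 12 * T 32, 2, 144), (a * a * T 22, 2, 8), (a * b * I 8 * T 27, 0, 512),
      (a * b * I 8 * T 33, 2, 896), (a * b * I 12 * T 32, 2, 48), (a * b * T 22, 2, 88),
      (a * R 2 * T 32, 2, 88), (a * R 12 * T 27, 0, 32), (a * R 12 * T 33, 2, 104),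
      (a * I 6 * S 27, 2, 224), (a * I 12 * S 27, 2, 16), (a * S 10, 2, 28), (a * S 15, 0, 28),
      (a * S 18, 2, 36), (a * S 20, 0, 12), (b * b * I 6 * T 32, 2, 624),
      (b * b * I 8 * T 27, 2, 64), (b * b * I 8 * T 33, 0, 768), (b * b * I 12 * T 32, 2, 64),
      (b * b * T 22, 2, 8), (b * R 2 * T 32, 2, 24), (b * R 12 * T 27, 2, 16),
      (b * R 12 * T 33, 0, 88), (b * I 6 * S 27, 0, 16), (b * I 12 * S 27, 2, 32),
      (b * S 10, 2, 4), (b * S 15, 2, 4), (b * S 18, 2, 4), (R 2 * S 27, 2, 8),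
      (I 1 * T 27, 2, 32), (I 1 * T 33, 2, 8), (I 2 * T 27, 0, 4), (I 2 * T 33, 2, 22),
      (I 3 * T 27, 2, 12), (I 3 * T 33, 0, 22), (I 5 * T 27, 2, 8), (I 5 * T 33, 0, 52),
      (T 1, 2, 4), (T 6, 0, 2)]),
    (8, [(a * a * I 6 * T 32, 0, 368), (a * a * I 8 * T 27, 2, 576),
      (a * a * I 12 * T 32, 2, 144), (a * a * T 22, 2, 8), (a * b * I 6 * T 32, 2, 128),
      (a * b * I 8 * T 27, 0, 640), (a * b * I 8 * T 33, 2, 832), (a * b * I 12 * T 32, 2, 16),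
      (a * b * T 22, 2, 88), (a * R 2 * T 32, 2, 88), (a * R 12 * T 27, 0, 48),
      (a * R 12 * T 33, 2, 96), (a * I 6 * S 27, 2, 208), (a * I 12 * S 27, 2, 16),
      (a * S 10, 2, 28), (a * S 15, 0, 28), (a * S 18, 2, 36), (a * S 20, 0, 16),
      (b * b * I 6 * T 32, 2, 592), (b * b * I 8 * T 27, 2, 192), (b * b * I 8 * T 33, 0, 832),
      (b * b * I 12 * T 32, 2, 64), (b * b * T 22, 0, 8), (b * R 2 * T 32, 2, 8),
      (b * R 12 * T 27, 2, 48), (b * R 12 * T 33, 0, 112), (b * I 6 * S 27, 0, 32),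
      (b * I 12 * S 27, 2, 32), (b * S 10, 0, 4), (b * S 15, 2, 12), (b * S 18, 0, 4),
      (b * S 20, 2, 8), (R 2 * S 27, 2, 8), (I 1 * T 27, 2, 32), (I 2 * T 27, 0, 12),
      (I 2 * T 33, 2, 28), (I 3 * T 27, 2, 12), (I 3 * T 33, 0, 20), (I 5 * T 27, 2, 24),
      (I 5 * T 33, 0, 56), (T 1, 2, 4), (T 6, 0, 2)])]

/-- The dependent imaginary parts of the coefficients of `f_2(4)`, part 2. -/
def depT_2 : List (ℕ × Coef) :=
  [
    (9, [(I 1 * T 32, 2, 8), (I 6 * T 33, 2, 4), (T 10, 0, 2)]),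
    (11, [(I 6 * T 32, 2, 8), (I 8 * T 27, 0, 8), (I 12 * T 32, 2, 8), (T 22, 0, 2)]),
    (12, [(I 8 * T 27, 2, 16), (I 8 * T 33, 0, 16)]),
    (13, [(a * a * I 8 * T 32, 0, 64), (a * b * I 8 * T 32, 0, 128), (a * R 12 * T 32, 0, 16),
      (b * b * I 8 * T 32, 2, 128), (b * R 12 * T 32, 0, 16), (I 1 * T 32, 0, 16),
      (I 2 * T 32, 2, 4), (I 3 * T 32, 0, 4), (I 5 * T 32, 2, 8), (T 18, 0, 2), (T 20, 0, 2)]),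
    (14, [(I 8 * T 32, 2, 8)]),
    (16, [(a * R 12 * T 32, 0, 16), (a * S 22, 0, 4), (I 3 * T 32, 2, 8), (I 6 * T 27, 2, 8),
      (I 6 * T 33, 0, 8), (I 12 * T 33, 0, 8)])]

/-- The dependent imaginary parts of the coefficients of `f_2(4)`, part 3. -/
def depT_3 : List (ℕ × Coef) :=
  [
    (17, [(a * a * I 8 * T 32, 0, 96), (a * b * I 8 * T 32, 2, 64), (a * R 12 * T 32, 0, 8),
      (a * S 22, 2, 4), (b * b * I 8 * T 32, 2, 64), (b * R 12 * T 32, 0, 24),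
      (b * I 8 * S 27, 2, 32), (R 12 * S 27, 0, 8), (I 1 * T 32, 0, 8), (I 2 * T 32, 2, 2),
      (I 3 * T 32, 0, 2), (I 5 * T 32, 0, 4), (T 10, 0, 2)]),
    (19, [(T 20, 0, 2)]),
    (21, [(T 22, 0, 2)]),
    (23, [(a * a * I 8 * T 32, 2, 64), (a * b * I 8 * T 32, 0, 128), (a * R 12 * T 32, 0, 16),
      (a * S 22, 0, 8), (b * R 12 * T 32, 2, 32), (b * I 8 * S 27, 0, 32), (b * S 22, 2, 4),
      (R 12 * S 27, 2, 8), (I 2 * T 32, 0, 4), (I 3 * T 32, 2, 4), (I 5 * T 32, 2, 16),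
      (I 12 * T 27, 0, 8), (I 12 * T 33, 2, 8), (T 10, 2, 2), (T 15, 0, 2), (T 18, 0, 2)]),
    (24, [(a * a * I 8 * T 32, 2, 64), (a * b * I 8 * T 32, 0, 128), (a * S 22, 0, 4),
      (b * I 8 * S 27, 0, 32), (b * S 22, 0, 4), (R 12 * S 27, 2, 8), (I 2 * T 32, 2, 4),
      (I 3 * T 32, 2, 4), (I 6 * T 27, 2, 8), (I 6 * T 33, 0, 8), (I 12 * T 27, 0, 8),
      (T 10, 2, 2), (T 15, 0, 2), (T 18, 0, 2)]),
    (25, [(a * a * I 8 * T 32, 0, 128), (a * S 22, 2, 8), (b * b * I 8 * T 32, 2, 128),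
      (b * R 12 * T 32, 0, 48), (b * I 8 * S 27, 2, 32), (b * S 22, 0, 4), (R 12 * S 27, 0, 8),
      (I 1 * T 32, 0, 16), (I 2 * T 32, 2, 8), (I 3 * T 32, 0, 8), (I 5 * T 32, 0, 8),
      (I 12 * T 27, 0, 8), (I 12 * T 33, 2, 8), (T 10, 0, 2), (T 15, 0, 2), (T 20, 0, 2)])]

/-- The dependent imaginary parts of the coefficients of `f_2(4)`, part 4. -/
def depT_4 : List (ℕ × Coef) :=
  [
    (26, [(T 22, 0, 2)]),
    (28, [(T 27, 0, 2), (T 33, 2, 2)]),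
    (29, [(T 27, 0, 2), (T 33, 2, 2)]),
    (30, [(T 32, 0, 2)]),
    (31, [(T 32, 0, 2)]),
    (34, [])]

/-- The dependent imaginary parts of the coefficients of `f_2(4)`. -/
noncomputable def depT : List (ℕ × Coef) :=
  cat depT_1 (cat depT_2 (cat depT_3 (depT_4)))

/-- The order of elimination of the unknowns from the second compatibility condition. -/
def steps2 : List Step :=
  [(dRe 1, [(1, 0, 1)]), (dRe 4, [(9, 0, 1)]), (dIm 3, [(12, 0, 1)]), (dIm 5, [(20, 0, 1)]),
   (dIm 4, [(26, 0, 1)]), (dIm 1, [(4, 0, 1)]), (dIm 2, [(6, 0, 1)]),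
   (dRe 3, [(7, 3, 2), (25, 3, 1)]), (eIm 1, [(7, 1, 2), (13, 3, 1), (25, 1, 1)]),
   (dRe 5, [(21, 0, 1)]), (dRe 2, [(5, 0, 1)]), (eIm 2, [(7, 0, 1)])]

/-- The order of elimination of the unknowns from the third compatibility condition. -/
def steps3 : List Step :=
  [(dIm 14, [(2, 0, 1)]), (dRe 14, [(3, 0, 1)]), (dIm 15, [(78, 0, 1)]), (dRe 15, [(79, 0, 1)]),
   (dRe 17, [(99, 0, 1)]), (dRe 21, [(103, 0, 1)]), (dRe 10, [(115, 0, 1)]),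
   (dIm 20, [(128, 0, 1)]), (dRe 20, [(129, 0, 1)]), (dRe 8, [(139, 0, 1)]),
   (dIm 11, [(144, 0, 1)]), (dRe 11, [(145, 0, 1)]), (dRe 16, [(155, 0, 1)]),
   (dIm 26, [(158, 0, 1)]), (dRe 26, [(159, 0, 1)]), (dRe 3, [(163, 0, 1)]),
   (dIm 18, [(166, 0, 1)]), (dRe 18, [(167, 0, 1)]), (dIm 17, [(170, 0, 1)]),
   (dIm 4, [(172, 0, 1)]), (dRe 4, [(173, 0, 1)]), (dRe 12, [(11, 0, 1)]), (eIm 9, [(25, 0, 1)]),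
   (dRe 22, [(27, 0, 1)]), (dRe 5, [(81, 0, 1)]), (dRe 7, [(133, 0, 1)]),
   (dIm 21, [(38, 0, 1), (50, 0, 1)]), (dIm 22, [(38, 2, 1), (50, 0, 1)]),
   (eRe 8, [(38, 0, 1), (48, 0, 1), (50, 0, 1)]), (eRe 9, [(24, 2, 1), (38, 0, 1), (50, 0, 1)]),
   (dIm 12, [(10, 0, 1)]), (dRe 19, [(63, 0, 1)]), (eIm 7, [(85, 0, 1)]), (dRe 25, [(121, 0, 1)]),
   (eIm 10, [(131, 0, 1)]), (dRe 9, [(83, 0, 1)]), (dRe 23, [(111, 0, 1)]), (eRe 1, [(8, 0, 1)]),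
   (dRe 13, [(17, 0, 1)]), (eIm 11, [(19, 0, 1)]), (dRe 24, [(29, 0, 1)]),
   (dIm 19, [(62, 0, 1), (154, 0, 1)]), (dIm 7, [(140, 2, 1), (162, 0, 1)]),
   (eRe 10, [(62, 0, 2), (130, 0, 1), (154, 0, 2)]), (dIm 5, [(148, 2, 1), (152, 0, 1)]),
   (eRe 5, [(20, 0, 1), (22, 0, 1), (80, 0, 1), (140, 2, 1), (142, 2, 1)]),
   (dIm 13, [(4, 0, 1), (16, 2, 1), (62, 2, 1), (82, 0, 1), (84, 2, 1), (110, 2, 1)]),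
   (eRe 11, [(94, 0, 1)]), (dIm 24, [(150, 0, 1)]),
   (dIm 23, [(4, 2, 5), (30, 0, 1), (34, 2, 5), (56, 0, 2)]),
   (dIm 10, [(4, 2, 6), (16, 2, 1), (30, 0, 1), (34, 2, 5), (56, 0, 2)]),
   (dIm 25, [(4, 0, 13), (16, 0, 2), (30, 2, 3), (34, 0, 11), (56, 2, 4)]),
   (dIm 9, [(4, 2, 5), (16, 2, 1), (30, 0, 1), (34, 2, 5), (56, 0, 2)]),
   (eRe 7, [(4, 0, 5), (16, 0, 1), (30, 2, 1), (34, 0, 4), (56, 2, 2)]),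
   (dIm 8, [(22, 2, 1), (36, 2, 1), (80, 2, 2), (88, 0, 2), (96, 0, 2)]),
   (eRe 3, [(22, 2, 1), (36, 2, 1), (80, 2, 1), (88, 0, 2), (96, 0, 2)]),
   (dIm 3, [(22, 2, 1), (36, 2, 1), (88, 0, 2), (96, 0, 2), (132, 2, 1)]), (dIm 1, [(20, 0, 1)]),
   (dRe 1, [(21, 0, 1)]), (dIm 2, [(22, 0, 1)]), (dIm 6, [(32, 0, 1)]), (eRe 4, [(36, 0, 1)]),
   (dIm 16, [(54, 0, 1)]), (eRe 6, [(62, 0, 1)]), (dRe 2, [(143, 0, 1)]), (dRe 6, [(33, 0, 1)]),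
   (eIm 4, [(37, 0, 1)])]

/-- The order of elimination of the unknowns from the fourth compatibility condition. -/
def steps4 : List Step :=
  [(dIm 55, [(28, 0, 1)]), (dIm 56, [(30, 0, 1)]), (dIm 58, [(128, 0, 1)]),
   (dRe 58, [(129, 0, 1)]), (dIm 57, [(152, 0, 1)]), (dRe 57, [(153, 0, 1)]),
   (dRe 56, [(165, 0, 1)]), (dRe 55, [(169, 0, 1)]), (dIm 71, [(224, 0, 1)]),
   (dRe 71, [(225, 0, 1)]), (dIm 69, [(228, 0, 1)]), (dRe 69, [(229, 0, 1)]),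
   (dIm 60, [(242, 0, 1)]), (dRe 60, [(243, 0, 1)]), (dRe 72, [(301, 0, 1)]),
   (dIm 51, [(302, 0, 1)]), (dRe 51, [(303, 0, 1)]), (dIm 44, [(314, 0, 1)]),
   (dRe 44, [(315, 0, 1)]), (dIm 47, [(322, 0, 1)]), (dRe 47, [(323, 0, 1)]),
   (dIm 73, [(332, 0, 1)]), (dRe 73, [(333, 0, 1)]), (dIm 52, [(336, 0, 1)]),
   (dRe 52, [(337, 0, 1)]), (dRe 68, [(349, 0, 1)]), (dIm 65, [(360, 0, 1)]),
   (dRe 54, [(365, 0, 1)]), (dIm 77, [(370, 0, 1)]), (dRe 77, [(371, 0, 1)]),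
   (dRe 66, [(373, 0, 1)]), (dRe 63, [(377, 0, 1)]), (dIm 63, [(384, 0, 1)]),
   (dIm 62, [(388, 0, 1)]), (dRe 62, [(389, 0, 1)]), (dIm 30, [(390, 0, 1)]),
   (dRe 30, [(391, 0, 1)]), (dIm 25, [(402, 0, 1)]), (dRe 25, [(403, 0, 1)]),
   (dIm 35, [(410, 0, 1)]), (dRe 35, [(411, 0, 1)]), (dIm 10, [(414, 0, 1)]),
   (dRe 10, [(415, 0, 1)]), (dIm 70, [(420, 0, 1)]), (dRe 70, [(421, 0, 1)]),
   (dIm 49, [(444, 0, 1)]), (dRe 49, [(445, 0, 1)]), (dIm 48, [(446, 0, 1)]),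
   (dRe 48, [(447, 0, 1)]), (dIm 39, [(454, 0, 1)]), (dRe 39, [(455, 0, 1)]),
   (dIm 67, [(472, 0, 1)]), (dRe 67, [(473, 0, 1)]), (dIm 28, [(482, 0, 1)]),
   (dRe 28, [(483, 0, 1)]), (dIm 27, [(484, 0, 1)]), (dRe 27, [(485, 0, 1)]),
   (dIm 11, [(492, 0, 1)]), (dRe 11, [(493, 0, 1)]), (dIm 29, [(498, 0, 1)]),
   (dRe 29, [(499, 0, 1)]), (dIm 61, [(500, 0, 1)]), (dRe 61, [(501, 0, 1)]),
   (dIm 41, [(510, 0, 1)]), (dRe 41, [(511, 0, 1)]), (dIm 50, [(514, 0, 1)]),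
   (dRe 50, [(515, 0, 1)]), (dIm 68, [(518, 0, 1)]), (dIm 14, [(520, 0, 1)]),
   (dRe 14, [(521, 0, 1)]), (dIm 26, [(524, 0, 1)]), (dRe 26, [(525, 0, 1)]),
   (dIm 42, [(528, 0, 1)]), (dRe 42, [(529, 0, 1)]), (dIm 15, [(530, 0, 1)]),
   (dRe 15, [(531, 0, 1)]), (dRe 75, [(43, 0, 1)]), (eIm 14, [(67, 0, 1)]),
   (eIm 30, [(71, 0, 1)]), (dRe 74, [(109, 0, 1)]), (dRe 76, [(159, 0, 1)]),
   (eIm 31, [(173, 0, 1)]), (dIm 45, [(230, 0, 1)]), (dRe 45, [(231, 0, 1)]),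
   (dIm 59, [(234, 0, 1)]), (dIm 66, [(238, 0, 1)]), (dIm 34, [(244, 0, 1)]),
   (dRe 34, [(245, 0, 1)]), (dIm 43, [(272, 0, 1)]), (dRe 43, [(273, 0, 1)]),
   (dIm 64, [(278, 0, 1)]), (dRe 59, [(283, 0, 1)]), (dIm 46, [(308, 0, 1)]),
   (dRe 46, [(309, 0, 1)]), (dIm 33, [(316, 0, 1)]), (dRe 33, [(317, 0, 1)]),
   (dRe 64, [(363, 0, 1)]), (dIm 54, [(364, 0, 1)]), (dIm 23, [(392, 0, 1)]),
   (dRe 23, [(393, 0, 1)]), (dIm 37, [(396, 0, 1)]), (dRe 37, [(397, 0, 1)]),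
   (dIm 7, [(404, 0, 1)]), (dRe 7, [(405, 0, 1)]), (dIm 24, [(434, 0, 1)]),
   (dRe 24, [(435, 0, 1)]), (dIm 38, [(448, 0, 1)]), (dRe 38, [(449, 0, 1)]),
   (dIm 32, [(458, 0, 1)]), (dRe 32, [(459, 0, 1)]), (dIm 40, [(466, 0, 1)]),
   (dRe 40, [(467, 0, 1)]), (dIm 12, [(486, 0, 1)]), (dRe 12, [(487, 0, 1)]),
   (dIm 36, [(506, 0, 1)]), (dRe 36, [(507, 0, 1)]), (dIm 13, [(526, 0, 1)]),
   (dRe 13, [(527, 0, 1)]), (dIm 53, [(22, 0, 1)]), (dIm 18, [(156, 0, 1)]),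
   (dRe 65, [(189, 0, 1)]), (dRe 20, [(265, 0, 1)]), (dRe 22, [(275, 0, 1)]),
   (dIm 8, [(286, 0, 1)]), (dRe 8, [(287, 0, 1)]), (dRe 31, [(299, 0, 1)]),
   (dIm 21, [(330, 0, 1)]), (dRe 21, [(331, 0, 1)]), (dIm 5, [(386, 0, 1)]),
   (dRe 5, [(387, 0, 1)]), (dIm 9, [(408, 0, 1)]), (dRe 9, [(409, 0, 1)]),
   (eIm 34, [(185, 0, 1)]), (eIm 28, [(235, 0, 1)]), (dIm 2, [(240, 0, 1)]),
   (dRe 2, [(241, 0, 1)]), (dIm 3, [(280, 0, 1)]), (dRe 3, [(281, 0, 1)]),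
   (eRe 28, [(54, 0, 1), (204, 2, 1)]), (dIm 72, [(108, 0, 1), (136, 0, 1)]),
   (dIm 74, [(108, 2, 1), (136, 0, 1)]), (dIm 75, [(158, 2, 1), (180, 0, 1)]),
   (eRe 29, [(54, 0, 1), (204, 2, 2)]), (dIm 76, [(158, 0, 1), (180, 0, 1)]),
   (dIm 4, [(288, 0, 1), (426, 2, 1)]), (dRe 4, [(289, 1, 1), (427, 3, 1)]),
   (dIm 6, [(288, 2, 2), (426, 0, 1)]), (dRe 6, [(289, 3, 2), (427, 1, 1)]),
   (eRe 30, [(158, 2, 1), (176, 0, 1), (180, 0, 1)]),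
   (eRe 32, [(108, 2, 1), (136, 0, 1), (192, 0, 1)]),
   (eRe 33, [(54, 0, 1), (162, 2, 1), (204, 2, 1)]),
   (eRe 31, [(108, 0, 1), (136, 0, 1), (270, 0, 1)]), (eRe 14, [(36, 0, 1)]),
   (eRe 34, [(56, 0, 1)]), (eIm 29, [(57, 0, 1)]), (dRe 53, [(81, 0, 1)]),
   (dIm 16, [(126, 0, 1)]), (dRe 16, [(127, 0, 1)]), (dIm 31, [(130, 0, 1)]),
   (dIm 17, [(150, 0, 1)]), (eRe 12, [(198, 0, 1)]), (eIm 12, [(199, 0, 1)]),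
   (dIm 19, [(222, 0, 1)]), (dRe 19, [(223, 0, 1)]), (dIm 1, [(246, 0, 1)]), (c₂, [(249, 0, 1)]),
   (dIm 20, [(268, 0, 1)]), (eRe 21, [(290, 0, 1)]), (eIm 21, [(291, 0, 1)]),
   (eRe 26, [(326, 0, 1)]), (dRe 18, [(327, 0, 1)]), (eRe 19, [(378, 0, 1)]),
   (eIm 19, [(379, 0, 1)]), (dIm 22, [(418, 0, 1)]), (dRe 1, [(1, 0, 1)]), (dRe 17, [(3, 0, 1)]),
   (eIm 26, [(51, 0, 1)]), (eRe 11, [(52, 0, 1)]), (eIm 11, [(53, 0, 1)]),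
   (eRe 16, [(144, 0, 1)]), (eIm 16, [(215, 0, 1)]),
   (eRe 24, [(210, 2, 1), (274, 2, 2), (334, 0, 2)]),
   (eRe 17, [(116, 2, 2), (208, 0, 2), (210, 0, 1)]),
   (eRe 13, [(116, 2, 2), (208, 0, 1), (210, 0, 1), (274, 0, 1)]), (eRe 23, [(116, 0, 1)]),
   (eRe 25, [(208, 0, 1)]), (c₁, [(219, 0, 1)]), (eRe 9, [(258, 0, 1)]),
   (eIm 17, [(59, 3, 6), (85, 3, 6), (123, 1, 3), (149, 1, 4), (419, 3, 6)]),
   (eIm 13, [(59, 1, 2), (85, 3, 2), (123, 1, 1), (209, 1, 4), (419, 3, 2)]),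
   (eIm 24, [(59, 1, 6), (85, 3, 6), (123, 1, 3), (149, 3, 8), (419, 1, 6)]),
   (eIm 23, [(59, 1, 18), (85, 1, 6), (123, 3, 3), (149, 3, 8), (419, 3, 6)]),
   (eIm 25, [(59, 3, 6), (85, 3, 18), (123, 1, 9), (149, 1, 8), (419, 3, 6)]),
   (eIm 9, [(59, 3, 18), (85, 1, 6), (123, 1, 9), (149, 1, 4), (209, 3, 12), (419, 3, 6)]),
   (eRe 8, [(48, 0, 1)]), (eRe 5, [(98, 0, 1)]), (eIm 3, [(89, 3, 1), (91, 1, 2), (99, 1, 1)]),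
   (eIm 2, [(49, 3, 2), (75, 1, 7), (89, 1, 4), (91, 3, 16)]),
   (eIm 4, [(49, 3, 10), (75, 1, 9), (89, 3, 6), (91, 3, 28)]),
   (eIm 7, [(49, 1, 32), (75, 3, 21), (89, 1, 1), (91, 1, 48)]),
   (eIm 8, [(49, 1, 24), (75, 3, 19), (89, 1, 17), (91, 1, 36)]),
   (eIm 5, [(49, 1, 10), (75, 3, 9), (89, 1, 19), (91, 1, 2), (213, 1, 26)])]

/-- Adds corresponding coefficients. -/
noncomputable def addCoefs (l : List Coef) : List Coef → List Coef :=
  @List.rec Coef (fun _ => List Coef → List Coef) (fun m => m)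
    (fun c l ih m => @List.rec Coef (fun _ => List Coef) (c :: l)
      (fun c' m' _ => cat c c' :: ih m') m) l

/-- The linear combination of monomials with given coefficients. -/
noncomputable def form (l : List Coef) : List (List ℕ) → Rep :=
  @List.rec Coef (fun _ => List (List ℕ) → Rep) (fun _ => [])
    (fun c _ ih m => @List.rec (List ℕ) (fun _ => Rep) [] (fun t m' _ => (c, t) :: ih m') m) l

/-- The deviations of the coefficients of `f_3(j)`, of which there are `n`, the last of them with
number `k`. -/
noncomputable def dev3 (k n : ℕ) : List Coef :=
  @Nat.rec (fun _ => List Coef) [] (fun i l =>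
    [(dRe (Nat.sub k i), 0, 1), (dIm (Nat.sub k i), 1, 1)] :: l) n

/-- The coefficients of `f_2(2)`. -/
def sol22 : List Coef := [[(a, 0, 4)], [(b, 0, 4)]]

/-- The deviations of the coefficients of `f_2(2)`. -/
def dev22 : List Coef := [[(eIm 1, 1, 1)], [(eIm 2, 1, 1)]]

/-- The flow `K_2` for `ρ₁ = ρ₂ = 1`. -/
def rK2 : Rep := [([(1, 3, 1)], [18]), ([(1, 3, 1)], [2, 3, 2])]

/-- The flow `K_3` for `ρ₁ = ρ₂ = B = 1`. -/
def rK3 : Rep := [([(1, 0, 1)], [26]), ([(1, 0, 3)], [2, 3, 10])]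

/-- A sequence of forcing terms. -/
noncomputable def rforcing (p q r : Rep) (j : ℕ) : Rep :=
  sel (Nat.beq j 2) p (sel (Nat.beq j 3) q (sel (Nat.beq j 4) r []))

/-- The difference of the two sides of the compatibility condition. -/
noncomputable def compat (f₂ f₃ : ℕ → Rep) (j : ℕ) : Rep :=
  cat (rM rK2 f₂ (f₃ j)) (rsmul [(1, 2, 1)] (rM rK3 f₃ (f₂ j)))

/-- The second compatibility condition. -/
noncomputable def level2 : Rep :=
  compat (rforcing (form (addCoefs dev22 sol22) monos22) (form [] monos23) (form [] monos24))
    (rforcing (form (addCoefs (dev3 5 5) sol32) monos32) (form [] monos33) (form [] monos34)) 2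

/-- The third compatibility condition. -/
noncomputable def level3 : Rep :=
  compat (rforcing (form sol22 monos22) (form (addCoefs dev23 sol23) monos23)
      (form [] monos24))
    (rforcing (form sol32 monos32) (form (addCoefs (dev3 26 26) sol33) monos33)
      (form [] monos34)) 3

/-- The fourth compatibility condition. -/
noncomputable def level4 : Rep :=
  compat (rforcing (form sol22 monos22) (form sol23 monos23) (form coef24 monos24))
    (rforcing (form sol32 monos32) (form sol33 monos33)
      (form (addCoefs (dev3 77 77) sol34) monos34)) 4

/-- The rules for the dependent coefficients of `f_2(4)`. -/
noncomputable def rules24 : List (ℕ × Coef) :=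
  fold (fun s r => (S s.1, (eRe s.1, 0, 1) :: s.2) :: r)
    (fold (fun s r => (T s.1, (eIm s.1, 0, 1) :: s.2) :: r) [] depT) depS

/-- The product of the dependent parameters. -/
noncomputable def dependents : ℕ := fold (fun s n => Nat.mul s.1 n) 1 rules24

/-- The first constraint as a rule for `a * S 10`. -/
def rule₁ : Coef :=
  (c₁, 0, 1) ::
    [(a * a * I 6 * T 32, 2, 4), (a * a * I 8 * T 27, 2, 16), (a * a * I 8 * T 33, 0, 16),
     (a * a * I 12 * T 32, 2, 4), (a * b * I 6 * T 32, 2, 12), (a * b * I 8 * T 27, 0, 16),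
     (a * b * I 8 * T 33, 2, 8), (a * b * T 22, 2, 2), (a * R 2 * T 32, 2, 2),
     (a * R 12 * T 33, 2, 4), (a * I 6 * S 27, 2, 4), (a * S 15, 0, 1), (a * S 18, 2, 1),
     (b * R 12 * T 33, 0, 4), (I 2 * T 33, 2, 1), (I 3 * T 33, 0, 1), (I 5 * T 33, 0, 2)]

/-- The second constraint as a rule for `I 6 * T 32`. -/
def rule₂ : Coef := [(c₂, 0, 1), (I 8 * T 33, 0, 1)]

/-- Eliminates the dependent parameters and uses the two constraints. -/
noncomputable def eliminate (c : Coef) : Coef :=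
  ccollect (crewrite (I 6 * T 32) rule₂ (crewrite (a * S 10) rule₁
    (ccollect (substitute dependents rules24 (ccollect c)))))

/-- The normal form of the fourth compatibility condition. -/
noncomputable def normal4 : Rep :=
  dropZero (fold (fun s r => (eliminate s.1, s.2) :: r) [] (gather level4))

section Evaluation

/-- The homomorphism with given values on the primes. -/
noncomputable def ofPrimes (w : ℕ → ℝ) : ℕ →*₀ ℝ where
  toFun n := if n = 0 then 0 else n.factorization.prod fun p e => w p ^ e
  map_zero' := by simp
  map_one' := by simp
  map_mul' m n := by
    by_cases hm : m = 0
    · simp [hm]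
    by_cases hn : n = 0
    · simp [hn]
    simp only [mul_eq_zero, hm, hn, or_self, if_false]
    rw [Nat.factorization_mul hm hn, Finsupp.prod_add_index' (by simp) (by simp [pow_add])]

theorem ofPrimes_prime (w : ℕ → ℝ) {p : ℕ} (hp : p.Prime) : ofPrimes w p = w p := by
  change (if p = 0 then 0 else p.factorization.prod fun p e => w p ^ e) = _
  rw [if_neg hp.ne_zero, hp.factorization, Finsupp.prod_single_index (by simp), pow_one]

theorem allB_smallPrime_primes : allB smallPrime 9 primes = true := by decide +kernel

theorem prime_of_mem_primes {p : ℕ} (h : p ∈ primes) : p.Prime :=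
  prime_of_smallPrime ((allB_iff _ _ _).1 allB_smallPrime_primes p h)

theorem nodup_primes : primes.Nodup := by
  have h : primes.Pairwise (· < ·) := by
    rw [← List.isChain_iff_pairwise]
    decide +kernel
  exact h.imp ne_of_lt

theorem length_primes : primes.length = 318 := by decide +kernel

theorem pr_mem {k : ℕ} (h : k < 318) : pr k ∈ primes := by
  rw [pr, List.getD_eq_getElem _ _ (by rwa [length_primes])]
  exact List.getElem_mem _

/-- The homomorphism with given values on the parameters. -/
noncomputable def eval (v : ℕ → ℝ) : ℕ →*₀ ℝ := ofPrimes fun p => v (primes.idxOf p)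

theorem eval_pr (v : ℕ → ℝ) {k : ℕ} (h : k < 318) : eval v (pr k) = v k := by
  rw [eval, ofPrimes_prime _ (prime_of_mem_primes (pr_mem h)), pr,
    List.getD_eq_getElem _ _ (by rwa [length_primes]), nodup_primes.idxOf_getElem]

/-- The numbers of the parameters that are coefficients of `f_2(2)`, `f_2(3)` and `f_2(4)`. -/
def baseNumbers : List ℕ := 0 :: 1 :: List.range' 4 92

/-- The product of these parameters. -/
noncomputable def baseProduct : ℕ := fold (fun k n => Nat.mul (pr k) n) 1 baseNumbers

theorem eval_congr {v w : ℕ → ℝ} (h : ∀ k ∈ baseNumbers, v k = w k) {n : ℕ}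
    (hn : n ∣ baseProduct ^ 5) : eval v n = eval w n := by
  have hlt : ∀ k ∈ baseNumbers, k < 318 := by decide +kernel
  have hb (l : List ℕ) (p : ℕ) (hp : p.Prime) (hl : ∀ k ∈ l, k ∈ baseNumbers)
      (hd : p ∣ fold (fun k n => Nat.mul (pr k) n) 1 l) : ∃ k ∈ baseNumbers, p = pr k := by
    induction l with
    | nil => exact absurd (Nat.dvd_one.1 hd) hp.ne_one
    | cons k l ih =>
      rw [fold_cons, Nat.mul_eq, hp.dvd_mul] at hd
      have hk := hl k List.mem_cons_self
      rcases hd with hd | hd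
      · exact ⟨k, hk, (Nat.prime_dvd_prime_iff_eq hp
          (prime_of_mem_primes (pr_mem (hlt k hk)))).1 hd⟩
      · exact ih (fun i hi => hl i (List.mem_cons_of_mem _ hi)) hd
  have key : ∀ n : ℕ, (∀ p, p.Prime → p ∣ n → ∃ k ∈ baseNumbers, p = pr k) →
      eval v n = eval w n := by
    intro n
    induction n using Nat.recOnMul with
    | zero => simp
    | one => simp
    | prime p hp =>
      intro h'
      obtain ⟨k, hk, rfl⟩ := h' p hp dvd_rfl
      rw [eval_pr _ (hlt k hk), eval_pr _ (hlt k hk), h k hk]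
    | mul m n ihm ihn =>
      intro h'
      rw [map_mul, map_mul, ihm fun p hp hd => h' p hp (hd.mul_right _),
        ihn fun p hp hd => h' p hp (hd.mul_left _)]
  refine key n fun p hp hd => ?_
  exact hb baseNumbers p hp (fun _ hk => hk)
    (hp.dvd_of_dvd_pow (hd.trans hn))

/-- Whether a coefficient only involves these parameters. -/
noncomputable def isBase (c : Coef) : Bool :=
  fold (fun t r => sel (Nat.beq (Nat.mod (Nat.pow baseProduct 5) t.1) 0) r false) true c

theorem val_congr {v w : ℕ → ℝ} (h : ∀ k ∈ baseNumbers, v k = w k) {c : Coef}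
    (hc : isBase c = true) :
    val (eval v) c = val (eval w) c := by
  induction c with
  | nil => simp
  | cons t c ih =>
    rw [isBase, fold_cons, ← isBase] at hc
    rcases hb : Nat.beq (Nat.mod (Nat.pow baseProduct 5) t.1) 0 with _ | _
    · rw [hb, sel_false] at hc
      exact absurd hc Bool.false_ne_true
    · rw [hb, sel_true] at hc
      rw [val_cons, val_cons, ih hc, tval, tval,
        eval_congr h (Nat.dvd_of_mod_eq_zero (Nat.eq_of_beq_eq_true hb))]

/-- A sequence of values of the parameters. -/
structure Values where
  (a b c₁ c₂ : ℝ)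
  (R I S T dRe dIm eRe eIm : ℕ → ℝ)

/-- The values in the order of the parameters. -/
def Values.toFun (V : Values) (k : ℕ) : ℝ :=
  if k = 0 then V.a else if k = 1 then V.b else if k = 2 then V.c₁ else if k = 3 then V.c₂
  else if k < 16 then V.R (k - 3) else if k < 28 then V.I (k - 15) else if k < 62 then V.S (k - 27)
  else if k < 96 then V.T (k - 61) else if k < 173 then V.dRe (k - 95)
  else if k < 250 then V.dIm (k - 172) else if k < 284 then V.eRe (k - 249) else V.eIm (k - 283)

/-- The homomorphism with given values on the parameters. -/
noncomputable def Values.hom (V : Values) : ℕ →*₀ ℝ := eval V.toFun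

variable (V : Values)

@[simp] theorem hom_a : V.hom Atom.a = V.a := eval_pr _ (by norm_num)
@[simp] theorem hom_b : V.hom Atom.b = V.b := eval_pr _ (by norm_num)
@[simp] theorem hom_c₁ : V.hom Atom.c₁ = V.c₁ := eval_pr _ (by norm_num)
@[simp] theorem hom_c₂ : V.hom Atom.c₂ = V.c₂ := eval_pr _ (by norm_num)

theorem hom_R {j : ℕ} (h1 : 1 ≤ j) (h2 : j ≤ 12) : V.hom (Atom.R j) = V.R j := by
  rw [Values.hom, Atom.R, eval_pr _ (by omega), Values.toFun]
  repeat rw [if_neg (by omega)]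
  rw [if_pos (by omega), show 3 + j - 3 = j by omega]

theorem hom_I {j : ℕ} (h1 : 1 ≤ j) (h2 : j ≤ 12) : V.hom (Atom.I j) = V.I j := by
  rw [Values.hom, Atom.I, eval_pr _ (by omega), Values.toFun]
  repeat rw [if_neg (by omega)]
  rw [if_pos (by omega), show 15 + j - 15 = j by omega]

theorem hom_S {j : ℕ} (h1 : 1 ≤ j) (h2 : j ≤ 34) : V.hom (Atom.S j) = V.S j := by
  rw [Values.hom, Atom.S, eval_pr _ (by omega), Values.toFun]
  repeat rw [if_neg (by omega)]
  rw [if_pos (by omega), show 27 + j - 27 = j by omega]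

theorem hom_T {j : ℕ} (h1 : 1 ≤ j) (h2 : j ≤ 34) : V.hom (Atom.T j) = V.T j := by
  rw [Values.hom, Atom.T, eval_pr _ (by omega), Values.toFun]
  repeat rw [if_neg (by omega)]
  rw [if_pos (by omega), show 61 + j - 61 = j by omega]

theorem hom_dRe {j : ℕ} (h1 : 1 ≤ j) (h2 : j ≤ 77) : V.hom (Atom.dRe j) = V.dRe j := by
  rw [Values.hom, Atom.dRe, eval_pr _ (by omega), Values.toFun]
  repeat rw [if_neg (by omega)]
  rw [if_pos (by omega), show 95 + j - 95 = j by omega]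

theorem hom_dIm {j : ℕ} (h1 : 1 ≤ j) (h2 : j ≤ 77) : V.hom (Atom.dIm j) = V.dIm j := by
  rw [Values.hom, Atom.dIm, eval_pr _ (by omega), Values.toFun]
  repeat rw [if_neg (by omega)]
  rw [if_pos (by omega), show 172 + j - 172 = j by omega]

theorem hom_eRe {j : ℕ} (h1 : 1 ≤ j) (h2 : j ≤ 34) : V.hom (Atom.eRe j) = V.eRe j := by
  rw [Values.hom, Atom.eRe, eval_pr _ (by omega), Values.toFun]
  repeat rw [if_neg (by omega)]
  rw [if_pos (by omega), show 249 + j - 249 = j by omega]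

theorem hom_eIm {j : ℕ} (h1 : 1 ≤ j) (h2 : j ≤ 34) : V.hom (Atom.eIm j) = V.eIm j := by
  rw [Values.hom, Atom.eIm, eval_pr _ (by omega), Values.toFun]
  repeat rw [if_neg (by omega)]
  rw [show 283 + j - 283 = j by omega]

end Evaluation

/-- The linear combination of monomials with the coefficients `c k`, `c (k + 1)`, …. -/
noncomputable def gen : List (List ℕ) → ℕ → (ℕ → ℂ) → DiffPoly
  | [], _, _ => 0
  | l :: ms, k, c => C (c k) * mono l + gen ms (k + 1) c

theorem gen_congr {ms : List (List ℕ)} {k : ℕ} {c c' : ℕ → ℂ}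
    (h : ∀ j, k ≤ j → j < k + ms.length → c j = c' j) : gen ms k c = gen ms k c' := by
  induction ms generalizing k with
  | nil => rfl
  | cons l ms ih =>
    rw [gen, gen, h k le_rfl (by simp), ih fun j h1 h2 => h j (by omega) (by simp; omega)]

theorem den_form (χ : ℕ →*₀ ℝ) (ms : List (List ℕ)) (l : List Coef) (k : ℕ) :
    den χ (form l ms) = gen ms k fun j => val χ (l.getD (j - k) []) := by
  induction ms generalizing l k with
  | nil => cases l <;> simp [form, gen]
  | cons m ms ih =>
    cases l with
    | nil =>
      have h := ih [] (k + 1)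
      simp only [List.getD_nil, val_nil] at h
      rw [gen]
      simp only [List.getD_nil, val_nil, C_0, zero_mul, zero_add, ← h]
      cases ms <;> simp [form]
    | cons c l =>
      have e : form (c :: l) (m :: ms) = (c, m) :: form l ms := rfl
      rw [e, den_cons, gen, ih l (k + 1)]
      congr 1
      · simp
      · refine gen_congr fun j h1 h2 => ?_
        rw [show j - k = (j - (k + 1)) + 1 by omega, List.getD_cons_succ]

theorem gen22 (c : ℕ → ℂ) : gen monos22 1 c = f22 (c 1) (c 2) := by
  simp only [gen, monos22, f22, mono_cons, mono_nil, jet, u, ū]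
  norm_num only
  simp only [if_true, if_false]
  ring

theorem gen32 (c : ℕ → ℂ) : gen monos32 1 c = f32 c := by
  simp only [gen, monos32, f32, mono_cons, mono_nil, jet, u, ū]
  norm_num only
  simp only [if_true, if_false]
  ring

theorem gen23 (c : ℕ → ℂ) : gen monos23 1 c = f23 c := by
  simp only [gen, monos23, f23, mono_cons, mono_nil, jet, u, ū, add_assoc]
  norm_num only
  simp only [if_true, if_false]
  repeat refine congrArg₂ (· + ·) (by ring) ?_
  ring

theorem gen33 (c : ℕ → ℂ) : gen monos33 1 c = f33 c := by
  simp only [gen, monos33, f33, mono_cons, mono_nil, jet, u, ū, add_assoc]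
  norm_num only
  simp only [if_true, if_false]
  repeat refine congrArg₂ (· + ·) (by ring) ?_
  ring

theorem gen24 (c : ℕ → ℂ) : gen monos24 1 c = f24 c := by
  simp only [gen, monos24, f24, mono_cons, mono_nil, jet, u, ū, add_assoc]
  norm_num only
  simp only [if_true, if_false]
  repeat refine congrArg₂ (· + ·) (by ring) ?_
  ring

theorem gen34 (c : ℕ → ℂ) : gen monos34 1 c = f34 c := by
  simp only [gen, monos34, f34, mono_cons, mono_nil, jet, u, ū, add_assoc]
  norm_num only
  simp only [if_true, if_false]
  repeat refine congrArg₂ (· + ·) (by ring) ?_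
  ring

/-- The substitution that multiplies all the conjugate amplitudes by `t`. -/
noncomputable def stretch (t : ℂ) : DiffPoly →ₐ[ℂ] DiffPoly :=
  aeval fun
    | .u j k => u j k
    | .ubar j k => C t * ū j k

@[simp] theorem stretch_u (t : ℂ) (j k : ℕ) : stretch t (u j k) = u j k := by simp [stretch, u]
@[simp] theorem stretch_ū (t : ℂ) (j k : ℕ) : stretch t (ū j k) = C t * ū j k := by
  simp [stretch, ū]
@[simp] theorem stretch_C (t c : ℂ) : stretch t (C c) = C c := by simp [stretch]
@[simp] theorem bar_u (j k : ℕ) : bar (u j k) = ū j k := by simp [bar, u]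
@[simp] theorem bar_ū (j k : ℕ) : bar (ū j k) = u j k := by simp [bar, ū]
@[simp] theorem dξ_u (j k : ℕ) : dξ (u j k) = u j (k + 1) := by simp [dξ, u]
@[simp] theorem dξ_ū (j k : ℕ) : dξ (ū j k) = ū j (k + 1) := by simp [dξ, ū]

theorem X_u (j k : ℕ) : X (Jet.u j k) = u j k := rfl
theorem X_ubar (j k : ℕ) : X (Jet.ubar j k) = ū j k := rfl

theorem dt_u (K : DiffPoly) (f : ℕ → DiffPoly) (j k : ℕ) :
    dt K f (u j k) = dξ^[k] (rhs K f j) := by simp [dt, u]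
theorem dt_ū (K : DiffPoly) (f : ℕ → DiffPoly) (j k : ℕ) :
    dt K f (ū j k) = dξ^[k] (bar (rhs K f j)) := by simp [dt, ū]

/-- The Fréchet derivative in the direction `v` as a derivation. -/
noncomputable def frechetDer (v : DiffPoly) : Derivation ℂ DiffPoly DiffPoly :=
  mkDerivation ℂ fun
    | .u j k => if j = 1 then dξ^[k] v else 0
    | .ubar j k => if j = 1 then dξ^[k] (bar v) else 0

theorem frechet_eq (K v : DiffPoly) : frechet K v = frechetDer v K := rfl

theorem frechetDer_u (v : DiffPoly) (j k : ℕ) :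
    frechetDer v (u j k) = if j = 1 then dξ^[k] v else 0 := by simp [frechetDer, u]
theorem frechetDer_ū (v : DiffPoly) (j k : ℕ) :
    frechetDer v (ū j k) = if j = 1 then dξ^[k] (bar v) else 0 := by simp [frechetDer, ū]

theorem derivation_C_mul (d : Derivation ℂ DiffPoly DiffPoly) (c : ℂ) (p : DiffPoly) :
    d (C c * p) = C c * d p := by
  rw [Derivation.leibniz, derivation_C]
  simp

theorem dξ_iterate_C_mul (c : ℂ) (k : ℕ) (p : DiffPoly) :
    dξ^[k] (C c * p) = C c * dξ^[k] p := by
  induction k generalizing p with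
  | zero => rfl
  | succ k ih => rw [Function.iterate_succ_apply, derivation_C_mul, ih, Function.iterate_succ_apply]

/-- A derivation is compatible with `stretch t` if it is so on the jet variables. -/
theorem stretch_derivation {d d' : Derivation ℂ DiffPoly DiffPoly} {t s : ℂ}
    (h : ∀ i, d' (stretch t (X i)) = C s * stretch t (d (X i))) (p : DiffPoly) :
    d' (stretch t p) = C s * stretch t (d p) := by
  induction p using MvPolynomial.induction_on with
  | C c => simp
  | add p q hp hq => rw [map_add, map_add, hp, hq, map_add, map_add, mul_add]
  | mul_X p i hp =>
    rw [map_mul, Derivation.leibniz, hp, h, Derivation.leibniz, map_add]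
    simp only [smul_eq_mul, map_mul]
    ring

theorem stretch_dξ (t : ℂ) (p : DiffPoly) : dξ (stretch t p) = stretch t (dξ p) := by
  have := stretch_derivation (d := dξ) (d' := dξ) (t := t) (s := 1) (fun i => ?_) p
  · simpa using this
  · cases i with
    | u j k => simp [X_u]
    | ubar j k => simp [X_ubar]

theorem stretch_dξ_iterate (t : ℂ) (k : ℕ) (p : DiffPoly) :
    dξ^[k] (stretch t p) = stretch t (dξ^[k] p) := by
  induction k generalizing p with
  | zero => rfl
  | succ k ih => rw [Function.iterate_succ_apply, stretch_dξ, ih, Function.iterate_succ_apply]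

/-- The differential polynomials of charge one are those for which `stretch t` and conjugation
commute up to a factor `t`. -/
def Charged (t : ℂ) (p : DiffPoly) : Prop := C t * bar (stretch t p) = stretch t (bar p)

theorem Charged.add {t : ℂ} {p q : DiffPoly} (hp : Charged t p) (hq : Charged t q) :
    Charged t (p + q) := by
  simp only [Charged, map_add, mul_add] at *
  rw [hp, hq]

theorem Charged.C_mul {t : ℂ} {p : DiffPoly} (hp : Charged t p) (c : ℂ) :
    Charged t (C c * p) := by
  simp only [Charged, map_mul, stretch_C, bar_C] at *
  rw [← hp]
  ring

theorem charged_u (t : ℂ) (j k : ℕ) : Charged t (u j k) := by simp [Charged]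

variable {t : ℝ}

theorem stretch_frechet {K v : DiffPoly} (hv : Charged t v) :
    frechet (stretch t K) (stretch t v) = stretch t (frechet K v) := by
  rw [frechet_eq, frechet_eq]
  have := stretch_derivation (t := t) (s := 1) (d := frechetDer v) (d' := frechetDer (stretch t v))
    (fun i => ?_) K
  · simpa using this
  · cases i with
    | u j k =>
      rw [X_u, stretch_u, frechetDer_u, frechetDer_u]
      split_ifs <;> simp [stretch_dξ_iterate]
    | ubar j k =>
      rw [X_ubar, stretch_ū, derivation_C_mul, frechetDer_ū, frechetDer_ū]
      split_ifs
      · rw [← dξ_iterate_C_mul, hv, stretch_dξ_iterate]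
        simp
      · simp

theorem frechet_C_mul (c : ℂ) (K v : DiffPoly) : frechet (C c * K) v = C c * frechet K v :=
  derivation_C_mul _ _ _

theorem frechet_C_mul_right (s : ℝ) (K v : DiffPoly) :
    frechet K (C (s : ℂ) * v) = C (s : ℂ) * frechet K v := by
  have h : frechetDer (C (s : ℂ) * v) = (s : ℂ) • frechetDer v := by
    refine derivation_ext fun i => ?_
    rw [Derivation.smul_apply, smul_eq_C_mul]
    cases i with
    | u j k => simp only [X_u, frechetDer_u, dξ_iterate_C_mul, mul_ite, mul_zero]
    | ubar j k =>
      simp only [X_ubar, frechetDer_ū, map_mul, bar_C, Complex.conj_ofReal, dξ_iterate_C_mul,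
        mul_ite, mul_zero]
  rw [frechet_eq, h, Derivation.smul_apply, smul_eq_C_mul, frechet_eq]

theorem stretch_M {K : DiffPoly} {f : ℕ → DiffPoly} {s s' : ℝ}
    (hr : ∀ j, Charged t (rhs K f j)) {p : DiffPoly} (hp : Charged t p) :
    M (C (s : ℂ) * stretch t K) (fun j => C (s : ℂ) * stretch t (f j))
      (C (s' : ℂ) * stretch t p) = C ((s * s' : ℝ) : ℂ) * stretch t (M K f p) := by
  have h1 (j : ℕ) : rhs (C (s : ℂ) * stretch t K) (fun j => C (s : ℂ) * stretch t (f j)) j =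
      C (s : ℂ) * stretch t (rhs K f j) := by
    rw [rhs, rhs]
    split_ifs
    · rfl
    · have := stretch_frechet (K := K) (charged_u t j 0)
      rw [stretch_u] at this
      rw [frechet_C_mul, this, map_add, mul_add]
  have h2 : dt (C (s : ℂ) * stretch t K) (fun j => C (s : ℂ) * stretch t (f j)) (stretch t p) =
      C (s : ℂ) * stretch t (dt K f p) := by
    refine stretch_derivation (fun i => ?_) p
    cases i with
    | u j k =>
      rw [X_u, stretch_u, dt_u, dt_u, h1, dξ_iterate_C_mul, stretch_dξ_iterate]
    | ubar j k =>
      rw [X_ubar, stretch_ū, derivation_C_mul, dt_ū, dt_ū, h1, map_mul, bar_C,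
        Complex.conj_ofReal, ← dξ_iterate_C_mul, mul_left_comm, hr, dξ_iterate_C_mul,
        stretch_dξ_iterate]
  rw [M, derivation_C_mul, h2, frechet_C_mul, frechet_C_mul_right, stretch_frechet hp, M, map_sub]
  push_cast
  rw [C_mul]
  ring

theorem stretch_injective {t : ℂ} (ht : t ≠ 0) : Function.Injective (stretch t) := by
  have h : (stretch t⁻¹).comp (stretch t) = AlgHom.id ℂ DiffPoly := by
    refine algHom_ext fun i => ?_
    cases i with
    | u j k => simp [X_u]
    | ubar j k =>
      rw [X_ubar, AlgHom.comp_apply, stretch_ū, map_mul, stretch_C, stretch_ū, ← mul_assoc, ← C_mul,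
        mul_inv_cancel₀ ht]
      simp
  exact Function.LeftInverse.injective (g := stretch t⁻¹) fun p => by
    simpa using AlgHom.congr_fun h p

variable {ρ₁ ρ₂ B : ℝ}

theorem stretch_K2 : K2 ρ₁ ρ₂ = C (ρ₁ : ℂ) * stretch (ρ₂ / ρ₁ : ℝ) (K2 1 1) := by
  simp only [K2, map_mul, map_add, stretch_C, stretch_u, stretch_ū, div_one, Complex.ofReal_one,
    map_one, mul_one]
  ring

theorem stretch_K3 : K3 ρ₁ ρ₂ B = C (B : ℂ) * stretch (ρ₂ / ρ₁ : ℝ) (K3 1 1 1) := by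
  have h : ((3 * ρ₂ / ρ₁ : ℝ) : ℂ) = ((3 * 1 / 1 : ℝ) : ℂ) * ((ρ₂ / ρ₁ : ℝ) : ℂ) := by
    push_cast
    ring
  simp only [K3, map_mul, map_add, stretch_C, stretch_u, stretch_ū, Complex.ofReal_one, map_one,
    h]
  ring

theorem charged_rhs_K2 {f : ℕ → DiffPoly} (hf : ∀ j, Charged t (f j)) (j : ℕ) :
    Charged t (rhs (K2 1 1) f j) := by
  rw [rhs]
  split_ifs
  · simp [Charged, K2, bar_C]
    ring
  · refine Charged.add ?_ (hf j)
    rw [frechet_K2]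
    simp [Charged, bar_C, map_ofNat]
    ring

theorem charged_rhs_K3 {f : ℕ → DiffPoly} (hf : ∀ j, Charged t (f j)) (j : ℕ) :
    Charged t (rhs (K3 1 1 1) f j) := by
  rw [rhs]
  split_ifs
  · simp [Charged, K3, bar_C]
    ring
  · refine Charged.add ?_ (hf j)
    rw [frechet_K3]
    simp [Charged, bar_C]
    ring

theorem compatible_stretch_iff (h₁ : ρ₁ ≠ 0) (h₂ : ρ₂ ≠ 0) (hB : B ≠ 0) {f₂ f₃ : ℕ → DiffPoly}
    (hf₂ : ∀ j, Charged (ρ₂ / ρ₁ : ℝ) (f₂ j)) (hf₃ : ∀ j, Charged (ρ₂ / ρ₁ : ℝ) (f₃ j)) (j : ℕ) :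
    Compatible ρ₁ ρ₂ B (fun j => C (ρ₁ : ℂ) * stretch (ρ₂ / ρ₁ : ℝ) (f₂ j))
      (fun j => C (B : ℂ) * stretch (ρ₂ / ρ₁ : ℝ) (f₃ j)) j ↔ Compatible 1 1 1 f₂ f₃ j := by
  have ht : ((ρ₂ / ρ₁ : ℝ) : ℂ) ≠ 0 := by exact_mod_cast div_ne_zero h₂ h₁
  have hs : (C ((ρ₁ * B : ℝ) : ℂ) : DiffPoly) ≠ 0 := by
    rw [Ne, C_eq_zero]
    exact_mod_cast mul_ne_zero h₁ hB
  rw [Compatible, stretch_K2, stretch_K3, stretch_M (charged_rhs_K2 hf₂) (hf₃ j),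
    stretch_M (charged_rhs_K3 hf₃) (hf₂ j), mul_comm B ρ₁, mul_right_inj' hs,
    (stretch_injective ht).eq_iff, Compatible]

/-- The number of conjugate amplitudes in a monomial. -/
def conjCount (l : List ℕ) : ℕ := l.countP fun i => i % 2 = 1

/-- Whether the monomials have charge one. -/
def chargeOne (ms : List (List ℕ)) : Bool :=
  ms.all fun l => l.countP (fun i => i % 2 = 0) = conjCount l + 1

theorem conjCount_cons (i : ℕ) (l : List ℕ) :
    conjCount (i :: l) = conjCount l + if i % 2 = 1 then 1 else 0 := by
  simp [conjCount, List.countP_cons]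

theorem stretch_mono (t : ℂ) (l : List ℕ) :
    stretch t (mono l) = C (t ^ conjCount l) * mono l := by
  induction l with
  | nil => simp [conjCount]
  | cons i l ih =>
    rw [mono_cons, map_mul, ih, conjCount_cons]
    rcases Nat.mod_two_eq_zero_or_one i with h | h
    · simp [jet, h, X_u]
      ring
    · simp [jet, h, X_ubar, pow_succ]
      ring

theorem conjCount_flip (l : List ℕ) :
    conjCount (fold (fun i r => flip i :: r) [] l) = l.countP fun i => i % 2 = 0 := by
  induction l with
  | nil => rfl
  | cons i l ih =>
    rw [fold_cons, conjCount_cons, ih, List.countP_cons]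
    congr 1
    have hm : Nat.mod i 2 = i % 2 := rfl
    rcases Nat.mod_two_eq_zero_or_one i with h | h
    · have : flip i = i + 1 := by simp [flip, hm, h]
      simp [this, h]
      omega
    · have : flip i = i - 1 := by simp [flip, hm, h, Nat.beq]
      simp [this, h]
      omega

theorem charged_mono (t : ℝ) {l : List ℕ} (h : l.countP (fun i => i % 2 = 0) = conjCount l + 1) :
    Charged t (mono l) := by
  rw [Charged, stretch_mono, map_mul, bar_C, bar_mono, stretch_mono, conjCount_flip, h, map_pow,
    Complex.conj_ofReal, ← mul_assoc, ← C_mul, pow_succ']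

theorem charged_gen (t : ℝ) {ms : List (List ℕ)} (h : chargeOne ms = true) (k : ℕ) (c : ℕ → ℂ) :
    Charged t (gen ms k c) := by
  induction ms generalizing k with
  | nil => simp [gen, Charged]
  | cons l ms ih =>
    rw [chargeOne, List.all_cons, Bool.and_eq_true, decide_eq_true_eq, ← chargeOne] at h
    exact ((charged_mono t h.1).C_mul _).add (ih h.2 _)

/-- The coefficients for which `C s * stretch t` gives the coefficients `c`. -/
noncomputable def unscale (s t : ℂ) (ms : List (List ℕ)) (c : ℕ → ℂ) (j : ℕ) : ℂ :=
  c j / (s * t ^ conjCount (ms.getD (j - 1) []))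

theorem stretch_gen (s t : ℂ) (ms : List (List ℕ)) (k : ℕ) (c : ℕ → ℂ) :
    C s * stretch t (gen ms k c) =
      gen ms k fun j => s * t ^ conjCount (ms.getD (j - k) []) * c j := by
  induction ms generalizing k with
  | nil => simp [gen]
  | cons l ms ih =>
    rw [gen, map_add, map_mul, stretch_C, stretch_mono, mul_add, ih, gen]
    congr 1
    · simp only [Nat.sub_self, List.getD_cons_zero, C_mul]
      ring
    · refine gen_congr fun j h1 h2 => ?_
      rw [show j - k = (j - (k + 1)) + 1 by omega, List.getD_cons_succ]

theorem stretch_gen_unscale {s t : ℂ} (hs : s ≠ 0) (ht : t ≠ 0) (ms : List (List ℕ))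
    (c : ℕ → ℂ) : C s * stretch t (gen ms 1 (unscale s t ms c)) = gen ms 1 c := by
  rw [stretch_gen]
  refine gen_congr fun j _ _ => ?_
  rw [unscale, mul_div_cancel₀ _ (mul_ne_zero hs (pow_ne_zero _ ht))]

@[simp] theorem gen_zero (ms : List (List ℕ)) (k : ℕ) : gen ms k (fun _ => 0) = 0 := by
  induction ms generalizing k with
  | nil => rfl
  | cons l ms ih => simp [gen, ih]

@[simp] theorem unscale_zero (s t : ℂ) (ms : List (List ℕ)) :
    unscale s t ms (fun _ => 0) = fun _ => 0 := by
  funext j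
  simp [unscale]

/-- The forcing terms `f_2(j)` with given coefficients. -/
noncomputable def force₂ (a τ η : ℕ → ℂ) : ℕ → DiffPoly :=
  forcing (gen monos22 1 a) (gen monos23 1 τ) (gen monos24 1 η)

/-- The forcing terms `f_3(j)` with given coefficients. -/
noncomputable def force₃ (α γ κ : ℕ → ℂ) : ℕ → DiffPoly :=
  forcing (gen monos32 1 α) (gen monos33 1 γ) (gen monos34 1 κ)

theorem compatible_unscale_iff {ρ₁ ρ₂ B : ℝ} (h₁ : ρ₁ ≠ 0) (h₂ : ρ₂ ≠ 0) (hB : B ≠ 0)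
    (a τ η α γ κ : ℕ → ℂ) (j : ℕ) :
    Compatible ρ₁ ρ₂ B (force₂ a τ η) (force₃ α γ κ) j ↔ Compatible 1 1 1
      (force₂ (unscale ρ₁ (ρ₂ / ρ₁ : ℝ) monos22 a) (unscale ρ₁ (ρ₂ / ρ₁ : ℝ) monos23 τ)
        (unscale ρ₁ (ρ₂ / ρ₁ : ℝ) monos24 η))
      (force₃ (unscale B (ρ₂ / ρ₁ : ℝ) monos32 α) (unscale B (ρ₂ / ρ₁ : ℝ) monos33 γ)
        (unscale B (ρ₂ / ρ₁ : ℝ) monos34 κ)) j := by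
  have ht : ((ρ₂ / ρ₁ : ℝ) : ℂ) ≠ 0 := by exact_mod_cast div_ne_zero h₂ h₁
  have hρ : (ρ₁ : ℂ) ≠ 0 := by exact_mod_cast h₁
  have hB' : (B : ℂ) ≠ 0 := by exact_mod_cast hB
  have hf (s : ℂ) (p q r : DiffPoly) : (fun j => C s * stretch (ρ₂ / ρ₁ : ℝ) (forcing p q r j)) =
      forcing (C s * stretch (ρ₂ / ρ₁ : ℝ) p) (C s * stretch (ρ₂ / ρ₁ : ℝ) q)
        (C s * stretch (ρ₂ / ρ₁ : ℝ) r) := by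
    funext j
    rw [forcing.eq_def, forcing.eq_def]
    split <;> simp
  have hc {p q r : DiffPoly} (hp : Charged (ρ₂ / ρ₁ : ℝ) p) (hq : Charged (ρ₂ / ρ₁ : ℝ) q)
      (hr : Charged (ρ₂ / ρ₁ : ℝ) r) (j : ℕ) : Charged (ρ₂ / ρ₁ : ℝ) (forcing p q r j) := by
    rw [forcing.eq_def]
    split
    · exact hp
    · exact hq
    · exact hr
    · simp [Charged]
  rw [← compatible_stretch_iff h₁ h₂ hB]
  · rw [force₂, force₃, force₂, force₃, hf, hf]
    simp only [stretch_gen_unscale hρ ht, stretch_gen_unscale hB' ht]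
  · exact hc (charged_gen _ (by decide +kernel) _ _) (charged_gen _ (by decide +kernel) _ _)
      (charged_gen _ (by decide +kernel) _ _)
  · exact hc (charged_gen _ (by decide +kernel) _ _) (charged_gen _ (by decide +kernel) _ _)
      (charged_gen _ (by decide +kernel) _ _)

section
variable (χ : ℕ →*₀ ℝ)

theorem den_rK2 : den χ rK2 = K2 1 1 := by
  simp [rK2, K2, tval, jet, X_u, X_ubar]
  ring

theorem den_rK3 : den χ rK3 = K3 1 1 1 := by
  simp [rK3, K3, tval, jet, X_u, X_ubar]
  ring

theorem den_rforcing (p q r : Rep) (j : ℕ) :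
    den χ (rforcing p q r j) = forcing (den χ p) (den χ q) (den χ r) j := by
  rw [rforcing]
  match j with
  | 0 | 1 => simp [forcing, Nat.beq]
  | 2 => simp [forcing]
  | 3 => simp [forcing, Nat.beq]
  | 4 => simp [forcing, Nat.beq]
  | j + 5 => simp [forcing, Nat.beq]

theorem compatible_iff_den_compat (p₂ q₂ r₂ p₃ q₃ r₃ : Rep) (j : ℕ) :
    Compatible 1 1 1 (forcing (den χ p₂) (den χ q₂) (den χ r₂))
      (forcing (den χ p₃) (den χ q₃) (den χ r₃)) j ↔
        den χ (compat (rforcing p₂ q₂ r₂) (rforcing p₃ q₃ r₃) j) = 0 := by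
  rw [compat, cat_eq, den_append, den_rsmul,
    den_rM χ _ _ _ fun j _ => den_rforcing χ p₂ q₂ r₂ j,
    den_rM χ _ _ _ fun j _ => den_rforcing χ p₃ q₃ r₃ j, den_rK2, den_rK3, den_rforcing,
    den_rforcing, Compatible, ← sub_eq_zero]
  simp [tval, sub_eq_add_neg]

/-- The values of a list of coefficients. -/
noncomputable def values (l : List Coef) (j : ℕ) : ℂ := val χ (l.getD (j - 1) [])

theorem den_form_one (ms : List (List ℕ)) (l : List Coef) :
    den χ (form l ms) = gen ms 1 (values χ l) := den_form χ ms l 1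

theorem values_addCoefs (l m : List Coef) (j : ℕ) :
    values χ (addCoefs l m) j = values χ l j + values χ m j := by
  have h (k : ℕ) : val χ ((addCoefs l m).getD k []) =
      val χ (l.getD k []) + val χ (m.getD k []) := by
    induction l generalizing m k with
    | nil => simp [addCoefs]
    | cons c l ih =>
      cases m with
      | nil => simp [addCoefs]
      | cons d m =>
        have e : addCoefs (c :: l) (d :: m) = cat c d :: addCoefs l m := rfl
        rw [e]
        cases k with
        | zero => simp
        | succ k => simpa using ih m k
  exact h _

end

theorem checkSystem_level2 : checkSystem (collect level2) steps2 = true := by decide +kernel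

theorem checkSystem_level3 : checkSystem (collect level3) steps3 = true := by decide +kernel

theorem checkSystem_normal4 : checkSystem normal4 steps4 = true := by decide +kernel

/-- The scale of the real part of `η_j`. -/
noncomputable def scaleS (j : ℕ) : ℕ := if (depS.lookup j).isSome then 8 else 16

/-- The scale of the imaginary part of `η_j`. -/
noncomputable def scaleT (j : ℕ) : ℕ := if (depT.lookup j).isSome then 8 else 16

/-- The values of the parameters for given coefficients of `f_2(2)`, `f_2(3)`, `f_2(4)`. -/
noncomputable def baseValues (a τ η : ℕ → ℂ) : Values where
  a := (a 1).re / 4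
  b := (a 2).re / 4
  c₁ := 0
  c₂ := 0
  R j := (τ j).re / 8
  I j := (τ j).im / 8
  S j := (η j).re / scaleS j
  T j := (η j).im / scaleT j
  dRe _ := 0
  dIm _ := 0
  eRe _ := 0
  eIm _ := 0

/-- Changes the values of all parameters except for the coefficients of `f_2(2)`, `f_2(3)`,
`f_2(4)`. -/
def Values.change (V : Values) (x y : ℝ) (d : ℕ → ℂ) (e e' : ℕ → ℝ) : Values :=
  { V with
    c₁ := x
    c₂ := y
    dRe := fun j => (d j).re
    dIm := fun j => (d j).im
    eRe := e
    eIm := e' }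

section
variable (V : Values) (x y : ℝ) (d : ℕ → ℂ) (e e' : ℕ → ℝ)

theorem val_change {c : Coef} (hc : isBase c = true) :
    val (V.change x y d e e').hom c = val V.hom c := by
  refine val_congr (fun k hk => ?_) hc
  have h : k ≠ 2 ∧ k ≠ 3 ∧ k < 96 := by
    have : ∀ k ∈ baseNumbers, k ≠ 2 ∧ k ≠ 3 ∧ k < 96 := by decide +kernel
    exact this k hk
  simp [Values.toFun, Values.change, h.1, h.2.1, h.2.2]

theorem values_change {l : List Coef} (hl : allB isBase 9 l = true) (j : ℕ) :
    values (V.change x y d e e').hom l j = values V.hom l j := by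
  refine val_change V x y d e e' ?_
  rcases Nat.lt_or_ge (j - 1) l.length with h | h
  · rw [List.getD_eq_getElem _ _ h]
    exact (allB_iff _ _ _).1 hl _ (List.getElem_mem h)
  · rw [List.getD_eq_default _ _ h]
    rfl

theorem getD_dev3 (k n i : ℕ) (h : i < n) : (dev3 k n).getD i [] =
    [(dRe (k - (n - 1 - i)), 0, 1), (dIm (k - (n - 1 - i)), 1, 1)] := by
  induction n generalizing i with
  | zero => omega
  | succ n ih =>
    have h' : dev3 k (n + 1) = [(dRe (k - n), 0, 1), (dIm (k - n), 1, 1)] :: dev3 k n := rfl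
    rw [h']
    cases i with
    | zero => simp
    | succ i =>
      rw [List.getD_cons_succ, ih i (by omega), show n + 1 - 1 - (i + 1) = n - 1 - i by omega]

theorem values_dev3 {n j : ℕ} (h1 : 1 ≤ j) (h2 : j ≤ n) (h3 : n ≤ 77) :
    values (V.change x y d e e').hom (dev3 n n) j = d j := by
  rw [values, getD_dev3 n n _ (by omega), show n - (n - 1 - (j - 1)) = j by omega]
  simp only [val_cons, val_nil, tval, hom_dRe _ h1 (h2.trans h3), hom_dIm _ h1 (h2.trans h3)]
  apply Complex.ext <;> simp [Values.change]

end

theorem allB_isBase_sol32 : allB isBase 9 sol32 = true := by decide +kernel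
theorem allB_isBase_sol33 : allB isBase 9 sol33 = true := by decide +kernel
theorem allB_isBase_sol34 : allB isBase 9 sol34 = true := by decide +kernel
theorem allB_isBase_sol22 : allB isBase 9 sol22 = true := by decide +kernel
theorem allB_isBase_sol23 : allB isBase 9 sol23 = true := by decide +kernel
theorem allB_isBase_coef24 : allB isBase 9 coef24 = true := by decide +kernel

theorem values_nil (χ : ℕ →*₀ ℝ) : values χ [] = fun _ => 0 := by
  funext j
  simp [values]

/-- The compatibility conditions for given coefficients, as the vanishing of a differential
polynomial. -/
theorem compatible_iff_den (χ : ℕ →*₀ ℝ) {a τ η α γ κ : ℕ → ℂ} {A T E L G K : List Coef} {n : ℕ}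
    (ha : ∀ j, 1 ≤ j → j < 3 → a j = values χ A j)
    (hτ : ∀ j, 1 ≤ j → j < 13 → τ j = values χ T j)
    (hη : ∀ j, 1 ≤ j → j < 35 → η j = values χ E j)
    (hα : ∀ j, 1 ≤ j → j < 6 → α j = values χ L j)
    (hγ : ∀ j, 1 ≤ j → j < 27 → γ j = values χ G j)
    (hκ : ∀ j, 1 ≤ j → j < 78 → κ j = values χ K j) :
    Compatible 1 1 1 (force₂ a τ η) (force₃ α γ κ) n ↔
      den χ (compat (rforcing (form A monos22) (form T monos23) (form E monos24))
        (rforcing (form L monos32) (form G monos33) (form K monos34)) n) = 0 := by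
  rw [← compatible_iff_den_compat]
  simp only [den_form_one]
  rw [force₂, force₃, gen_congr (ms := monos22) ha, gen_congr (ms := monos23) hτ,
    gen_congr (ms := monos24) hη, gen_congr (ms := monos32) hα, gen_congr (ms := monos33) hγ,
    gen_congr (ms := monos34) hκ]

theorem eq_of_level2 {a α : ℕ → ℂ} (τ η : ℕ → ℂ)
    (h : Compatible 1 1 1 (force₂ a (fun _ => 0) fun _ => 0)
      (force₃ α (fun _ => 0) fun _ => 0) 2) :
    (∀ j, 1 ≤ j → j < 3 → a j = values (baseValues a τ η).hom sol22 j) ∧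
      ∀ j, 1 ≤ j → j < 6 → α j = values (baseValues a τ η).hom sol32 j := by
  set V := baseValues a τ η with hV
  set W := V.change 0 0 (fun j => α j - values V.hom sol32 j) (fun _ => 0) (fun j => (a j).im)
    with hW
  have ha : ∀ j, 1 ≤ j → j < 3 → a j = values W.hom (addCoefs dev22 sol22) j := by
    intro j h1 h2
    rw [values_addCoefs]
    interval_cases j
    · simp only [values, dev22, sol22, Nat.sub_self, List.getD_cons_zero, val_cons, val_nil, tval,
        hom_eIm W le_rfl (by norm_num), hom_a]
      apply Complex.ext <;> simp [hW, hV, Values.change, baseValues]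
      ring
    · simp only [values, dev22, sol22, Nat.add_one_sub_one, List.getD_cons_succ,
        List.getD_cons_zero, val_cons, val_nil, tval,
        hom_eIm W (show 1 ≤ 2 by norm_num) (by norm_num), hom_b]
      apply Complex.ext <;> simp [hW, hV, Values.change, baseValues]
      ring
  have hα : ∀ j, 1 ≤ j → j < 6 → α j = values W.hom (addCoefs (dev3 5 5) sol32) j := by
    intro j h1 h2
    rw [values_addCoefs, values_dev3 _ _ _ _ _ _ h1 (by omega) (by norm_num),
      values_change _ _ _ _ _ _ allB_isBase_sol32]
    ring
  have key := (compatible_iff_den W.hom (A := addCoefs dev22 sol22) (T := []) (E := [])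
    (L := addCoefs (dev3 5 5) sol32) (G := []) (K := []) ha (fun j _ _ => by simp [values_nil])
    (fun j _ _ => by simp [values_nil]) hα (fun j _ _ => by simp [values_nil])
    (fun j _ _ => by simp [values_nil])).1 h
  rw [← level2, ← den_collect,
    den_eq_zero_iff_of_checkSystem _ checkSystem_level2] at key
  have hmem : ∀ x ∈ (List.range' 1 5).map dRe ++ ((List.range' 1 5).map dIm ++
      (List.range' 1 2).map eIm), x ∈ steps2.map Prod.fst := by decide +kernel
  have hz (x : ℕ) (hx : x ∈ steps2.map Prod.fst) : W.hom x = 0 := by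
    obtain ⟨s, hs, rfl⟩ := List.mem_map.1 hx
    exact key s hs
  have hd (j : ℕ) (h1 : 1 ≤ j) (h2 : j < 6) : α j - values V.hom sol32 j = 0 := by
    have hr := hz _ (hmem (dRe j) (List.mem_append_left _
      (List.mem_map_of_mem (List.mem_range'_1.2 ⟨h1, by omega⟩))))
    have hi := hz _ (hmem (dIm j) (List.mem_append_right _ (List.mem_append_left _
      (List.mem_map_of_mem (List.mem_range'_1.2 ⟨h1, by omega⟩)))))
    rw [hom_dRe _ h1 (by omega)] at hr
    rw [hom_dIm _ h1 (by omega)] at hi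
    exact Complex.ext hr hi
  refine ⟨fun j h1 h2 => ?_, fun j h1 h2 => sub_eq_zero.1 (hd j h1 h2)⟩
  have hi : (a j).im = 0 := by
    have := hz _ (hmem (eIm j) (List.mem_append_right _ (List.mem_append_right _
      (List.mem_map_of_mem (List.mem_range'_1.2 ⟨h1, by omega⟩)))))
    rwa [hom_eIm _ h1 (by omega)] at this
  interval_cases j
  · simp only [values, sol22, Nat.sub_self, List.getD_cons_zero, val_cons, val_nil, tval, hom_a]
    apply Complex.ext <;> simp [hV, baseValues, hi]
    ring
  · simp only [values, sol22, Nat.add_one_sub_one, List.getD_cons_succ, List.getD_cons_zero,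
      val_cons, val_nil, tval, hom_b]
    apply Complex.ext <;> simp [hV, baseValues, hi]
    ring

theorem eq_of_level3 {a τ α γ : ℕ → ℂ} (η : ℕ → ℂ)
    (ha : ∀ j, 1 ≤ j → j < 3 → a j = values (baseValues a τ η).hom sol22 j)
    (hα : ∀ j, 1 ≤ j → j < 6 → α j = values (baseValues a τ η).hom sol32 j)
    (h : Compatible 1 1 1 (force₂ a τ fun _ => 0) (force₃ α γ fun _ => 0) 3) :
    (∀ j, 1 ≤ j → j < 13 → τ j = values (baseValues a τ η).hom sol23 j) ∧
      ∀ j, 1 ≤ j → j < 27 → γ j = values (baseValues a τ η).hom sol33 j := by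
  set V := baseValues a τ η with hV
  set W := V.change 0 0 (fun j => γ j - values V.hom sol33 j)
    (fun j => (τ j - values V.hom sol23 j).re) (fun j => (τ j - values V.hom sol23 j).im) with hW
  have hfree : ∀ j, 1 ≤ j → j < 13 →
      values W.hom dev23 j = τ j - values V.hom sol23 j := by
    intro j h1 h2
    have hR : ∀ j, 1 ≤ j → j ≤ 12 → V.hom (R j) = (τ j).re / 8 := fun j h1 h2 => hom_R V h1 h2
    have hI : ∀ j, 1 ≤ j → j ≤ 12 → V.hom (I j) = (τ j).im / 8 := fun j h1 h2 => hom_I V h1 h2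
    have hr : W.hom (eRe j) = (τ j - values V.hom sol23 j).re := hom_eRe W h1 (by omega)
    have hi : W.hom (eIm j) = (τ j - values V.hom sol23 j).im := hom_eIm W h1 (by omega)
    have hRj := hR j h1 (by omega)
    have hIj := hI j h1 (by omega)
    apply Complex.ext
    · interval_cases j <;>
        simp [values, dev23, tval, hr] <;>
        simp [sol23, tval, hRj, pow_succ]
      all_goals ring
    · interval_cases j <;>
        simp [values, dev23, tval, hi] <;>
        simp [sol23, tval, hIj, pow_succ]
      all_goals ring
  have hτ : ∀ j, 1 ≤ j → j < 13 → τ j = values W.hom (addCoefs dev23 sol23) j := by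
    intro j h1 h2
    rw [values_addCoefs, hfree j h1 h2, values_change _ _ _ _ _ _ allB_isBase_sol23]
    ring
  have hγ : ∀ j, 1 ≤ j → j < 27 → γ j = values W.hom (addCoefs (dev3 26 26) sol33) j := by
    intro j h1 h2
    rw [values_addCoefs, values_dev3 _ _ _ _ _ _ h1 (by omega) (by norm_num),
      values_change _ _ _ _ _ _ allB_isBase_sol33]
    ring
  have key := (compatible_iff_den W.hom (A := sol22) (T := addCoefs dev23 sol23) (E := [])
    (L := sol32) (G := addCoefs (dev3 26 26) sol33) (K := [])
    (fun j h1 h2 => by rw [values_change _ _ _ _ _ _ allB_isBase_sol22, ha j h1 h2])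
    hτ (fun j _ _ => by simp [values_nil])
    (fun j h1 h2 => by rw [values_change _ _ _ _ _ _ allB_isBase_sol32, hα j h1 h2])
    hγ (fun j _ _ => by simp [values_nil])).1 h
  rw [← level3, ← den_collect, den_eq_zero_iff_of_checkSystem _ checkSystem_level3] at key
  have hmem : ∀ x ∈ (List.range' 1 26).map dRe ++ (List.range' 1 26).map dIm,
      x ∈ steps3.map Prod.fst := by decide +kernel
  have hz (x : ℕ) (hx : x ∈ steps3.map Prod.fst) : W.hom x = 0 := by
    obtain ⟨s, hs, rfl⟩ := List.mem_map.1 hx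
    exact key s hs
  have hdev : ∀ c ∈ dev23, ∀ t ∈ c, t.1 ∈ steps3.map Prod.fst := by decide +kernel
  have hd0 (j : ℕ) : values W.hom dev23 j = 0 := by
    have h0 (c : Coef) (hc : ∀ t ∈ c, W.hom t.1 = 0) : val W.hom c = 0 := by
      induction c with
      | nil => simp
      | cons t c ih =>
        rw [val_cons, ih fun s hs => hc s (List.mem_cons_of_mem _ hs), tval,
          hc t List.mem_cons_self]
        simp
    refine h0 _ fun t ht => hz _ ?_
    rcases Nat.lt_or_ge (j - 1) dev23.length with h | h
    · rw [List.getD_eq_getElem _ _ h] at ht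
      exact hdev _ (List.getElem_mem h) t ht
    · rw [List.getD_eq_default _ _ h] at ht
      simp at ht
  refine ⟨fun j h1 h2 => sub_eq_zero.1 ((hfree j h1 h2).symm.trans (hd0 j)),
    fun j h1 h2 => sub_eq_zero.1 ?_⟩
  have hr := hz _ (hmem (dRe j) (List.mem_append_left _
    (List.mem_map_of_mem (List.mem_range'_1.2 ⟨h1, by omega⟩))))
  have hi := hz _ (hmem (dIm j) (List.mem_append_right _
    (List.mem_map_of_mem (List.mem_range'_1.2 ⟨h1, by omega⟩))))
  rw [hom_dRe _ h1 (by omega)] at hr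
  rw [hom_dIm _ h1 (by omega)] at hi
  exact Complex.ext hr hi

theorem im_val_eq_zero (χ : ℕ →*₀ ℝ) {c : Coef} (h : part 1 c = []) : (val χ c).im = 0 := by
  obtain ⟨h1, h2, -⟩ := val_part_eq χ c
  rw [h1, h, val_nil, add_zero, h2]

theorem values_coef24 {a τ η : ℕ → ℂ} {j : ℕ} (h1 : 1 ≤ j) (h2 : j < 35) :
    η j = values (baseValues a τ η).hom coef24 j := by
  have h : ∀ j ∈ List.range' 1 34, coef24.getD (j - 1) [] =
      [(S j, 0, scaleS j), (T j, 1, scaleT j)] := by decide +kernel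
  have hs : (scaleS j : ℝ) ≠ 0 := by rw [scaleS]; split_ifs <;> norm_num
  have ht : (scaleT j : ℝ) ≠ 0 := by rw [scaleT]; split_ifs <;> norm_num
  rw [values, h j (List.mem_range'_1.2 ⟨h1, by omega⟩)]
  simp only [val_cons, val_nil, tval, hom_S _ h1 (by omega : j ≤ 34),
    hom_T _ h1 (by omega : j ≤ 34)]
  apply Complex.ext
  · simp [baseValues, mul_div_cancel₀ _ hs]
  · simp [baseValues, mul_div_cancel₀ _ ht]

/-- The conditions on the coefficients of `f_2(4)`: the values of the dependent coefficients and
the two constraints. -/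
structure Solvable (χ : ℕ →*₀ ℝ) : Prop where
  re : ∀ s ∈ depS, χ (S s.1) = (val χ s.2).re
  im : ∀ s ∈ depT, χ (T s.1) = (val χ s.2).re
  constraint₁ : χ (a * S 10) = (val χ rule₁.tail).re
  constraint₂ : χ (I 6 * T 32) = χ (I 8 * T 33)

theorem den_normal4 (χ : ℕ →*₀ ℝ) (hr : ∀ r ∈ rules24, (χ r.1 : ℂ) = val χ r.2)
    (h₁ : (χ (a * S 10) : ℂ) = val χ rule₁) (h₂ : (χ (I 6 * T 32) : ℂ) = val χ rule₂) :
    den χ normal4 = den χ level4 := by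
  have he (c : Coef) : val χ (eliminate c) = val χ c := by
    rw [eliminate, val_ccollect, val_crewrite χ _ _ h₂, val_crewrite χ _ _ h₁, val_ccollect,
      val_substitute χ _ _ hr, val_ccollect]
  rw [normal4, den_dropZero, den_map_coef χ _ he, den_gather]

theorem mem_rules24 {r : ℕ × Coef} (h : r ∈ rules24) :
    (∃ s ∈ depS, r = (S s.1, (eRe s.1, 0, 1) :: s.2)) ∨
      ∃ s ∈ depT, r = (T s.1, (eIm s.1, 0, 1) :: s.2) := by
  have aux (f : ℕ × Coef → ℕ × Coef) (l : List (ℕ × Coef)) (m : List (ℕ × Coef))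
      (h : r ∈ fold (fun s r => f s :: r) m l) : (∃ s ∈ l, r = f s) ∨ r ∈ m := by
    induction l with
    | nil => exact .inr h
    | cons s l ih =>
      rw [fold_cons, List.mem_cons] at h
      rcases h with h | h
      · exact .inl ⟨s, List.mem_cons_self, h⟩
      · rcases ih h with ⟨s', hs', e⟩ | h
        · exact .inl ⟨s', List.mem_cons_of_mem _ hs', e⟩
        · exact .inr h
  rcases aux (fun s => (S s.1, (eRe s.1, 0, 1) :: s.2)) _ _ h with h | h
  · exact .inl h
  · rcases aux (fun s => (T s.1, (eIm s.1, 0, 1) :: s.2)) _ _ h with h | h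
    · exact .inr h
    · simp at h

theorem compatible_four_iff {a τ η α γ κ : ℕ → ℂ}
    (ha : ∀ j, 1 ≤ j → j < 3 → a j = values (baseValues a τ η).hom sol22 j)
    (hτ : ∀ j, 1 ≤ j → j < 13 → τ j = values (baseValues a τ η).hom sol23 j)
    (hα : ∀ j, 1 ≤ j → j < 6 → α j = values (baseValues a τ η).hom sol32 j)
    (hγ : ∀ j, 1 ≤ j → j < 27 → γ j = values (baseValues a τ η).hom sol33 j) :
    Compatible 1 1 1 (force₂ a τ η) (force₃ α γ κ) 4 ↔
      (∀ j, 1 ≤ j → j < 78 → κ j = values (baseValues a τ η).hom sol34 j) ∧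
        Solvable (baseValues a τ η).hom := by
  set V := baseValues a τ η with hV
  set W := V.change (V.hom (Atom.a * S 10) - (val V.hom rule₁.tail).re)
    (V.hom (I 6 * T 32) - V.hom (I 8 * T 33)) (fun j => κ j - values V.hom sol34 j)
    (fun j => V.hom (S j) - (val V.hom ((depS.lookup j).getD [])).re)
    (fun j => V.hom (T j) - (val V.hom ((depT.lookup j).getD [])).re) with hW
  have hχ {n : ℕ} (hn : isBase [(n, 0, 1)] = true) : W.hom n = V.hom n := by
    have h : val W.hom [(n, 0, 1)] = val V.hom [(n, 0, 1)] := val_change V _ _ _ _ _ hn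
    simpa [tval] using h
  have hS : ∀ s ∈ depS, (1 ≤ s.1 ∧ s.1 ≤ 34) ∧ isBase [(S s.1, 0, 1)] = true ∧
      isBase s.2 = true ∧ part 1 s.2 = [] ∧ depS.lookup s.1 = some s.2 := by decide +kernel
  have hT : ∀ s ∈ depT, (1 ≤ s.1 ∧ s.1 ≤ 34) ∧ isBase [(T s.1, 0, 1)] = true ∧
      isBase s.2 = true ∧ part 1 s.2 = [] ∧ depT.lookup s.1 = some s.2 := by decide +kernel
  have heS : ∀ s ∈ depS, W.hom (eRe s.1) = V.hom (S s.1) - (val V.hom s.2).re := by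
    intro s hs
    obtain ⟨⟨h1, h2⟩, -, -, -, h3⟩ := hS s hs
    have e : W.eRe s.1 = V.hom (S s.1) - (val V.hom ((depS.lookup s.1).getD [])).re := rfl
    rw [hom_eRe _ h1 h2, e, h3, Option.getD_some]
  have heT : ∀ s ∈ depT, W.hom (eIm s.1) = V.hom (T s.1) - (val V.hom s.2).re := by
    intro s hs
    obtain ⟨⟨h1, h2⟩, -, -, -, h3⟩ := hT s hs
    have e : W.eIm s.1 = V.hom (T s.1) - (val V.hom ((depT.lookup s.1).getD [])).re := rfl
    rw [hom_eIm _ h1 h2, e, h3, Option.getD_some]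
  have hr : ∀ r ∈ rules24, (W.hom r.1 : ℂ) = val W.hom r.2 := by
    intro r hr
    rcases mem_rules24 hr with ⟨s, hs, rfl⟩ | ⟨s, hs, rfl⟩
    · obtain ⟨-, h1, h2, h3, -⟩ := hS s hs
      have hi := im_val_eq_zero V.hom h3
      rw [val_cons, val_change V _ _ _ _ _ h2, hχ h1]
      apply Complex.ext <;> simp [tval, heS s hs, hi]
    · obtain ⟨-, h1, h2, h3, -⟩ := hT s hs
      have hi := im_val_eq_zero V.hom h3
      rw [val_cons, val_change V _ _ _ _ _ h2, hχ h1]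
      apply Complex.ext <;> simp [tval, heT s hs, hi]
  have h₁ : (W.hom (Atom.a * S 10) : ℂ) = val W.hom rule₁ := by
    have hi := im_val_eq_zero V.hom (show part 1 rule₁.tail = [] by decide +kernel)
    have e : rule₁ = (c₁, 0, 1) :: rule₁.tail := rfl
    rw [e, val_cons, val_change V _ _ _ _ _ (by decide +kernel),
      hχ (by decide +kernel)]
    have : W.hom c₁ = V.hom (Atom.a * S 10) - (val V.hom rule₁.tail).re := hom_c₁ W
    apply Complex.ext <;> simp [tval, this, hi]
  have hc₂ : W.hom c₂ = V.hom (I 6 * T 32) - V.hom (I 8 * T 33) := hom_c₂ W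
  have h₂ : (W.hom (I 6 * T 32) : ℂ) = val W.hom rule₂ := by
    have e : W.hom (I 6 * T 32) = W.hom c₂ + W.hom (I 8 * T 33) := by
      rw [hc₂, hχ (by decide +kernel), hχ (by decide +kernel)]
      ring
    rw [e, rule₂]
    simp only [val_cons, val_nil, tval]
    push_cast
    ring
  have hκ : ∀ j, 1 ≤ j → j < 78 → κ j = values W.hom (addCoefs (dev3 77 77) sol34) j := by
    intro j h1 h2
    rw [values_addCoefs, values_dev3 _ _ _ _ _ _ h1 (by omega) (by norm_num),
      values_change _ _ _ _ _ _ allB_isBase_sol34]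
    ring
  rw [compatible_iff_den W.hom (A := sol22) (T := sol23) (E := coef24)
    (L := sol32) (G := sol33) (K := addCoefs (dev3 77 77) sol34)
    (fun j h1 h2 => by rw [values_change _ _ _ _ _ _ allB_isBase_sol22, ha j h1 h2])
    (fun j h1 h2 => by rw [values_change _ _ _ _ _ _ allB_isBase_sol23, hτ j h1 h2])
    (fun j h1 h2 => by rw [values_change _ _ _ _ _ _ allB_isBase_coef24, ← values_coef24 h1 h2])
    (fun j h1 h2 => by rw [values_change _ _ _ _ _ _ allB_isBase_sol32, hα j h1 h2])
    (fun j h1 h2 => by rw [values_change _ _ _ _ _ _ allB_isBase_sol33, hγ j h1 h2]) hκ,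
    ← level4, ← den_normal4 W.hom hr h₁ h₂, den_eq_zero_iff_of_checkSystem _ checkSystem_normal4]
  have hmem : ∀ x ∈ (List.range' 1 77).map dRe ++ ((List.range' 1 77).map dIm ++
      (depS.map (fun s => eRe s.1) ++ (depT.map (fun s => eIm s.1) ++ [c₁, c₂]))),
      x ∈ steps4.map Prod.fst := by decide +kernel
  have hmem' : ∀ x ∈ steps4.map Prod.fst, x ∈ (List.range' 1 77).map dRe ++
      ((List.range' 1 77).map dIm ++ (depS.map (fun s => eRe s.1) ++
        (depT.map (fun s => eIm s.1) ++ [c₁, c₂]))) := by decide +kernel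
  have hall : (∀ s ∈ steps4, W.hom s.1 = 0) ↔ ∀ x ∈ (List.range' 1 77).map dRe ++
      ((List.range' 1 77).map dIm ++ (depS.map (fun s => eRe s.1) ++
        (depT.map (fun s => eIm s.1) ++ [c₁, c₂]))), W.hom x = 0 := by
    constructor
    · intro h x hx
      obtain ⟨s, hs, rfl⟩ := List.mem_map.1 (hmem x hx)
      exact h s hs
    · exact fun h s hs => h _ (hmem' _ (List.mem_map_of_mem hs))
  rw [hall]
  simp only [List.forall_mem_append, List.forall_mem_map, List.forall_mem_cons,
    List.not_mem_nil, false_imp_iff, implies_true, and_true, List.mem_range'_1]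
  have hdR (j : ℕ) (h1 : 1 ≤ j) (h2 : j < 78) : W.hom (dRe j) = (κ j - values V.hom sol34 j).re :=
    hom_dRe W h1 (by omega)
  have hdI (j : ℕ) (h1 : 1 ≤ j) (h2 : j < 78) : W.hom (dIm j) = (κ j - values V.hom sol34 j).im :=
    hom_dIm W h1 (by omega)
  have hc₁ : W.hom c₁ = V.hom (Atom.a * S 10) - (val V.hom rule₁.tail).re := hom_c₁ W
  rw [hc₁, hc₂]
  constructor
  · rintro ⟨g1, g2, g3, g4, g5, g6⟩
    refine ⟨fun j h1 h2 => sub_eq_zero.1 (Complex.ext ?_ ?_), ?_, ?_, sub_eq_zero.1 g5,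
      sub_eq_zero.1 g6⟩
    · rw [← hdR j h1 h2, g1 j ⟨h1, by omega⟩, Complex.zero_re]
    · rw [← hdI j h1 h2, g2 j ⟨h1, by omega⟩, Complex.zero_im]
    · intro s hs
      rw [← sub_eq_zero, ← heS s hs, g3 s hs]
    · intro s hs
      rw [← sub_eq_zero, ← heT s hs, g4 s hs]
  · rintro ⟨g1, g2⟩
    refine ⟨fun j hj => ?_, fun j hj => ?_, fun s hs => ?_, fun s hs => ?_,
      sub_eq_zero.2 g2.constraint₁, sub_eq_zero.2 g2.constraint₂⟩
    · rw [hdR j hj.1 (by omega), g1 j hj.1 (by omega)]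
      simp
    · rw [hdI j hj.1 (by omega), g1 j hj.1 (by omega)]
      simp
    · rw [heS s hs, g2.re s hs, sub_self]
    · rw [heT s hs, g2.im s hs, sub_self]

theorem eq_of_sub_eq_mul {x y x' y' : ℝ} (z : ℝ) (h : x = y) (e : x' - y' = z * (x - y)) :
    x' = y' := by
  rw [← sub_eq_zero, e, h, sub_self, mul_zero]

theorem A4Relations.scale {ρ₁ ρ₂ a b c d : ℝ} {R I S T p q : ℕ → ℝ} (hρ₁ : ρ₁ ≠ 0) (hρ₂ : ρ₂ ≠ 0)
    (hc : c ≠ 0) (hd : d ≠ 0) (hp₁ : p 1 = d ^ 2 / c) (hp : ∀ j, 2 ≤ j → j ≤ 12 → p j = d)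
    (hq₁ : ∀ j ∈ [1, 2, 9, 10], q j = d ^ 2 / c)
    (hq : ∀ j, 1 ≤ j → j ≤ 34 → j ∉ [1, 2, 9, 10] → q j = d)
    (h : A4Relations ρ₁ ρ₂ a b R I S T) :
    A4Relations (c * ρ₁) (d * ρ₂) (d * a) (d * b) (fun j => p j * R j) (fun j => p j * I j)
      (fun j => q j * S j) (fun j => q j * T j) := by
  have h1 := hq₁ 1 (by simp)
  have h2 := hq₁ 2 (by simp)
  have h9 := hq₁ 9 (by simp)
  have h10 := hq₁ 10 (by simp)
  refine ⟨eq_of_sub_eq_mul (d ^ 2 / c) h.rel_T2 ?_, eq_of_sub_eq_mul d h.rel_T3 ?_,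
    eq_of_sub_eq_mul d h.rel_T4 ?_, eq_of_sub_eq_mul d h.rel_S5 ?_, eq_of_sub_eq_mul d h.rel_T5 ?_,
    eq_of_sub_eq_mul d h.rel_T7 ?_, eq_of_sub_eq_mul d h.rel_S8 ?_, eq_of_sub_eq_mul d h.rel_T8 ?_,
    eq_of_sub_eq_mul (d ^ 2 / c) h.rel_S9 ?_, eq_of_sub_eq_mul (d ^ 2 / c) h.rel_T9 ?_,
    eq_of_sub_eq_mul d h.rel_S11 ?_, eq_of_sub_eq_mul d h.rel_T11 ?_,
    eq_of_sub_eq_mul d h.rel_S12 ?_, eq_of_sub_eq_mul d h.rel_T12 ?_,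
    eq_of_sub_eq_mul d h.rel_S13 ?_, eq_of_sub_eq_mul d h.rel_T13 ?_,
    eq_of_sub_eq_mul d h.rel_S14 ?_, eq_of_sub_eq_mul d h.rel_T14 ?_,
    eq_of_sub_eq_mul d h.rel_S16 ?_, eq_of_sub_eq_mul d h.rel_T16 ?_,
    eq_of_sub_eq_mul d h.rel_S17 ?_, eq_of_sub_eq_mul d h.rel_T17 ?_,
    eq_of_sub_eq_mul d h.rel_S19 ?_, eq_of_sub_eq_mul d h.rel_T19 ?_,
    eq_of_sub_eq_mul d h.rel_S21 ?_, eq_of_sub_eq_mul d h.rel_T21 ?_,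
    eq_of_sub_eq_mul d h.rel_S23 ?_, eq_of_sub_eq_mul d h.rel_T23 ?_,
    eq_of_sub_eq_mul d h.rel_S24 ?_, eq_of_sub_eq_mul d h.rel_T24 ?_,
    eq_of_sub_eq_mul d h.rel_S25 ?_, eq_of_sub_eq_mul d h.rel_T25 ?_,
    eq_of_sub_eq_mul d h.rel_S26 ?_, eq_of_sub_eq_mul d h.rel_T26 ?_,
    eq_of_sub_eq_mul d h.rel_S28 ?_, eq_of_sub_eq_mul d h.rel_T28 ?_,
    eq_of_sub_eq_mul d h.rel_S29 ?_, eq_of_sub_eq_mul d h.rel_T29 ?_,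
    eq_of_sub_eq_mul d h.rel_S30 ?_, eq_of_sub_eq_mul d h.rel_T30 ?_,
    eq_of_sub_eq_mul d h.rel_S31 ?_, eq_of_sub_eq_mul d h.rel_T31 ?_,
    eq_of_sub_eq_mul d h.rel_S32 ?_, eq_of_sub_eq_mul d h.rel_S33 ?_,
    eq_of_sub_eq_mul d h.rel_S34 ?_, eq_of_sub_eq_mul d h.rel_T34 ?_,
    eq_of_sub_eq_mul (d ^ 4) h.constraint₁ ?_, eq_of_sub_eq_mul (d ^ 2) h.constraint₂ ?_⟩ <;>
  simp (discharger := decide) only [hp₁, hp, h1, h2, h9, h10, hq] <;>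
  (try field_simp) <;>
  ring

section
variable (χ : ℕ →*₀ ℝ)

theorem re_val_nil : (val χ []).re = 0 := by simp

theorem re_val_cons_zero (n k : ℕ) (c : Coef) :
    (val χ ((n, 0, k) :: c)).re = k * χ n + (val χ c).re := by
  simp [tval]

theorem re_val_cons_two (n k : ℕ) (c : Coef) :
    (val χ ((n, 2, k) :: c)).re = -(k * χ n) + (val χ c).re := by
  simp [tval]

end

theorem solvable_iff (a τ η : ℕ → ℂ) : Solvable (baseValues a τ η).hom ↔
    A4Relations 1 1 (a 1).re (a 2).re (fun j => (τ j).re) (fun j => (τ j).im)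
      (fun j => (η j).re) (fun j => (η j).im) := by
  set χ := (baseValues a τ η).hom with hχ
  have ha : χ Atom.a = (a 1).re / 4 := hom_a _
  have hb : χ Atom.b = (a 2).re / 4 := hom_b _
  have hR (j : ℕ) (h1 : 1 ≤ j) (h2 : j ≤ 12) : χ (R j) = (τ j).re / 8 := hom_R _ h1 h2
  have hI (j : ℕ) (h1 : 1 ≤ j) (h2 : j ≤ 12) : χ (I j) = (τ j).im / 8 := hom_I _ h1 h2
  have hS8 : ∀ j ∈ [5, 8, 9, 11, 12, 13, 14, 16, 17, 19, 21, 23, 24, 25, 26, 28, 29, 30, 31, 32,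
      33, 34],
      χ (S j) = (η j).re / 8 := by
    intro j hj
    have h : ∀ j ∈ [5, 8, 9, 11, 12, 13, 14, 16, 17, 19, 21, 23, 24, 25, 26, 28, 29, 30, 31, 32,
        33, 34],
        (1 ≤ j ∧ j ≤ 34) ∧ scaleS j = 8 := by decide +kernel
    obtain ⟨⟨h1, h2⟩, h3⟩ := h j hj
    simp [hχ, hom_S _ h1 h2, baseValues, h3]
  have hS16 : ∀ j ∈ [1, 2, 3, 4, 6, 7, 10, 15, 18, 20, 22, 27],
      χ (S j) = (η j).re / 16 := by
    intro j hj
    have h : ∀ j ∈ [1, 2, 3, 4, 6, 7, 10, 15, 18, 20, 22, 27],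
        (1 ≤ j ∧ j ≤ 34) ∧ scaleS j = 16 := by decide +kernel
    obtain ⟨⟨h1, h2⟩, h3⟩ := h j hj
    simp [hχ, hom_S _ h1 h2, baseValues, h3]
  have hT8 : ∀ j ∈ [2, 3, 4, 5, 7, 8, 9, 11, 12, 13, 14, 16, 17, 19, 21, 23, 24, 25, 26, 28, 29,
      30, 31, 34],
      χ (T j) = (η j).im / 8 := by
    intro j hj
    have h : ∀ j ∈ [2, 3, 4, 5, 7, 8, 9, 11, 12, 13, 14, 16, 17, 19, 21, 23, 24, 25, 26, 28, 29,
        30, 31, 34],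
        (1 ≤ j ∧ j ≤ 34) ∧ scaleT j = 8 := by decide +kernel
    obtain ⟨⟨h1, h2⟩, h3⟩ := h j hj
    simp [hχ, hom_T _ h1 h2, baseValues, h3]
  have hT16 : ∀ j ∈ [1, 6, 10, 15, 18, 20, 22, 27, 32, 33],
      χ (T j) = (η j).im / 16 := by
    intro j hj
    have h : ∀ j ∈ [1, 6, 10, 15, 18, 20, 22, 27, 32, 33],
        (1 ≤ j ∧ j ≤ 34) ∧ scaleT j = 16 := by decide +kernel
    obtain ⟨⟨h1, h2⟩, h3⟩ := h j hj
    simp [hχ, hom_T _ h1 h2, baseValues, h3]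
  have key : Solvable χ ↔ ((∀ s ∈ depS, χ (S s.1) = (val χ s.2).re) ∧
      ∀ s ∈ depT, χ (T s.1) = (val χ s.2).re) ∧ χ (Atom.a * S 10) = (val χ rule₁.tail).re ∧
      χ (I 6 * T 32) = χ (I 8 * T 33) :=
    ⟨fun h => ⟨⟨h.re, h.im⟩, h.constraint₁, h.constraint₂⟩,
      fun h => ⟨h.1.1, h.1.2, h.2.1, h.2.2⟩⟩
  rw [key]
  simp (discharger := decide) only [depS, depS_1, depS_2, depS_3, depS_4, depT, depT_1, depT_2,
    depT_3, depT_4, cat_eq, List.cons_append,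
    List.nil_append, List.forall_mem_cons, List.not_mem_nil, false_imp_iff, implies_true,
    and_true, rule₁, List.tail_cons, re_val_nil, re_val_cons_zero, re_val_cons_two, map_mul, ha,
    hb, hR, hI, hS8, hS16, hT8, hT16, and_assoc, Nat.cast_ofNat, Nat.cast_one]
  set x := (a 1).re
  set y := (a 2).re
  constructor
  · rintro ⟨
    s5, s8, s9, s11, s12, s13, s14, s16, s17, s19, s21, s23, s24, s25, s26, s28, s29, s30, s31,
    s32, s33, s34, t2, t3, t4, t5, t7, t8, t9, t11, t12, t13, t14, t16, t17, t19, t21, t23, t24,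
    t25, t26, t28, t29, t30, t31, t34, k₁, k₂⟩
    constructor
    · linear_combination 8 * t2 + 512 * (29/352) * k₁ +
        128 * (-35/88*x*x - 63/176*x*y - 1/176*y*y) * k₂
    · linear_combination 8 * t3 + 512 * (-1/16) * k₁ + 128 * (1/2*x*x + 1/4*x*y) * k₂
    · linear_combination 8 * t4 + 512 * (95/1056) * k₁ +
        128 * (-145/264*x*x + 1/176*x*y - 81/176*y*y) * k₂
    · linear_combination 8 * s5
    · linear_combination 8 * t5 + 512 * (-45/176) * k₁ +
        128 * (131/88*x*x - 125/176*x*y + 71/176*y*y) * k₂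
    · linear_combination 8 * t7 + 512 * (-31/176) * k₁ +
        128 * (89/44*x*x - 7/88*x*y + 193/88*y*y) * k₂
    · linear_combination 8 * s8
    · linear_combination 8 * t8 + 512 * (-23/88) * k₁ +
        128 * (65/44*x*x - 15/88*x*y + 27/88*y*y) * k₂
    · linear_combination 8 * s9 + 128 * (1/4*y) * k₂
    · linear_combination 8 * t9
    · linear_combination 8 * s11
    · linear_combination 8 * t11
    · linear_combination 8 * s12
    · linear_combination 8 * t12
    · linear_combination 8 * s13 + 128 * (2*x - 1*y) * k₂
    · linear_combination 8 * t13
    · linear_combination 8 * s14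
    · linear_combination 8 * t14
    · linear_combination 8 * s16
    · linear_combination 8 * t16
    · linear_combination 8 * s17 + 128 * (1/2*x - 1/4*y) * k₂
    · linear_combination 8 * t17
    · linear_combination 8 * s19
    · linear_combination 8 * t19
    · linear_combination 8 * s21
    · linear_combination 8 * t21
    · linear_combination 8 * s23 + 128 * (1/2*x + 3/4*y) * k₂
    · linear_combination 8 * t23
    · linear_combination 8 * s24 + 128 * (-1/2*x + 1/4*y) * k₂
    · linear_combination 8 * t24
    · linear_combination 8 * s25 + 128 * (3/2*x - 7/4*y) * k₂
    · linear_combination 8 * t25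
    · linear_combination 8 * s26
    · linear_combination 8 * t26 + 128 * (1) * k₂
    · linear_combination 8 * s28
    · linear_combination 8 * t28
    · linear_combination 8 * s29
    · linear_combination 8 * t29
    · linear_combination 8 * s30
    · linear_combination 8 * t30
    · linear_combination 8 * s31
    · linear_combination 8 * t31
    · linear_combination 8 * s32
    · linear_combination 8 * s33
    · linear_combination 8 * s34
    · linear_combination 8 * t34
    · linear_combination 512 * k₁
    · linear_combination 128 * k₂
  · intro h
    refine ⟨
      ?_, ?_, ?_, ?_, ?_, ?_, ?_, ?_, ?_, ?_, ?_, ?_, ?_, ?_, ?_, ?_, ?_, ?_, ?_, ?_, ?_, ?_,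
      ?_, ?_, ?_, ?_, ?_, ?_, ?_, ?_, ?_, ?_, ?_, ?_, ?_, ?_, ?_, ?_, ?_, ?_, ?_, ?_, ?_, ?_,
      ?_, ?_, ?_, ?_⟩
    · linear_combination h.rel_S5 / 8
    · linear_combination h.rel_S8 / 8
    · linear_combination h.rel_S9 / 8 - (1/4*y) / 8 * h.constraint₂
    · linear_combination h.rel_S11 / 8
    · linear_combination h.rel_S12 / 8
    · linear_combination h.rel_S13 / 8 - (2*x - 1*y) / 8 * h.constraint₂
    · linear_combination h.rel_S14 / 8
    · linear_combination h.rel_S16 / 8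
    · linear_combination h.rel_S17 / 8 - (1/2*x - 1/4*y) / 8 * h.constraint₂
    · linear_combination h.rel_S19 / 8
    · linear_combination h.rel_S21 / 8
    · linear_combination h.rel_S23 / 8 - (1/2*x + 3/4*y) / 8 * h.constraint₂
    · linear_combination h.rel_S24 / 8 - (-1/2*x + 1/4*y) / 8 * h.constraint₂
    · linear_combination h.rel_S25 / 8 - (3/2*x - 7/4*y) / 8 * h.constraint₂
    · linear_combination h.rel_S26 / 8
    · linear_combination h.rel_S28 / 8
    · linear_combination h.rel_S29 / 8
    · linear_combination h.rel_S30 / 8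
    · linear_combination h.rel_S31 / 8
    · linear_combination h.rel_S32 / 8
    · linear_combination h.rel_S33 / 8
    · linear_combination h.rel_S34 / 8
    · linear_combination h.rel_T2 / 8 - (29/352) / 8 * h.constraint₁ -
        (-35/88*x*x - 63/176*x*y - 1/176*y*y) / 8 * h.constraint₂
    · linear_combination h.rel_T3 / 8 - (-1/16) / 8 * h.constraint₁ -
        (1/2*x*x + 1/4*x*y) / 8 * h.constraint₂
    · linear_combination h.rel_T4 / 8 - (95/1056) / 8 * h.constraint₁ -
        (-145/264*x*x + 1/176*x*y - 81/176*y*y) / 8 * h.constraint₂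
    · linear_combination h.rel_T5 / 8 - (-45/176) / 8 * h.constraint₁ -
        (131/88*x*x - 125/176*x*y + 71/176*y*y) / 8 * h.constraint₂
    · linear_combination h.rel_T7 / 8 - (-31/176) / 8 * h.constraint₁ -
        (89/44*x*x - 7/88*x*y + 193/88*y*y) / 8 * h.constraint₂
    · linear_combination h.rel_T8 / 8 - (-23/88) / 8 * h.constraint₁ -
        (65/44*x*x - 15/88*x*y + 27/88*y*y) / 8 * h.constraint₂
    · linear_combination h.rel_T9 / 8
    · linear_combination h.rel_T11 / 8
    · linear_combination h.rel_T12 / 8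
    · linear_combination h.rel_T13 / 8
    · linear_combination h.rel_T14 / 8
    · linear_combination h.rel_T16 / 8
    · linear_combination h.rel_T17 / 8
    · linear_combination h.rel_T19 / 8
    · linear_combination h.rel_T21 / 8
    · linear_combination h.rel_T23 / 8
    · linear_combination h.rel_T24 / 8
    · linear_combination h.rel_T25 / 8
    · linear_combination h.rel_T26 / 8 - (1) / 8 * h.constraint₂
    · linear_combination h.rel_T28 / 8
    · linear_combination h.rel_T29 / 8
    · linear_combination h.rel_T30 / 8
    · linear_combination h.rel_T31 / 8
    · linear_combination h.rel_T34 / 8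
    · linear_combination h.constraint₁ / 512
    · linear_combination h.constraint₂ / 128

theorem a4Relations_iff {ρ₁ ρ₂ : ℝ} (h₁ : ρ₁ ≠ 0) (h₂ : ρ₂ ≠ 0) (a τ η : ℕ → ℂ) :
    A4Relations 1 1 (unscale ρ₁ (ρ₂ / ρ₁ : ℝ) monos22 a 1).re
      (unscale ρ₁ (ρ₂ / ρ₁ : ℝ) monos22 a 2).re
      (fun j => (unscale ρ₁ (ρ₂ / ρ₁ : ℝ) monos23 τ j).re)
      (fun j => (unscale ρ₁ (ρ₂ / ρ₁ : ℝ) monos23 τ j).im)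
      (fun j => (unscale ρ₁ (ρ₂ / ρ₁ : ℝ) monos24 η j).re)
      (fun j => (unscale ρ₁ (ρ₂ / ρ₁ : ℝ) monos24 η j).im) ↔
    A4Relations ρ₁ ρ₂ (a 1).re (a 2).re (fun j => (τ j).re) (fun j => (τ j).im)
      (fun j => (η j).re) (fun j => (η j).im) := by
  let w (ms : List (List ℕ)) (j : ℕ) : ℝ := ρ₁ * (ρ₂ / ρ₁) ^ conjCount (ms.getD (j - 1) [])
  have hw (ms : List (List ℕ)) (j : ℕ) : w ms j ≠ 0 :=
    mul_ne_zero h₁ (pow_ne_zero _ (div_ne_zero h₂ h₁))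
  have hu (ms : List (List ℕ)) (c : ℕ → ℂ) (j : ℕ) :
      unscale ρ₁ (ρ₂ / ρ₁ : ℝ) ms c j = c j / (w ms j : ℝ) := by
    simp [unscale, w]
  have e₁ {ms : List (List ℕ)} {j : ℕ} (h : conjCount (ms.getD (j - 1) []) = 1) : w ms j = ρ₂ := by
    simp only [w, h]
    field_simp
  have e₂ {ms : List (List ℕ)} {j : ℕ} (h : conjCount (ms.getD (j - 1) []) = 2) :
      w ms j = ρ₂ ^ 2 / ρ₁ := by
    simp only [w, h]
    field_simp
  have ha : ∀ j ∈ [1, 2], w monos22 j = ρ₂ := fun j hj => e₁ <| by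
    have h : ∀ j ∈ [1, 2], conjCount (monos22.getD (j - 1) []) = 1 := by decide +kernel
    exact h j hj
  have hp₁ : w monos23 1 = ρ₂ ^ 2 / ρ₁ := e₂ (by decide +kernel)
  have hp (j : ℕ) (hj : 2 ≤ j) (hj' : j ≤ 12) : w monos23 j = ρ₂ := e₁ <| by
    have h : ∀ j < 13, 2 ≤ j → conjCount (monos23.getD (j - 1) []) = 1 := by decide +kernel
    exact h j (by omega) hj
  have hq₁ : ∀ j ∈ [1, 2, 9, 10], w monos24 j = ρ₂ ^ 2 / ρ₁ := fun j hj => e₂ <| by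
    have h : ∀ j ∈ [1, 2, 9, 10], conjCount (monos24.getD (j - 1) []) = 2 := by decide +kernel
    exact h j hj
  have hq (j : ℕ) (hj : 1 ≤ j) (hj' : j ≤ 34) (hn : j ∉ [1, 2, 9, 10]) : w monos24 j = ρ₂ :=
    e₁ <| by
    have h : ∀ j < 35, 1 ≤ j → j ∉ [1, 2, 9, 10] →
        conjCount (monos24.getD (j - 1) []) = 1 := by decide +kernel
    exact h j (by omega) hj hn
  simp only [hu, Complex.div_ofReal_re, Complex.div_ofReal_im, ha 1 (by simp), ha 2 (by simp)]
  constructor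
  · intro h
    have := h.scale one_ne_zero one_ne_zero h₁ h₂ hp₁ hp hq₁ hq
    simpa [mul_div_cancel₀ _ (hw _ _), mul_div_cancel₀ _ h₂] using this
  · intro h
    have := h.scale (c := ρ₁⁻¹) (d := ρ₂⁻¹) (p := fun j => (w monos23 j)⁻¹)
      (q := fun j => (w monos24 j)⁻¹) h₁ h₂ (inv_ne_zero h₁) (inv_ne_zero h₂)
      (by rw [hp₁]; field_simp) (fun j hj hj' => by rw [hp j hj hj'])
      (fun j hj => by rw [hq₁ j hj]; field_simp) (fun j hj hj' hn => by rw [hq j hj hj' hn])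
    simpa [h₁, h₂, div_eq_inv_mul] using this

theorem gen_ite (a b : ℂ) : gen monos22 1 (fun j => if j = 1 then a else b) = f22 a b :=
  gen22 _

end MultiscaleNLS

theorem mainTheorem6 (ρ₁ ρ₂ B : ℝ) (hρ₁ : ρ₁ ≠ 0) (hρ₂ : ρ₂ ≠ 0) (hB : B ≠ 0)
    (a b : ℂ) (τ η : ℕ → ℂ) (α γ : ℕ → ℂ)
    (h2 : Compatible ρ₁ ρ₂ B (forcing (f22 a b) 0 0) (forcing (f32 α) 0 0) 2)
    (h3 : Compatible ρ₁ ρ₂ B (forcing (f22 a b) (f23 τ) 0) (forcing (f32 α) (f33 γ) 0) 3) :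
    ((∃ κ : ℕ → ℂ, Compatible ρ₁ ρ₂ B (forcing (f22 a b) (f23 τ) (f24 η))
        (forcing (f32 α) (f33 γ) (f34 κ)) 4) ↔
      A4Relations ρ₁ ρ₂ a.re b.re (fun j => (τ j).re) (fun j => (τ j).im)
        (fun j => (η j).re) (fun j => (η j).im)) ∧
    (∀ κ κ' : ℕ → ℂ,
      Compatible ρ₁ ρ₂ B (forcing (f22 a b) (f23 τ) (f24 η))
        (forcing (f32 α) (f33 γ) (f34 κ)) 4 →
      Compatible ρ₁ ρ₂ B (forcing (f22 a b) (f23 τ) (f24 η))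
        (forcing (f32 α) (f33 γ) (f34 κ')) 4 →
      ∀ m ∈ Finset.Icc 1 77, κ m = κ' m) := by
  let c (j : ℕ) : ℂ := if j = 1 then a else b
  let t : ℂ := (ρ₂ / ρ₁ : ℝ)
  have ht : t ≠ 0 := Complex.ofReal_ne_zero.2 (div_ne_zero hρ₂ hρ₁)
  have hB' : (B : ℂ) ≠ 0 := by exact_mod_cast hB
  have hs (j : ℕ) : (B : ℂ) * t ^ conjCount (monos34.getD (j - 1) []) ≠ 0 :=
    mul_ne_zero hB' (pow_ne_zero _ ht)
  have h2' := (compatible_unscale_iff hρ₁ hρ₂ hB c (fun _ => 0) (fun _ => 0) α (fun _ => 0)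
    (fun _ => 0) 2).1 (by simpa only [force₂, force₃, c, gen_ite, gen32, gen_zero] using h2)
  have h3' := (compatible_unscale_iff hρ₁ hρ₂ hB c τ (fun _ => 0) α γ (fun _ => 0) 3).1
    (by simpa only [force₂, force₃, c, gen_ite, gen32, gen23, gen33, gen_zero] using h3)
  rw [unscale_zero, unscale_zero, unscale_zero, unscale_zero] at h2'
  rw [unscale_zero, unscale_zero] at h3'
  have key (κ : ℕ → ℂ) := (compatible_unscale_iff hρ₁ hρ₂ hB c τ η α γ κ 4).trans <|
    have l2 := eq_of_level2 (unscale ρ₁ t monos23 τ) (unscale ρ₁ t monos24 η) h2'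
    have l3 := eq_of_level3 (unscale ρ₁ t monos24 η) l2.1 l2.2 h3'
    compatible_four_iff l2.1 l3.1 l2.2 l3.2
  simp only [solvable_iff, a4Relations_iff hρ₁ hρ₂, force₂, force₃, c, gen_ite, gen32, gen23,
    gen33, gen24, gen34, if_true, if_neg (show (2 : ℕ) ≠ 1 by norm_num)] at key
  refine ⟨⟨fun ⟨κ, hκ⟩ => ((key κ).1 hκ).2, fun h => ?_⟩, fun κ κ' h h' m hm => ?_⟩
  · refine ⟨_, (key fun j => (B * t ^ conjCount (monos34.getD (j - 1) [])) *
      values (baseValues (unscale ρ₁ t monos22 c) (unscale ρ₁ t monos23 τ)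
        (unscale ρ₁ t monos24 η)).hom sol34 j).2 ⟨fun j _ _ => ?_, h⟩⟩
    exact mul_div_cancel_left₀ _ (hs j)
  · obtain ⟨h1, h77⟩ := Finset.mem_Icc.1 hm
    have e := (((key κ).1 h).1 m h1 (by omega)).trans
      (((key κ').1 h').1 m h1 (by omega)).symm
    exact (div_left_inj' (hs m)).1 e
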